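/- **Setting.** Let $n\ge 1$ and let $T\ge 1$ be an integer such that $K:=T^{2/3}$ is an integer (so $T$ is a perfect cube and $T/K=T^{1/3}$). Let $\mathcal K\subset\mathbb R^n$ be convex and compact with $r\mathcal B^n\subseteq\mathcal K\subseteq R\mathcal B^n$, $r>0$, where $\mathcal B^n$ is the closed Euclidean unit ball, and write $\mathcal K_\delta:=(1-\delta/r)\mathcal K$. Let $\alpha,G,M>0$ and let $f_1,\dots,f_T$ be loss functions, fixed in advance (oblivious adversary), that on $\mathcal K$ are $\alpha$-strongly convex, $G$-Lipschitz and bounded in absolute value by $M$. Put $T_0=\max\{4T^{2/3},8/\alpha\}$ and $\epsilon_m=16R^2\beta_m^{1/3}$ with $\beta_m=\alpha(mK+T_0)$. **Algorithm** (blocked bandit Frank-Wolfe with parameter $\delta\in(0,r]$). Choose $\mathbf x_0\in\mathcal K_\delta$ arbitrarily and set $\mathbf x_1=\mathbf x_0$. For each block $m=1,\dots,T/K$ and each round $t=(m-1)K+s$, $s=1,\dots,K$: draw $\mathbf u_t$ uniformly from the unit sphere, independently of the past, play $\mathbf y_t=\mathbf x_{m-1}+\delta\mathbf u_t$, observe $f_t(\mathbf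 y_t)$, and put $\mathbf g_t=\frac n\delta f_t(\mathbf y_t)\mathbf u_t$; at the end of the block put $\hat{\mathbf g}_m=\sum_{s=1}^K\mathbf g_{(m-1)K+s}$. If $m\ge2$, then in parallel to block $m$ the point $\mathbf x_m$ is computed by Frank-Wolfe applied over $\mathcal K_\delta$ to $$\hat F_m(\mathbf x)=\sum_{i=1}^{m-1}\Big(\mathbf x^\top\hat{\mathbf g}_i+\tfrac{K\alpha}{2}\|\mathbf x-\mathbf x_{i-1}\|^2\Big)+\tfrac{T_0\alpha}{2}\|\mathbf x-\mathbf x_1\|^2 :$$ start at $\mathbf z_1=\mathbf x_{m-1}$; for $\tau=1,2,\dots$ call the linear optimization oracle for $\mathbf v_\tau\in\arg\min_{\mathbf x\in\mathcal K_\delta}\nabla\hat F_m(\mathbf z_\tau)^\top\mathbf x$ and set $\mathbf z_{\tau+1}=\mathbf z_\tau+\sigma_\tau(\mathbf v_\tau-\mathbf z_\tau)$ with $\sigma_\tau\in\arg\min_{\sigma\in[0,1]}\hat F_m(\mathbf z_\tau+\sigma(\mathbf v_\tau-\mathbf z_\tau))$, until $\nabla\hat F_m(\mathbf z_\tau)^\top(\mathbf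 z_\tau-\mathbf v_\tau)\le\epsilon_m$; then $\mathbf x_m=\mathbf z_\tau$ and $L_m=\tau$ is the number of oracle calls ($L_1=0$). The choice among several minimizers is arbitrary but must not depend on future randomness. The regret is $\mathcal R_T=\sum_{t=1}^Tf_t(\mathbf y_t)-\min_{\mathbf x\in\mathcal K}\sum_{t=1}^Tf_t(\mathbf x)$. **Theorem.** For every $c>0$ with $cT^{-1/3}/r\le1$, the algorithm with $\delta=cT^{-1/3}$ satisfies $$\mathbb E[\mathcal R_T]\le\Big(\frac{4cRG}{r}+2R^2\alpha+\frac{16RG}{\alpha^{1/3}}\Big)T^{2/3}+16R^2+\Big(\frac{2nM}{c\sqrt\alpha}+\frac{2G}{\sqrt\alpha}+4R\sqrt\alpha\Big)^2T^{2/3}(1+\ln T),$$ $$\mathbb E\Big[\sum_{m=1}^{T/K}L_m\Big]\le\Big(\frac{nM}{2cR}+\frac G{2R}+\alpha\Big)T+\frac1{\alpha^{2/3}}\Big(\frac{nM}{2cR}+\frac G{2R}+\alpha\Big)^2T+T^{1/3}.$$ If $T$ is large in terms of $\alpha$ alone, the bounds improve: if $\alpha T^{2/3}\ge2$, the last term $T^{1/3}$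 of the second bound can be dropped; if moreover $\alpha^{1/3}(1+\ln T)\ge1$, then in the first bound $16R^2$ can be dropped and $\frac{16RG}{\alpha^{1/3}}$ can be replaced by $\frac{4G}{\alpha^{1/3}}$. In particular, if $T\ge2$ and $\frac{(nM)^2\ln T}{r^2GR\alpha}\le T$, then with $c=\big(r(nM)^2\ln T/(GR\alpha)\big)^{1/3}$ $$\mathbb E[\mathcal R_T]\le\Big(\frac{4(nMGR)^{2/3}(\ln T)^{1/3}}{\alpha^{1/3}r^{2/3}}+2R^2\alpha+\frac{16RG}{\alpha^{1/3}}\Big)T^{2/3}+16R^2+\Big(\frac{2(nMGR)^{1/3}}{\alpha^{1/6}r^{1/3}(\ln T)^{1/3}}+\frac{2G}{\sqrt\alpha}+4R\sqrt\alpha\Big)^2T^{2/3}(1+\ln T),$$ $$\mathbb E\Big[\sum_{m=1}^{T/K}L_m\Big]\le AT+\frac{A^2}{\alpha^{2/3}}T+T^{1/3},\qquad A=\frac{(nMG\alpha)^{1/3}}{2r^{1/3}R^{2/3}(\ln T)^{1/3}}+\frac G{2R}+\alpha,$$ with the same improvements under the same conditions. Thus, for fixed $\alpha,G,M,r,R$,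 the expected regret for the optimized choice of $c$ is $O\big((nT)^{2/3}(\ln T)^{1/3}+T^{2/3}\ln T\big)$, and for fixed $n$ as well the expected number of oracle calls is $O(T)$. -/

import Mathlib

open MeasureTheory ProbabilityTheory
open scoped Pointwise RealInnerProductSpace

noncomputable section

/-- The space `ℝⁿ` with the Euclidean norm. -/
abbrev Vec (n : ℕ) : Type := EuclideanSpace ℝ (Fin n)

/-- The unit sphere of `ℝⁿ`. -/
abbrev USphere (n : ℕ) : Type := Metric.sphere (0 : Vec n) 1

/-- The uniform probability measure on the unit sphere (normalized surface measure). -/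
def uniformSphere (n : ℕ) : Measure (USphere n) :=
  ((volume : Measure (Vec n)).toSphere Set.univ)⁻¹ • (volume : Measure (Vec n)).toSphere

/-- The shrunk feasible set `(1 - δ / r) 𝒦`. -/
def shrunkSet {n : ℕ} (𝒦 : Set (Vec n)) (r δ : ℝ) : Set (Vec n) :=
  (1 - δ / r) • 𝒦

/-! ### Frank-Wolfe with a stopping condition -/

/-- `z 1, z 2, …` and `v 1, v 2, …` are iterates and linear-optimization answers of Frank-Wolfe
with line search for `F` over `S`, started at `xin`. The sequences are indexed by all `τ ≥ 1`;
where the loop is left is recorded by `fwCalls`. -/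
structure IsFrankWolfe {n : ℕ} (S : Set (Vec n)) (F : Vec n → ℝ) (xin : Vec n)
    (z v : ℕ → Vec n) : Prop where
  init : z 1 = xin
  oracle : ∀ τ, 1 ≤ τ → v τ ∈ S ∧ IsMinOn (fun w => ⟪gradient F (z τ), w⟫) S (v τ)
  step : ∀ τ, 1 ≤ τ → ∃ σ ∈ Set.Icc (0 : ℝ) 1,
    IsMinOn (fun s : ℝ => F (z τ + s • (v τ - z τ))) (Set.Icc (0 : ℝ) 1) σ ∧
      z (τ + 1) = z τ + σ • (v τ - z τ)

/-- The quantity tested by the stopping condition after iteration `τ`. -/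
def fwGap {n : ℕ} (F : Vec n → ℝ) (z v : ℕ → Vec n) (τ : ℕ) : ℝ :=
  ⟪gradient F (z τ), z τ - v τ⟫

/-- The number of iterations of the do-while loop, which is the number of calls to the
linear-optimization oracle: the first `τ ≥ 1` at which the tested quantity is at most `ε`
(and `⊤` if the loop is never left). -/
def fwCalls {n : ℕ} (F : Vec n → ℝ) (ε : ℝ) (z v : ℕ → Vec n) : ℕ∞ :=
  ⨅ τ : ℕ, ⨅ _ : 1 ≤ τ ∧ fwGap F z v τ ≤ ε, (τ : ℕ∞)

/-! ### The bandit algorithm with blocks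

Rounds `t = 1, …, T` and blocks `m = 1, …, T / K`; block `m` consists of the rounds
`(m - 1) K + s` with `s = 1, …, K`. -/

/-- The point played in round `t`: if `t` lies in block `m`, then `m - 1 = (t - 1) / K`, and the
point is `x (m - 1) + δ u t`. -/
def play {n : ℕ} (K : ℕ) (δ : ℝ) (x : ℕ → Vec n) (u : ℕ → USphere n) (t : ℕ) : Vec n :=
  x ((t - 1) / K) + δ • (u t : Vec n)

/-- The one-point gradient estimate `(n / δ) f_t(y_t) u_t` of round `t`. -/
def roundEstimate {n : ℕ} (K : ℕ) (δ : ℝ) (f : ℕ → Vec n → ℝ) (x : ℕ → Vec n)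
    (u : ℕ → USphere n) (t : ℕ) : Vec n :=
  ((n : ℝ) / δ * f t (play K δ x u t)) • (u t : Vec n)

/-- The sum of the gradient estimates over block `m`. -/
def blockEstimate {n : ℕ} (K : ℕ) (δ : ℝ) (f : ℕ → Vec n → ℝ) (x : ℕ → Vec n)
    (u : ℕ → USphere n) (m : ℕ) : Vec n :=
  ∑ s ∈ Finset.Icc 1 K, roundEstimate K δ f x u ((m - 1) * K + s)

/-- The regularized objective of block `m`. -/
def blockObjective {n : ℕ} (K : ℕ) (α δ T₀ : ℝ) (f : ℕ → Vec n → ℝ) (x : ℕ → Vec n)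
    (u : ℕ → USphere n) (m : ℕ) (w : Vec n) : ℝ :=
  (∑ i ∈ Finset.Icc 1 (m - 1),
      (⟪w, blockEstimate K δ f x u i⟫ + K * (α / 2) * ‖w - x (i - 1)‖ ^ 2)) +
    T₀ * (α / 2) * ‖w - x 1‖ ^ 2

/-- One realization of the blocked bandit Frank-Wolfe algorithm, for given exploration
directions `u`: `x m` are the block iterates, and `z m`, `v m` are the iterates and the oracle
answers of the Frank-Wolfe procedure that is run during block `m ≥ 2`. -/
structure IsBanditFWPath {n : ℕ} (𝒦 : Set (Vec n)) (r : ℝ) (T K : ℕ) (α δ T₀ : ℝ) (ε : ℕ → ℝ)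
    (f : ℕ → Vec n → ℝ) (u : ℕ → USphere n) (x : ℕ → Vec n) (z v : ℕ → ℕ → Vec n) : Prop where
  start : x 0 ∈ shrunkSet 𝒦 r δ
  first : x 1 = x 0
  inner : ∀ m ∈ Finset.Icc 2 (T / K),
    IsFrankWolfe (shrunkSet 𝒦 r δ) (blockObjective K α δ T₀ f x u m) (x (m - 1)) (z m) (v m)
  output : ∀ m ∈ Finset.Icc 2 (T / K), ∀ τ : ℕ,
    fwCalls (blockObjective K α δ T₀ f x u m) (ε m) (z m) (v m) = τ → x m = z m τ

/-- A randomized run of the algorithm. `ℱ t` is the information available after round `t`.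
The direction `u t` is uniform on the sphere and independent of the past. The starting point and
the oracle's choices among several minimizers are arbitrary (they may even be randomized), but
they do not look into the future; the Frank-Wolfe procedure of block `m` is executed in parallel
to the rounds of that block, so that its answers are known when the block ends. -/
structure IsBanditFWRun {n : ℕ} (𝒦 : Set (Vec n)) (r : ℝ) (T K : ℕ) (α δ T₀ : ℝ) (ε : ℕ → ℝ)
    (f : ℕ → Vec n → ℝ) {Ω : Type*} [mΩ : MeasurableSpace Ω] (P : Measure Ω)
    (ℱ : Filtration ℕ mΩ) (u : ℕ → Ω → USphere n) (x : ℕ → Ω → Vec n)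
    (z v : ℕ → ℕ → Ω → Vec n) : Prop where
  u_measurable : ∀ t ∈ Finset.Icc 1 T, Measurable[ℱ t] (u t)
  u_law : ∀ t ∈ Finset.Icc 1 T, P.map (u t) = uniformSphere n
  u_indep : ∀ t ∈ Finset.Icc 1 T,
    Indep (MeasurableSpace.comap (u t) inferInstance) (ℱ (t - 1)) P
  start_measurable : Measurable[ℱ 0] (x 0)
  oracle_measurable : ∀ m ∈ Finset.Icc 2 (T / K), ∀ τ, 1 ≤ τ → Measurable[ℱ (m * K)] (v m τ)
  path : ∀ ω, IsBanditFWPath 𝒦 r T K α δ T₀ ε f (fun t => u t ω) (fun m => x m ω)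
    (fun m τ => z m τ ω) (fun m τ => v m τ ω)

/-- The regret of one realization. -/
def regret {n : ℕ} (𝒦 : Set (Vec n)) (T K : ℕ) (δ : ℝ) (f : ℕ → Vec n → ℝ) (x : ℕ → Vec n)
    (u : ℕ → USphere n) : ℝ :=
  ∑ t ∈ Finset.Icc 1 T, f t (play K δ x u t) -
    ⨅ w : 𝒦, ∑ t ∈ Finset.Icc 1 T, f t (w : Vec n)

/-- The overall number of calls to the linear-optimization oracle in one realization (no call is
made during the first block). -/
def totalCalls {n : ℕ} (T K : ℕ) (α δ T₀ : ℝ) (ε : ℕ → ℝ) (f : ℕ → Vec n → ℝ)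
    (x : ℕ → Vec n) (u : ℕ → USphere n) (z v : ℕ → ℕ → Vec n) : ℕ∞ :=
  ∑ m ∈ Finset.Icc 2 (T / K),
    fwCalls (blockObjective K α δ T₀ f x u m) (ε m) (z m) (v m)

/-- The regret of a run is integrable and its expectation is at most `B`. -/
def ExpectedRegretLE {n : ℕ} (𝒦 : Set (Vec n)) (T K : ℕ) (δ : ℝ) (f : ℕ → Vec n → ℝ)
    {Ω : Type*} [MeasurableSpace Ω] (P : Measure Ω) (u : ℕ → Ω → USphere n)
    (x : ℕ → Ω → Vec n) (B : ℝ) : Prop :=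
  Integrable (fun ω => regret 𝒦 T K δ f (fun m => x m ω) (fun t => u t ω)) P ∧
    ∫ ω, regret 𝒦 T K δ f (fun m => x m ω) (fun t => u t ω) ∂P ≤ B

/-- The number of oracle calls of a run is measurable and its expectation is at most `B`. -/
def ExpectedCallsLE {n : ℕ} (T K : ℕ) (α δ T₀ : ℝ) (ε : ℕ → ℝ) (f : ℕ → Vec n → ℝ)
    {Ω : Type*} [MeasurableSpace Ω] (P : Measure Ω) (u : ℕ → Ω → USphere n)
    (x : ℕ → Ω → Vec n) (z v : ℕ → ℕ → Ω → Vec n) (B : ℝ) : Prop :=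
  Measurable (fun ω => ((totalCalls T K α δ T₀ ε f (fun m => x m ω) (fun t => u t ω)
      (fun m τ => z m τ ω) (fun m τ => v m τ ω) : ℕ∞) : ENNReal)) ∧
    ∫⁻ ω, ((totalCalls T K α δ T₀ ε f (fun m => x m ω) (fun t => u t ω)
      (fun m τ => z m τ ω) (fun m τ => v m τ ω) : ℕ∞) : ENNReal) ∂P ≤ ENNReal.ofReal B

end

/-!
The regret argument treats block `k` as one step of follow-the-regularized-leader on the surrogate
losses `w ↦ ⟪w, g k⟫ + K α / 2 * ‖w - x k‖ ^ 2`, where `g k` is the sum of the one-point gradient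
estimates of the block, with two defects: the oracle calls run in parallel to a block, so that the
iterate is one block late, and it is only an approximate minimizer (`IsDelayedFTRL`). All objectives
are quadratics with Hessian a multiple `curvature` of the identity, so that their constrained
minimizers, the leaders, are nearest-point projections.

* *Smoothing.* The mean of a one-point estimate is the gradient of the average of the loss over a
  ball (`hasDerivAt_ballAverage`). Averages inherit strong convexity and the Lipschitz constant, so
  the means have norm at most `G`, and a loss differs from its average by at most `G δ`. The flux
  formula for this gradient is obtained by differentiating in polar coordinates
  (`hasDerivAt_integral_ball`), which needs no more than continuity.
* *Moments.* Inside a block the deviations of the estimates from their means are orthogonal, so the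
  second moment of `g k` is at most `K (n M / δ) ^ 2 + (K G) ^ 2`
  (`integral_norm_sq_sum_estimate_le`). With `δ` of order `T ^ (-1 / 3)` and `K = T ^ (2 / 3)`, both
  summands have the order of `K ^ 2`: this balance is the reason for working in blocks.
* *Regret.* Up to the regularization the leader has no regret; the loss from being late is a
  stability term `‖g k‖ ^ 2 / curvature`, which sums to a logarithm. The approximation error enters
  only through `⟪g k, x k - leader⟫`, whose second argument is known before the block starts. In
  expectation `g k` may therefore be replaced by its mean, of norm at most `K G` instead of
  `K n M / δ` (`IsDelayedFTRL.regret_le`, `IsBanditFWRun.integral_regret_le`).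
* *Oracle calls.* While the Frank-Wolfe gap exceeds `16 R ^ 2 β ^ (1 / 3)`, line search decreases
  the objective by at least `32 R ^ 2 β ^ (-1 / 3)`. The optimality gap left by one block is the
  starting gap of the next one apart from the effect of one new loss, and weighting it by
  `β ^ (1 / 3)` makes it a potential that bounds the total number of calls
  (`IsDelayedFTRL.sum_calls_le`).

Expectations only make sense for measurable iterates. The oracle answers are adapted by assumption;
line search and the stopping time are functions of them (`IsBanditFWRun.adapted`).

The stated constants leave slack: of the squared term only `2 D ^ 2 / α + 4 D R` out of
`4 D ^ 2 / α + 16 D R + 16 R ^ 2 α`, with `D = n M / c + G`, is needed for stability, and the rest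
absorbs the regularization and, for large `T`, the approximation error.
-/

noncomputable section

/-! ### Polar coordinates and the gradient of ball averages -/

/-- Integration in polar coordinates, for integrands that need not be radial. -/
lemma integral_polar {n : ℕ} [Nontrivial (Vec n)] {F : Vec n → ℝ} (hF : Integrable F) :
    Integrable (fun u : USphere n => ∫ ρ in Set.Ioi (0 : ℝ), ρ ^ (n - 1) * F (ρ • (u : Vec n)))
        (volume : Measure (Vec n)).toSphere ∧
      ∫ w, F w = ∫ u : USphere n, (∫ ρ in Set.Ioi (0 : ℝ), ρ ^ (n - 1) * F (ρ • (u : Vec n)))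
        ∂(volume : Measure (Vec n)).toSphere := by
  have hmp := (volume : Measure (Vec n)).measurePreserving_homeomorphUnitSphereProd
  have hemb := (homeomorphUnitSphereProd (Vec n)).measurableEmbedding
  set H : USphere n × Set.Ioi (0 : ℝ) → ℝ := fun p => F ((p.2 : ℝ) • (p.1 : Vec n)) with hH
  have hcomp : ∀ w : ({0}ᶜ : Set (Vec n)), H (homeomorphUnitSphereProd (Vec n) w) = F w := by
    intro w
    have hw : ‖(w : Vec n)‖ ≠ 0 := norm_ne_zero_iff.2 w.2
    simp [hH, smul_smul, hw]
  have hinner : ∀ u : USphere n,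
      ∫ ρ : Set.Ioi (0 : ℝ), H (u, ρ) ∂Measure.volumeIoiPow (n - 1)
        = ∫ ρ in Set.Ioi (0 : ℝ), ρ ^ (n - 1) * F (ρ • (u : Vec n)) := by
    intro u
    simp only [Measure.volumeIoiPow, ENNReal.ofReal, hH]
    rw [integral_withDensity_eq_integral_smul,
      integral_subtype_comap measurableSet_Ioi
        fun a : ℝ ↦ Real.toNNReal (a ^ (n - 1)) • F (a • (u : Vec n)),
      setIntegral_congr_fun measurableSet_Ioi fun x hx ↦ ?_]
    · rw [NNReal.smul_def, Real.coe_toNNReal _ (pow_nonneg hx.out.le _), smul_eq_mul]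
    · exact (measurable_subtype_coe.pow_const _).real_toNNReal
  rw [finrank_euclideanSpace_fin] at hmp
  have hint : Integrable H ((volume : Measure (Vec n)).toSphere.prod
      (Measure.volumeIoiPow (n - 1))) := by
    rw [← hmp.integrable_comp_emb hemb]
    have h1 : IntegrableOn F ({0}ᶜ : Set (Vec n)) := hF.integrableOn
    rw [integrableOn_iff_comap_subtypeVal (measurableSet_singleton _).compl] at h1
    exact h1.congr (Filter.Eventually.of_forall fun w => (hcomp w).symm)
  refine ⟨by simpa only [hinner] using hint.integral_prod_left, ?_⟩
  calc ∫ w, F w = ∫ w : ({0}ᶜ : Set (Vec n)), F w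
          ∂((volume : Measure (Vec n)).comap Subtype.val) := by
        rw [integral_subtype_comap (measurableSet_singleton _).compl F,
          setIntegral_congr_set (ae_eq_univ.2 (by simp : volume (({0}ᶜ : Set (Vec n))ᶜ) = 0)),
          setIntegral_univ]
    _ = ∫ p, H p ∂((volume : Measure (Vec n)).toSphere.prod (Measure.volumeIoiPow (n - 1))) := by
        rw [← hmp.integral_comp hemb]
        exact integral_congr_ae (Filter.Eventually.of_forall fun w => (hcomp w).symm)
    _ = _ := by
        rw [integral_prod _ hint]
        simp only [hinner]

/-- The distance from the origin, in direction `u`, to the boundary of the unit ball centred at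
`s • h`. -/
def ballRadius {n : ℕ} (h u : Vec n) (s : ℝ) : ℝ :=
  s * ⟪u, h⟫ + √(1 - s ^ 2 * (‖h‖ ^ 2 - ⟪u, h⟫ ^ 2))

lemma norm_smul_sub_smul_le_one_iff {n : ℕ} {h u : Vec n} (hu : ‖u‖ = 1) {s : ℝ}
    (hs : |s| * ‖h‖ ≤ 1) {ρ : ℝ} (hρ : 0 < ρ) :
    ‖ρ • u - s • h‖ ≤ 1 ↔ ρ ≤ ballRadius h u s := by
  have h1 : ‖ρ • u - s • h‖ ^ 2 = ρ ^ 2 - 2 * ρ * s * ⟪u, h⟫ + s ^ 2 * ‖h‖ ^ 2 := by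
    rw [norm_sub_sq_real, norm_smul, norm_smul, inner_smul_left, inner_smul_right, hu]
    simp only [Real.norm_eq_abs, mul_pow, sq_abs, conj_trivial]
    ring
  have h2 : s ^ 2 * ‖h‖ ^ 2 ≤ 1 := by
    rw [← sq_abs s, ← mul_pow]
    exact pow_le_one₀ (by positivity) hs
  set a := ⟪u, h⟫ with ha
  set D := 1 - s ^ 2 * (‖h‖ ^ 2 - a ^ 2) with hD
  have hD0 : (s * a) ^ 2 ≤ D := by rw [hD]; nlinarith
  have hDs : |s * a| ≤ √D := Real.abs_le_sqrt hD0
  rw [← sq_le_one_iff₀ (norm_nonneg _), h1]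
  have h3 : ρ ^ 2 - 2 * ρ * s * a + s ^ 2 * ‖h‖ ^ 2 ≤ 1 ↔ (ρ - s * a) ^ 2 ≤ D := by
    rw [hD]; constructor <;> intro h <;> nlinarith
  rw [h3, Real.sq_le ((sq_nonneg _).trans hD0), ballRadius]
  have := abs_le.1 hDs
  constructor
  · rintro ⟨-, h⟩; linarith
  · intro h; constructor <;> linarith

/-- The integral along the ray in direction `u` inside the unit ball centred at `s • h`, with the
weight of polar coordinates. -/
def rayIntegral {n : ℕ} (ψ : Vec n → ℝ) (h u : Vec n) (s : ℝ) : ℝ :=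
  ∫ ρ in (0 : ℝ)..ballRadius h u s, ρ ^ (n - 1) * ψ (ρ • u)

lemma ballRadius_nonneg {n : ℕ} {h u : Vec n} {s : ℝ} (hs : |s| * ‖h‖ ≤ 1) :
    0 ≤ ballRadius h u s := by
  have h2 : s ^ 2 * ‖h‖ ^ 2 ≤ 1 := by
    rw [← sq_abs s, ← mul_pow]
    exact pow_le_one₀ (by positivity) hs
  have : |s * ⟪u, h⟫| ≤ √(1 - s ^ 2 * (‖h‖ ^ 2 - ⟪u, h⟫ ^ 2)) :=
    Real.abs_le_sqrt (by nlinarith)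
  have := abs_le.1 this
  rw [ballRadius]; linarith

lemma integral_ball_eq_integral_rayIntegral {n : ℕ} [Nontrivial (Vec n)] {ψ : Vec n → ℝ}
    (hψ : Continuous ψ) (h : Vec n) {s : ℝ} (hs : |s| * ‖h‖ ≤ 1) :
    Integrable (fun u : USphere n => rayIntegral ψ h u s)
        (volume : Measure (Vec n)).toSphere ∧
      ∫ v in Metric.closedBall (0 : Vec n) 1, ψ (v + s • h)
        = ∫ u : USphere n, rayIntegral ψ h u s ∂(volume : Measure (Vec n)).toSphere := by
  set F : Vec n → ℝ := (Metric.closedBall (s • h) 1).indicator ψ with hF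
  have hFint : Integrable F :=
    (integrable_indicator_iff Metric.isClosed_closedBall.measurableSet).2
      (hψ.continuousOn.integrableOn_compact (isCompact_closedBall _ _))
  have hray : ∀ u : USphere n, ∫ ρ in Set.Ioi (0 : ℝ), ρ ^ (n - 1) * F (ρ • (u : Vec n))
      = rayIntegral ψ h u s := by
    intro u
    have hu : ‖(u : Vec n)‖ = 1 := norm_eq_of_mem_sphere u
    rw [rayIntegral, intervalIntegral.integral_of_le (ballRadius_nonneg hs),
      ← integral_indicator measurableSet_Ioi, ← integral_indicator measurableSet_Ioc]
    congr 1
    ext ρ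
    by_cases hρ : 0 < ρ
    · have := norm_smul_sub_smul_le_one_iff hu hs hρ
      by_cases hle : ρ ≤ ballRadius h u s
      · have hm : ρ • (u : Vec n) ∈ Metric.closedBall (s • h) 1 := by
          rw [mem_closedBall_iff_norm]; exact this.2 hle
        simp [Set.indicator, hρ, hle, hF, hm]
      · have hm : ρ • (u : Vec n) ∉ Metric.closedBall (s • h) 1 := by
          rw [mem_closedBall_iff_norm]; exact fun hh => hle (this.1 hh)
        simp [Set.indicator, hρ, hle, hF, hm]
    · simp [Set.indicator, hρ]
  have key := integral_polar hFint
  simp only [hray] at key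
  refine ⟨key.1, ?_⟩
  rw [← key.2, ← integral_indicator Metric.isClosed_closedBall.measurableSet,
    ← integral_add_right_eq_self F (s • h)]
  congr 1
  ext v
  simp [hF, Set.indicator]

lemma hasDerivAt_ballRadius {n : ℕ} {h u : Vec n} {s : ℝ}
    (hs : |s| * ‖h‖ < 1) :
    HasDerivAt (ballRadius h u) (⟪u, h⟫ - s * (‖h‖ ^ 2 - ⟪u, h⟫ ^ 2) /
      √(1 - s ^ 2 * (‖h‖ ^ 2 - ⟪u, h⟫ ^ 2))) s := by
  have h2 : s ^ 2 * ‖h‖ ^ 2 < 1 := by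
    rw [← sq_abs s, ← mul_pow]
    exact pow_lt_one₀ (by positivity) hs (by norm_num)
  have hD : 0 < 1 - s ^ 2 * (‖h‖ ^ 2 - ⟪u, h⟫ ^ 2) := by
    nlinarith [mul_nonneg (sq_nonneg s) (sq_nonneg ⟪u, h⟫)]
  have h3 : HasDerivAt (fun s : ℝ => 1 - s ^ 2 * (‖h‖ ^ 2 - ⟪u, h⟫ ^ 2))
      (-(2 * s * (‖h‖ ^ 2 - ⟪u, h⟫ ^ 2))) s := by
    have := (((hasDerivAt_id s).pow 2).mul_const (‖h‖ ^ 2 - ⟪u, h⟫ ^ 2)).const_sub 1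
    simpa using this
  have h4 := ((hasDerivAt_id s).mul_const ⟪u, h⟫).add (h3.sqrt hD.ne')
  refine h4.congr_deriv ?_
  have := (Real.sqrt_pos.2 hD).ne'
  field_simp
  ring

lemma hasDerivAt_rayIntegral {n : ℕ} {ψ : Vec n → ℝ} (hψ : Continuous ψ) {h u : Vec n}
    {s : ℝ} (hs : |s| * ‖h‖ < 1) :
    HasDerivAt (rayIntegral ψ h u)
      (ballRadius h u s ^ (n - 1) * ψ (ballRadius h u s • u) *
        (⟪u, h⟫ - s * (‖h‖ ^ 2 - ⟪u, h⟫ ^ 2) / √(1 - s ^ 2 * (‖h‖ ^ 2 - ⟪u, h⟫ ^ 2)))) s := by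
  have hc : Continuous fun ρ : ℝ => ρ ^ (n - 1) * ψ (ρ • u) := by fun_prop
  have h1 := intervalIntegral.integral_hasDerivAt_right (hc.intervalIntegrable 0 (ballRadius h u s))
    (hc.stronglyMeasurableAtFilter _ _) hc.continuousAt
  exact h1.comp s (hasDerivAt_ballRadius hs)

/-- Moving the unit ball in direction `h` changes the integral of `ψ` at the rate given by the flux
through the sphere. In polar coordinates this is differentiation of `rayIntegral` under the
integral over directions, so that continuity of `ψ` suffices. -/
theorem hasDerivAt_integral_ball {n : ℕ} [Nontrivial (Vec n)] {ψ : Vec n → ℝ}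
    (hψ : Continuous ψ) (h : Vec n) :
    HasDerivAt (fun s : ℝ => ∫ v in Metric.closedBall (0 : Vec n) 1, ψ (v + s • h))
      (∫ u : USphere n, ψ u * ⟪(u : Vec n), h⟫ ∂(volume : Measure (Vec n)).toSphere) 0 := by
  obtain ⟨C, hC⟩ := (isCompact_closedBall (0 : Vec n) 2).exists_bound_of_continuousOn
    hψ.continuousOn
  have hC0 : 0 ≤ C := (norm_nonneg _).trans (hC 0 (by simp))
  -- on this neighbourhood of `0` the displacement `s • h` has length at most `1 / 2`, which keeps
  -- the square root in `ballRadius` away from `0`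
  set η : ℝ := 1 / (2 * (‖h‖ + 1)) with hη
  have hη0 : 0 < η := by positivity
  have hsmall : ∀ s ∈ Metric.ball (0 : ℝ) η, |s| * ‖h‖ ≤ 1 / 2 := by
    intro s hs
    have : |s| < η := by simpa using hs
    calc |s| * ‖h‖ ≤ η * (‖h‖ + 1) := by gcongr; linarith
      _ = 1 / 2 := by rw [hη]; field_simp
  have hnear : Metric.ball (0 : ℝ) η ∈ nhds (0 : ℝ) := Metric.ball_mem_nhds _ hη0
  have key := hasDerivAt_integral_of_dominated_loc_of_deriv_le
    (μ := (volume : Measure (Vec n)).toSphere)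
    (F := fun s (u : USphere n) => rayIntegral ψ h u s)
    (F' := fun s (u : USphere n) =>
      ballRadius h u s ^ (n - 1) * ψ (ballRadius h u s • (u : Vec n)) *
        (⟪(u : Vec n), h⟫ - s * (‖h‖ ^ 2 - ⟪(u : Vec n), h⟫ ^ 2) /
          √(1 - s ^ 2 * (‖h‖ ^ 2 - ⟪(u : Vec n), h⟫ ^ 2))))
    (bound := fun _ => 2 ^ (n - 1) * C * (3 * ‖h‖)) (x₀ := 0) hnear ?_ ?_ ?_ ?_ ?_ ?_
  · have h0 : ∀ u : USphere n, ballRadius h (u : Vec n) 0 = 1 := by intro u; simp [ballRadius]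
    simp only [h0, one_pow, one_mul, one_smul, zero_mul, zero_div, sub_zero] at key
    refine key.2.congr_of_eventuallyEq ?_
    filter_upwards [hnear] with s hs
    exact (integral_ball_eq_integral_rayIntegral hψ h ((hsmall s hs).trans (by norm_num))).2
  · filter_upwards [hnear] with s hs
    exact (integral_ball_eq_integral_rayIntegral hψ h
      ((hsmall s hs).trans (by norm_num))).1.aestronglyMeasurable
  · exact (integral_ball_eq_integral_rayIntegral hψ h (by simp)).1
  · have h0 : ∀ u : USphere n, ballRadius h (u : Vec n) 0 = 1 := by intro u; simp [ballRadius]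
    simp only [h0, one_pow, one_mul, one_smul, zero_mul, zero_div, sub_zero]
    have : Continuous fun u : USphere n => ψ u * ⟪(u : Vec n), h⟫ := by fun_prop
    exact this.aestronglyMeasurable
  · refine Filter.Eventually.of_forall fun u s hs => ?_
    have hu : ‖(u : Vec n)‖ = 1 := norm_eq_of_mem_sphere u
    have hs' := hsmall s hs
    have ha : |⟪(u : Vec n), h⟫| ≤ ‖h‖ := by
      simpa [hu] using abs_real_inner_le_norm (u : Vec n) h
    set a := ⟪(u : Vec n), h⟫ with hadef
    have ha2 : a ^ 2 ≤ ‖h‖ ^ 2 := by rw [← sq_abs]; gcongr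
    have hsb : s ^ 2 * ‖h‖ ^ 2 ≤ 1 / 4 := by
      rw [← sq_abs s, ← mul_pow]
      calc (|s| * ‖h‖) ^ 2 ≤ (1 / 2) ^ 2 := by gcongr
        _ = 1 / 4 := by norm_num
    have hD1 : 1 / 4 ≤ 1 - s ^ 2 * (‖h‖ ^ 2 - a ^ 2) := by
      nlinarith [mul_nonneg (sq_nonneg s) (sq_nonneg a)]
    have hD2 : 1 - s ^ 2 * (‖h‖ ^ 2 - a ^ 2) ≤ 1 := by
      nlinarith [mul_nonneg (sq_nonneg s) (sub_nonneg.2 ha2)]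
    have hq1 : 1 / 2 ≤ √(1 - s ^ 2 * (‖h‖ ^ 2 - a ^ 2)) :=
      Real.le_sqrt_of_sq_le (by linarith)
    have hq2 : √(1 - s ^ 2 * (‖h‖ ^ 2 - a ^ 2)) ≤ 1 := Real.sqrt_le_one.2 hD2
    have hsa : |s * a| ≤ 1 / 2 := by
      rw [abs_mul]; exact (mul_le_mul_of_nonneg_left ha (abs_nonneg _)).trans hs'
    have hR0 : 0 ≤ ballRadius h u s := ballRadius_nonneg (hs'.trans (by norm_num))
    have hR2 : ballRadius h u s ≤ 2 := by
      rw [ballRadius, ← hadef]; have := (abs_le.1 hsa).2; linarith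
    rw [norm_mul, norm_mul, norm_pow, Real.norm_of_nonneg hR0]
    have hψC : ‖ψ (ballRadius h u s • (u : Vec n))‖ ≤ C := by
      apply hC
      simp [norm_smul, hu, abs_of_nonneg hR0, hR2]
    have hlast : ‖a - s * (‖h‖ ^ 2 - a ^ 2) / √(1 - s ^ 2 * (‖h‖ ^ 2 - a ^ 2))‖ ≤ 3 * ‖h‖ := by
      refine (norm_sub_le _ _).trans ?_
      rw [norm_div, norm_mul, Real.norm_eq_abs, Real.norm_eq_abs, Real.norm_eq_abs,
        Real.norm_of_nonneg (Real.sqrt_nonneg _), abs_of_nonneg (sub_nonneg.2 ha2)]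
      have : |s| * (‖h‖ ^ 2 - a ^ 2) / √(1 - s ^ 2 * (‖h‖ ^ 2 - a ^ 2)) ≤ 2 * ‖h‖ := by
        rw [div_le_iff₀ (by linarith)]
        have h5 : |s| * (‖h‖ ^ 2 - a ^ 2) ≤ 1 / 2 * ‖h‖ := by
          nlinarith [abs_nonneg s, norm_nonneg h, mul_nonneg (abs_nonneg s) (sq_nonneg a),
            mul_le_mul_of_nonneg_right hs' (norm_nonneg h)]
        nlinarith [norm_nonneg h]
      linarith
    gcongr
  · exact integrable_const _
  · refine Filter.Eventually.of_forall fun u s hs => ?_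
    exact hasDerivAt_rayIntegral hψ
      ((hsmall s hs).trans_lt (by norm_num))

/-! ### Smoothing by ball averages -/

/-- The average of `φ` over the ball of radius `δ` around `y`. -/
def ballAverage {n : ℕ} (δ : ℝ) (φ : Vec n → ℝ) (y : Vec n) : ℝ :=
  ⨍ v in Metric.closedBall (0 : Vec n) 1, φ (y + δ • v)

/-- The one-point gradient estimate of `φ` at `y` from its value at `y + δ u`. -/
def pointEstimate {n : ℕ} (δ : ℝ) (φ : Vec n → ℝ) (y : Vec n) (u : USphere n) : Vec n :=
  ((n : ℝ) / δ * φ (y + δ • (u : Vec n))) • (u : Vec n)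

/-- The mean of the one-point gradient estimate at `y`. For continuous `φ` it is the gradient of
`ballAverage δ φ` at `y`. -/
def meanEstimate {n : ℕ} (δ : ℝ) (φ : Vec n → ℝ) (y : Vec n) : Vec n :=
  ∫ u, pointEstimate δ φ y u ∂uniformSphere n

lemma ballAverage_eq {n : ℕ} [Nontrivial (Vec n)] (δ : ℝ) (φ : Vec n → ℝ) (y : Vec n) :
    ballAverage δ φ y = ((volume : Measure (Vec n)).real (Metric.ball 0 1))⁻¹ *
      ∫ v in Metric.closedBall (0 : Vec n) 1, φ (y + δ • v) := by
  rw [ballAverage, setAverage_eq, smul_eq_mul, measureReal_def, measureReal_def,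
    Measure.addHaar_closedBall_eq_addHaar_ball]

lemma volume_real_unitBall_pos (n : ℕ) :
    0 < (volume : Measure (Vec n)).real (Metric.ball 0 1) :=
  ENNReal.toReal_pos (Metric.measure_ball_pos _ _ one_pos).ne' measure_ball_lt_top.ne

lemma integral_uniformSphere {n : ℕ} {E : Type*} [NormedAddCommGroup E] [NormedSpace ℝ E]
    (g : USphere n → E) :
    ∫ u, g u ∂uniformSphere n = ((n : ℝ) * (volume : Measure (Vec n)).real (Metric.ball 0 1))⁻¹ •
      ∫ u, g u ∂(volume : Measure (Vec n)).toSphere := by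
  rw [uniformSphere, integral_smul_measure, ENNReal.toReal_inv, ← measureReal_def,
    Measure.toSphere_real_apply_univ, finrank_euclideanSpace_fin]

instance isProbabilityMeasure_uniformSphere {n : ℕ} [Nontrivial (Vec n)] :
    IsProbabilityMeasure (uniformSphere n) := by
  constructor
  rw [uniformSphere, Measure.smul_apply, smul_eq_mul]
  exact ENNReal.inv_mul_cancel (Measure.measure_univ_ne_zero.2
    (volume : Measure (Vec n)).toSphere_ne_zero) (measure_ne_top _ _)

lemma integrable_uniformSphere {n : ℕ} [Nontrivial (Vec n)] {E : Type*} [NormedAddCommGroup E]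
    {g : USphere n → E} (hg : Continuous g) : Integrable g (uniformSphere n) :=
  hg.integrable_of_hasCompactSupport (HasCompactSupport.of_compactSpace g)

lemma inner_meanEstimate {n : ℕ} [Nontrivial (Vec n)] {φ : Vec n → ℝ} (hφ : Continuous φ)
    (δ : ℝ) (y h : Vec n) :
    ⟪meanEstimate δ φ y, h⟫ =
      ∫ u, ⟪pointEstimate δ φ y u, h⟫ ∂uniformSphere n := by
  rw [meanEstimate, real_inner_comm, ← integral_inner (integrable_uniformSphere
    (by unfold pointEstimate; fun_prop))]
  simp only [real_inner_comm]

/-- The mean of the one-point estimates is the gradient of the ball average. -/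
theorem hasDerivAt_ballAverage {n : ℕ} [Nontrivial (Vec n)] {φ : Vec n → ℝ} (hφ : Continuous φ)
    {δ : ℝ} (hδ : 0 < δ) (y h : Vec n) :
    HasDerivAt (fun s : ℝ => ballAverage δ φ (y + s • h)) ⟪meanEstimate δ φ y, h⟫ 0 := by
  have hn : (n : ℝ) ≠ 0 := by
    have : 0 < Module.finrank ℝ (Vec n) := Module.finrank_pos
    rw [finrank_euclideanSpace_fin] at this
    positivity
  have h1 := (hasDerivAt_integral_ball (ψ := fun v => φ (y + δ • v)) (by fun_prop)
    (δ⁻¹ • h)).const_mul (((volume : Measure (Vec n)).real (Metric.ball 0 1))⁻¹)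
  refine (h1.congr_deriv ?_).congr_of_eventuallyEq (Filter.Eventually.of_forall fun s => ?_)
  · rw [inner_meanEstimate hφ, integral_uniformSphere, smul_eq_mul, mul_inv, mul_comm (n : ℝ)⁻¹,
      mul_assoc, ← integral_const_mul (n : ℝ)⁻¹]
    congr 1
    refine integral_congr_ae (μ := (volume : Measure (Vec n)).toSphere)
      (Filter.Eventually.of_forall fun u => ?_)
    dsimp only
    rw [pointEstimate, inner_smul_right, inner_smul_left, conj_trivial]
    field_simp
  · simp only [ballAverage_eq]
    congr 2
    ext v
    congr 1
    rw [smul_add, smul_smul, smul_smul, mul_assoc, mul_comm s, mul_inv_cancel_left₀ hδ.ne']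
    abel

lemma integrable_ballAverage {n : ℕ} {φ : Vec n → ℝ} (hφ : Continuous φ) (δ : ℝ) (y : Vec n) :
    IntegrableOn (fun v => φ (y + δ • v)) (Metric.closedBall (0 : Vec n) 1) :=
  (by fun_prop : Continuous fun v => φ (y + δ • v)).continuousOn.integrableOn_compact
    (isCompact_closedBall _ _)

/-- Pointwise inequalities between values of `φ` on three parallel balls pass to averages. -/
lemma ballAverage_le {n : ℕ} [Nontrivial (Vec n)] {φ : Vec n → ℝ} (hφ : Continuous φ) {δ : ℝ}
    {y y₁ y₂ : Vec n} {a b c : ℝ}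
    (h : ∀ v ∈ Metric.closedBall (0 : Vec n) 1,
      φ (y + δ • v) ≤ a * φ (y₁ + δ • v) + b * φ (y₂ + δ • v) + c) :
    ballAverage δ φ y ≤ a * ballAverage δ φ y₁ + b * ballAverage δ φ y₂ + c := by
  have hV := volume_real_unitBall_pos n
  have hi := fun y => integrable_ballAverage hφ δ y
  have h1 : ∫ v in Metric.closedBall (0 : Vec n) 1, φ (y + δ • v) ≤
      ∫ v in Metric.closedBall (0 : Vec n) 1, (a * φ (y₁ + δ • v) + b * φ (y₂ + δ • v) + c) :=
    setIntegral_mono_on (hi y) ((((hi y₁).const_mul a).add ((hi y₂).const_mul b)).add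
      (integrableOn_const (by simpa using measure_closedBall_lt_top.ne)))
      Metric.isClosed_closedBall.measurableSet h
  have hc : ∫ _ in Metric.closedBall (0 : Vec n) 1, c =
      (volume : Measure (Vec n)).real (Metric.ball 0 1) * c := by
    rw [setIntegral_const, smul_eq_mul, measureReal_def, measureReal_def,
      Measure.addHaar_closedBall_eq_addHaar_ball]
  rw [integral_add, integral_add, integral_const_mul, integral_const_mul, hc] at h1
  · simp only [ballAverage_eq]
    have h2 := mul_le_mul_of_nonneg_left h1 (inv_nonneg.2 hV.le)
    refine h2.trans (le_of_eq ?_)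
    field_simp
  · exact (hi y₁).const_mul a
  · exact (hi y₂).const_mul b
  · exact ((hi y₁).const_mul a).add ((hi y₂).const_mul b)
  · exact integrableOn_const (by simpa using measure_closedBall_lt_top.ne)

section Lipschitz

variable {n : ℕ} {φ : Vec n → ℝ} {G δ : ℝ}

lemma continuous_of_abs_sub_le (hφ : ∀ a b, |φ a - φ b| ≤ G * ‖a - b‖) : Continuous φ := by
  refine (LipschitzWith.of_dist_le_mul (K := G.toNNReal) fun a b => ?_).continuous
  rw [Real.dist_eq, dist_eq_norm]
  exact (hφ a b).trans (mul_le_mul_of_nonneg_right (Real.le_coe_toNNReal G) (norm_nonneg _))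

variable [Nontrivial (Vec n)]

lemma abs_ballAverage_sub_le (hG : 0 ≤ G) (hφ : ∀ a b, |φ a - φ b| ≤ G * ‖a - b‖) (hδ : 0 ≤ δ)
    (y : Vec n) : |ballAverage δ φ y - φ y| ≤ G * δ := by
  have hc := continuous_of_abs_sub_le hφ
  have hV := volume_real_unitBall_pos n
  have hb : ∀ v ∈ Metric.closedBall (0 : Vec n) 1, |φ (y + δ • v) - φ y| ≤ G * δ := by
    intro v hv
    refine (hφ _ _).trans (mul_le_mul_of_nonneg_left ?_ hG)
    rw [add_sub_cancel_left, norm_smul, Real.norm_of_nonneg hδ]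
    exact mul_le_of_le_one_right hδ (by simpa using hv)
  have h1 : ∫ v in Metric.closedBall (0 : Vec n) 1, (φ (y + δ • v) - φ y)
      = (volume : Measure (Vec n)).real (Metric.ball 0 1) * (ballAverage δ φ y - φ y) := by
    rw [integral_sub (integrable_ballAverage hc δ y)
      (integrableOn_const (by simpa using measure_closedBall_lt_top.ne)), setIntegral_const,
      ballAverage_eq, smul_eq_mul]
    simp only [measureReal_def, Measure.addHaar_closedBall_eq_addHaar_ball] at hV ⊢
    field_simp
  have h2 := norm_setIntegral_le_of_norm_le_const
    (measure_closedBall_lt_top (x := (0 : Vec n)) (r := 1) (μ := volume))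
    (f := fun v => φ (y + δ • v) - φ y) (C := G * δ) hb
  rw [h1, norm_mul, Real.norm_of_nonneg hV.le, mul_comm (G * δ), measureReal_def,
    measureReal_def, Measure.addHaar_closedBall_eq_addHaar_ball, ← measureReal_def] at h2
  exact le_of_mul_le_mul_left h2 hV

lemma abs_ballAverage_sub_ballAverage_le (hφ : ∀ a b, |φ a - φ b| ≤ G * ‖a - b‖) (y w : Vec n) :
    |ballAverage δ φ y - ballAverage δ φ w| ≤ G * ‖y - w‖ := by
  have hc := continuous_of_abs_sub_le hφ
  have key : ∀ y w : Vec n, ballAverage δ φ y ≤ ballAverage δ φ w + G * ‖y - w‖ := by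
    intro y w
    have := ballAverage_le hc (δ := δ) (y := y) (y₁ := w) (y₂ := w) (a := 1) (b := 0)
      (c := G * ‖y - w‖) (fun v _ => by
        have := (abs_le.1 (hφ (y + δ • v) (w + δ • v))).2
        rw [add_sub_add_right_eq_sub] at this
        linarith)
    linarith
  have h1 := key y w
  have h2 := key w y
  rw [norm_sub_rev] at h2
  rw [abs_le]; constructor <;> linarith

/-- A Lipschitz constant bounds the derivative of the average in the direction of its own
gradient. -/
lemma norm_meanEstimate_le (hG : 0 ≤ G) (hφ : ∀ a b, |φ a - φ b| ≤ G * ‖a - b‖) (hδ : 0 < δ)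
    (y : Vec n) : ‖meanEstimate δ φ y‖ ≤ G := by
  set g := meanEstimate δ φ y with hg
  have hd := hasDerivAt_ballAverage (continuous_of_abs_sub_le hφ) hδ y g
  have hb : ‖⟪meanEstimate δ φ y, g⟫‖ ≤ G * ‖g‖ := by
    refine hd.le_of_lip' (by positivity) (Filter.Eventually.of_forall fun s => ?_)
    have := abs_ballAverage_sub_ballAverage_le (δ := δ) hφ (y + s • g) (y + (0 : ℝ) • g)
    rw [Real.norm_eq_abs]
    refine this.trans (le_of_eq ?_)
    rw [add_sub_add_left_eq_sub, zero_smul, sub_zero, sub_zero, norm_smul]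
    ring
  rw [← hg, real_inner_self_eq_norm_sq, Real.norm_of_nonneg (sq_nonneg _), sq] at hb
  rcases (norm_nonneg g).eq_or_lt with h0 | h0
  · rw [← h0]; exact hG
  · exact le_of_mul_le_mul_right hb h0

/-- Ball averaging preserves strong convexity, and the mean of the gradient estimate is the
corresponding subgradient. -/
theorem ballAverage_strongConvex {𝒦 : Set (Vec n)} {α : ℝ} (hc : Continuous φ)
    (hconv : StrongConvexOn 𝒦 α φ) (hδ : 0 < δ) {y w : Vec n}
    (hy : ∀ v ∈ Metric.closedBall (0 : Vec n) 1, y + δ • v ∈ 𝒦)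
    (hw : ∀ v ∈ Metric.closedBall (0 : Vec n) 1, w + δ • v ∈ 𝒦) :
    ballAverage δ φ y - ballAverage δ φ w ≤
      ⟪meanEstimate δ φ y, y - w⟫ - α / 2 * ‖y - w‖ ^ 2 := by
  -- divide the strong convexity inequality at `(1 - s) y + s w` by `s` and let `s` tend to `0`
  have hd := (hasDerivAt_ballAverage hc hδ y (w - y)).tendsto_slope_zero_right
  have hr : Filter.Tendsto (fun s : ℝ => ballAverage δ φ w - ballAverage δ φ y
      - (1 - s) * (α / 2 * ‖y - w‖ ^ 2)) (nhdsWithin 0 (Set.Ioi 0))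
      (nhds (ballAverage δ φ w - ballAverage δ φ y - (1 - 0) * (α / 2 * ‖y - w‖ ^ 2))) := by
    refine Filter.Tendsto.mono_left ?_ nhdsWithin_le_nhds
    exact (by fun_prop : Continuous fun s : ℝ => ballAverage δ φ w - ballAverage δ φ y
      - (1 - s) * (α / 2 * ‖y - w‖ ^ 2)).tendsto 0
  have hle := le_of_tendsto_of_tendsto hd hr ?_
  · rw [← neg_sub y w, inner_neg_right] at hle
    linarith
  · have hmem : Set.Ioo (0 : ℝ) 1 ∈ nhdsWithin (0 : ℝ) (Set.Ioi 0) :=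
      Ioo_mem_nhdsGT one_pos
    filter_upwards [hmem] with s hs
    have h1 : ballAverage δ φ (y + s • (w - y)) ≤ (1 - s) * ballAverage δ φ y
        + s * ballAverage δ φ w + -((1 - s) * s * (α / 2 * ‖y - w‖ ^ 2)) := by
      refine ballAverage_le hc fun v hv => ?_
      have := hconv.2 (hy v hv) (hw v hv) (sub_nonneg.2 hs.2.le) hs.1.le (sub_add_cancel 1 s)
      rw [add_sub_add_right_eq_sub, smul_eq_mul, smul_eq_mul] at this
      refine le_trans (le_of_eq ?_) (this.trans (le_of_eq (by ring)))
      congr 1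
      module
    rw [zero_add, zero_smul, add_zero, smul_eq_mul, inv_mul_le_iff₀ hs.1]
    linarith
end Lipschitz

/-! ### Isotropic quadratics and their constrained minimizers -/

/-- The quadratic `b / 2 * ‖w‖² - ⟪p, w⟫ + k`, whose Hessian is `b` times the identity. -/
def quadratic {n : ℕ} (b : ℝ) (p : Vec n) (k : ℝ) (w : Vec n) : ℝ :=
  b / 2 * ‖w‖ ^ 2 - ⟪p, w⟫ + k

lemma quadratic_expand {n : ℕ} (b : ℝ) (p : Vec n) (k : ℝ) (y w : Vec n) :
    quadratic b p k y =
      quadratic b p k w + ⟪b • w - p, y - w⟫ + b / 2 * ‖y - w‖ ^ 2 := by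
  simp only [quadratic, norm_sub_sq_real, inner_sub_left, inner_sub_right, inner_smul_left,
    real_inner_self_eq_norm_sq, conj_trivial, real_inner_comm w y]
  ring

lemma gradient_quadratic {n : ℕ} (b : ℝ) (p : Vec n) (k : ℝ) (w : Vec n) :
    gradient (quadratic b p k) w = b • w - p := by
  apply HasGradientAt.gradient
  rw [hasGradientAt_iff_isLittleO]
  have h : (fun y => quadratic b p k y - quadratic b p k w - ⟪b • w - p, y - w⟫) =
      fun y => b / 2 * ‖y - w‖ ^ 2 := by
    ext y
    rw [quadratic_expand b p k y w]
    ring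
  rw [h]
  refine Asymptotics.IsLittleO.const_mul_left ?_ _
  have : (fun y : Vec n => ‖y - w‖ ^ 2) = fun y => ‖y - w‖ * ‖y - w‖ := by ext; ring
  rw [this]
  refine (Asymptotics.IsLittleO.mul_isBigO (f₁ := fun y : Vec n => ‖y - w‖)
    (g₁ := fun _ : Vec n => (1 : ℝ)) (f₂ := fun y : Vec n => ‖y - w‖)
    (g₂ := fun y : Vec n => ‖y - w‖) ?_ (Asymptotics.isBigO_refl _ _)).trans_isBigO ?_
  · rw [Asymptotics.isLittleO_one_iff]
    have : Continuous fun y : Vec n => ‖y - w‖ := by fun_prop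
    simpa using this.tendsto w
  · simp only [one_mul]
    exact Asymptotics.isBigO_norm_left.2 (Asymptotics.isBigO_refl _ _)

open Classical in
/-- The nearest point of `S` to `y` (and `0` if there is none, which does not happen for a nonempty
closed convex set). -/
def nearestPoint {n : ℕ} (S : Set (Vec n)) (y : Vec n) : Vec n :=
  if h : ∃ w ∈ S, ∀ a ∈ S, ⟪y - w, a - w⟫ ≤ 0 then h.choose else 0

lemma nearestPoint_spec {n : ℕ} {S : Set (Vec n)} (hne : S.Nonempty) (hcl : IsClosed S)
    (hconv : Convex ℝ S) (y : Vec n) :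
    nearestPoint S y ∈ S ∧ ∀ a ∈ S, ⟪y - nearestPoint S y, a - nearestPoint S y⟫ ≤ 0 := by
  have h : ∃ w ∈ S, ∀ a ∈ S, ⟪y - w, a - w⟫ ≤ 0 := by
    obtain ⟨w, hw, he⟩ := exists_norm_eq_iInf_of_complete_convex hne hcl.isComplete hconv y
    exact ⟨w, hw, (norm_eq_iInf_iff_real_inner_le_zero hconv hw).1 he⟩
  rw [nearestPoint, dif_pos h]
  exact h.choose_spec

lemma continuous_nearestPoint {n : ℕ} {S : Set (Vec n)} (hne : S.Nonempty) (hcl : IsClosed S)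
    (hconv : Convex ℝ S) : Continuous (nearestPoint S) := by
  refine (LipschitzWith.of_dist_le_mul (K := 1) fun y y' => ?_).continuous
  obtain ⟨h1, h2⟩ := nearestPoint_spec hne hcl hconv y
  obtain ⟨h1', h2'⟩ := nearestPoint_spec hne hcl hconv y'
  set q := nearestPoint S y
  set q' := nearestPoint S y'
  have ha := h2 q' h1'
  have hb := h2' q h1
  have hkey : ‖q - q'‖ ^ 2 ≤ ⟪y - y', q - q'⟫ := by
    rw [← real_inner_self_eq_norm_sq]
    simp only [inner_sub_left, inner_sub_right] at ha hb ⊢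
    linarith
  have hcs := hkey.trans (real_inner_le_norm _ _)
  rw [dist_eq_norm, dist_eq_norm, NNReal.coe_one, one_mul]
  rcases (norm_nonneg (q - q')).eq_or_lt with h0 | h0
  · rw [← h0]; positivity
  · rw [sq] at hcs
    exact le_of_mul_le_mul_right hcs h0

lemma first_order_quadratic_nearestPoint {n : ℕ} {S : Set (Vec n)} (hne : S.Nonempty)
    (hcl : IsClosed S) (hconv : Convex ℝ S) {b : ℝ} (hb : 0 < b) (p : Vec n) {a : Vec n}
    (ha : a ∈ S) :
    0 ≤ ⟪b • nearestPoint S (b⁻¹ • p) - p, a - nearestPoint S (b⁻¹ • p)⟫ := by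
  have h := (nearestPoint_spec hne hcl hconv (b⁻¹ • p)).2 a ha
  set q := nearestPoint S (b⁻¹ • p)
  have : b • q - p = (-b) • (b⁻¹ • p - q) := by
    rw [smul_sub, smul_smul, neg_mul, mul_inv_cancel₀ hb.ne']
    module
  rw [this, inner_smul_left, conj_trivial]
  nlinarith

lemma quadratic_min_le {n : ℕ} {b : ℝ} {p : Vec n} {k : ℝ} {q a : Vec n}
    (h : 0 ≤ ⟪b • q - p, a - q⟫) :
    quadratic b p k q + b / 2 * ‖a - q‖ ^ 2 ≤ quadratic b p k a := by
  rw [quadratic_expand b p k a q]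
  linarith

/-! ### Frank-Wolfe with line search on a quadratic -/

section FrankWolfe

variable {n : ℕ} {S : Set (Vec n)} {b k : ℝ} {p xin : Vec n} {z v : ℕ → Vec n}

lemma IsFrankWolfe.mem {F : Vec n → ℝ} (h : IsFrankWolfe S F xin z v) (hconv : Convex ℝ S)
    (hx : xin ∈ S) : ∀ τ, 1 ≤ τ → z τ ∈ S := by
  intro τ hτ
  induction τ, hτ using Nat.le_induction with
  | base => rw [h.init]; exact hx
  | succ τ hτ ih =>
    obtain ⟨σ, hσ, -, hz⟩ := h.step τ hτ
    rw [hz]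
    exact hconv.add_smul_sub_mem ih (h.oracle τ hτ).1 hσ

lemma fwGap_quadratic (τ : ℕ) :
    fwGap (quadratic b p k) z v τ = ⟪b • z τ - p, z τ - v τ⟫ := by
  rw [fwGap, gradient_quadratic]

lemma IsFrankWolfe.inner_le_gap (h : IsFrankWolfe S (quadratic b p k) xin z v) {τ : ℕ}
    (hτ : 1 ≤ τ) {a : Vec n} (ha : a ∈ S) :
    ⟪b • z τ - p, z τ - a⟫ ≤ fwGap (quadratic b p k) z v τ := by
  have := isMinOn_iff.1 (h.oracle τ hτ).2 a ha
  rw [gradient_quadratic] at this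
  rw [fwGap_quadratic, inner_sub_right, inner_sub_right]
  linarith

lemma quadratic_line (τ : ℕ) (s : ℝ) :
    quadratic b p k (z τ + s • (v τ - z τ)) = quadratic b p k (z τ)
      - s * fwGap (quadratic b p k) z v τ + b * s ^ 2 / 2 * ‖v τ - z τ‖ ^ 2 := by
  rw [quadratic_expand b p k _ (z τ), fwGap_quadratic, add_sub_cancel_left, inner_smul_right,
    norm_smul, mul_pow, Real.norm_eq_abs, sq_abs, ← neg_sub (v τ) (z τ), inner_neg_right]
  ring

/-- Line search on a quadratic is a clipped Newton step. If the direction vanishes, any step size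
gives the same point, and the quotient is `0`. -/
lemma IsFrankWolfe.step_eq (h : IsFrankWolfe S (quadratic b p k) xin z v) (hconv : Convex ℝ S)
    (hx : xin ∈ S) (hb : 0 < b) {τ : ℕ} (hτ : 1 ≤ τ) :
    z (τ + 1) = z τ + min 1 (⟪b • z τ - p, z τ - v τ⟫ / (b * ‖v τ - z τ‖ ^ 2)) •
      (v τ - z τ) := by
  obtain ⟨σ, hσ, hmin, hz⟩ := h.step τ hτ
  rw [hz]
  rcases eq_or_ne (v τ - z τ) 0 with hd | hd
  · simp [hd]
  have hg0 : 0 ≤ fwGap (quadratic b p k) z v τ := by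
    have := h.inner_le_gap hτ (h.mem hconv hx τ hτ)
    simpa using this
  rw [← fwGap_quadratic (k := k)]
  set g := fwGap (quadratic b p k) z v τ
  have hA : 0 < b * ‖v τ - z τ‖ ^ 2 := by positivity
  have hle : ∀ s ∈ Set.Icc (0 : ℝ) 1, - σ * g + σ ^ 2 / 2 * (b * ‖v τ - z τ‖ ^ 2)
      ≤ - s * g + s ^ 2 / 2 * (b * ‖v τ - z τ‖ ^ 2) := by
    intro s hs
    have := isMinOn_iff.1 hmin s hs
    rw [quadratic_line, quadratic_line] at this
    linarith
  set A := b * ‖v τ - z τ‖ ^ 2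
  congr 2
  have hsq : (σ - min 1 (g / A)) ^ 2 ≤ 0 := by
    have hm := hle (min 1 (g / A)) ⟨by positivity, min_le_left _ _⟩
    rcases le_total 1 (g / A) with h1 | h1
    · rw [min_eq_left h1] at hm ⊢
      have h2 : A ≤ g := by rwa [le_div_iff₀ hA, one_mul] at h1
      have h3 : A * (σ - 1) ^ 2 ≤ 0 := by
        nlinarith [mul_nonneg (sub_nonneg.2 h2) (sub_nonneg.2 hσ.2)]
      nlinarith [sq_nonneg (σ - 1)]
    · rw [min_eq_right h1] at hm ⊢
      have h2 : g = g / A * A := by field_simp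
      set t := g / A
      rw [h2] at hm
      have h3 : A * (σ - t) ^ 2 ≤ 0 := by nlinarith
      nlinarith [sq_nonneg (σ - t)]
  have := pow_eq_zero_iff (two_ne_zero) |>.1 (le_antisymm hsq (sq_nonneg _))
  linarith

/-- While the gap exceeds `ε`, an iteration decreases the objective by at least `η`. The two
conditions on `η` cover a full step and the step that minimizes along the segment. -/
lemma IsFrankWolfe.decrease (h : IsFrankWolfe S (quadratic b p k) xin z v) (hb : 0 < b) {R ε η : ℝ}
    (hdiam : ∀ a ∈ S, ∀ a' ∈ S, ‖a - a'‖ ≤ 2 * R) (hconv : Convex ℝ S) (hx : xin ∈ S)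
    (hε : 0 < ε) (hη1 : η ≤ ε / 2) (hη2 : η * (8 * b * R ^ 2) ≤ ε ^ 2) {τ : ℕ} (hτ : 1 ≤ τ)
    (hgap : ε < fwGap (quadratic b p k) z v τ) :
    quadratic b p k (z (τ + 1)) + η ≤ quadratic b p k (z τ) := by
  obtain ⟨σ, hσ, hmin, hz⟩ := h.step τ hτ
  have hle : ∀ s ∈ Set.Icc (0 : ℝ) 1, quadratic b p k (z (τ + 1)) ≤ quadratic b p k (z τ)
      - s * fwGap (quadratic b p k) z v τ + s ^ 2 / 2 * (b * ‖v τ - z τ‖ ^ 2) := by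
    intro s hs
    have := isMinOn_iff.1 hmin s hs
    rw [quadratic_line τ s] at this
    rw [hz]
    linarith
  have hA4 : b * ‖v τ - z τ‖ ^ 2 ≤ 4 * b * R ^ 2 := by
    have := hdiam (v τ) (h.oracle τ hτ).1 (z τ) (h.mem hconv hx τ hτ)
    have := pow_le_pow_left₀ (norm_nonneg _) this 2
    nlinarith
  set g := fwGap (quadratic b p k) z v τ
  have hA0 : 0 ≤ b * ‖v τ - z τ‖ ^ 2 := by positivity
  set A := b * ‖v τ - z τ‖ ^ 2
  rcases le_or_gt A g with h1 | h1
  · have := hle 1 ⟨zero_le_one, le_rfl⟩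
    linarith
  · have hA : 0 < A := by linarith
    have := hle (g / A) ⟨by apply div_nonneg <;> linarith, (div_le_one hA).2 h1.le⟩
    have h2 : - (g / A) * g + (g / A) ^ 2 / 2 * A = - (g ^ 2 / (2 * A)) := by
      field_simp; ring
    have h3 : η ≤ g ^ 2 / (2 * A) := by
      rw [le_div_iff₀ (by linarith)]
      rcases le_or_gt η 0 with h0 | h0
      · nlinarith
      · nlinarith
    linarith

/-- Frank-Wolfe stops, and each of its iterations but the last decreases the objective by at least
`η`. -/
theorem IsFrankWolfe.calls (h : IsFrankWolfe S (quadratic b p k) xin z v) (hb : 0 < b) {R ε η : ℝ}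
    (hdiam : ∀ a ∈ S, ∀ a' ∈ S, ‖a - a'‖ ≤ 2 * R) (hconv : Convex ℝ S) (hx : xin ∈ S)
    (hε : 0 < ε) (hη : 0 < η) (hη1 : η ≤ ε / 2) (hη2 : η * (8 * b * R ^ 2) ≤ ε ^ 2)
    {B : ℝ} (hB : ∀ a ∈ S, B ≤ quadratic b p k a) :
    ∃ L : ℕ, 1 ≤ L ∧ fwCalls (quadratic b p k) ε z v = L ∧
      fwGap (quadratic b p k) z v L ≤ ε ∧
      quadratic b p k (z L) + ((L : ℝ) - 1) * η ≤ quadratic b p k xin := by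
  classical
  have hdec : ∀ j : ℕ, (∀ τ, 1 ≤ τ → τ ≤ j → ε < fwGap (quadratic b p k) z v τ) →
      quadratic b p k (z (j + 1)) + j * η ≤ quadratic b p k xin := by
    intro j
    induction j with
    | zero => intro _; simp [h.init]
    | succ j ih =>
      intro hj
      have h1 := ih fun τ h1 h2 => hj τ h1 (h2.trans j.le_succ)
      have h2 := h.decrease hb hdiam hconv hx hε hη1 hη2 (Nat.le_add_left 1 j)
        (hj (j + 1) (Nat.le_add_left 1 j) le_rfl)
      push_cast
      linarith
  have hex : ∃ τ : ℕ, 1 ≤ τ ∧ fwGap (quadratic b p k) z v τ ≤ ε := by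
    by_contra! hno
    obtain ⟨j, hj⟩ := exists_nat_gt ((quadratic b p k xin - B) / η)
    have h1 := hdec j fun τ hτ _ => hno τ hτ
    have h2 := hB _ (h.mem hconv hx (j + 1) (Nat.le_add_left 1 j))
    rw [div_lt_iff₀ hη] at hj
    linarith
  obtain ⟨h1, h2⟩ := Nat.find_spec hex
  refine ⟨Nat.find hex, h1, le_antisymm (iInf₂_le _ ⟨h1, h2⟩) ?_, h2, ?_⟩
  · exact le_iInf₂ fun τ hτ => Nat.cast_le.2 (Nat.find_min' hex hτ)
  · have h3 := hdec (Nat.find hex - 1) fun τ hτ hle => by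
      have := Nat.find_min hex (m := τ) (by omega)
      push Not at this
      exact this hτ
    rw [Nat.sub_add_cancel h1, Nat.cast_sub h1, Nat.cast_one] at h3
    exact h3

end FrankWolfe

/-! ### Delayed follow-the-regularized-leader -/

section FTRL

variable {n : ℕ}

/-- The curvature `κ k + τ₀` of the objective after `k` blocks. -/
def curvature (κ τ₀ : ℝ) (k : ℕ) : ℝ := κ * k + τ₀

/-- The vector `p` for which the objective after `k` blocks has gradient `curvature κ τ₀ k • w - p`
at `w`. -/
def ftrlPole (κ τ₀ : ℝ) (g x : ℕ → Vec n) (k : ℕ) : Vec n :=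
  τ₀ • x 0 + ∑ i ∈ Finset.range k, (κ • x i - g i)

/-- The objective `τ₀ / 2 * ‖w - x 0‖² + ∑ i < k, (⟪w, g i⟫ + κ / 2 * ‖w - x i‖²)` after `k` blocks,
where `g i` is the linear loss and `x i` the iterate of the block with (zero-based) number `i`. -/
def ftrlObjective (κ τ₀ : ℝ) (g x : ℕ → Vec n) (k : ℕ) : Vec n → ℝ :=
  quadratic (curvature κ τ₀ k) (ftrlPole κ τ₀ g x k)
    (τ₀ / 2 * ‖x 0‖ ^ 2 + ∑ i ∈ Finset.range k, κ / 2 * ‖x i‖ ^ 2)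

/-- The minimizer of `ftrlObjective` over `S`. -/
def leader (S : Set (Vec n)) (κ τ₀ : ℝ) (g x : ℕ → Vec n) (k : ℕ) : Vec n :=
  nearestPoint S ((curvature κ τ₀ k)⁻¹ • ftrlPole κ τ₀ g x k)

lemma ftrlObjective_zero (κ τ₀ : ℝ) (g x : ℕ → Vec n) (w : Vec n) :
    ftrlObjective κ τ₀ g x 0 w = τ₀ / 2 * ‖w - x 0‖ ^ 2 := by
  simp only [ftrlObjective, quadratic, curvature, ftrlPole, norm_sub_sq_real, Nat.cast_zero,
    mul_zero, zero_add, Finset.range_zero, Finset.sum_empty, add_zero,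
    inner_smul_right, real_inner_comm w]
  ring

lemma ftrlObjective_succ (κ τ₀ : ℝ) (g x : ℕ → Vec n) (k : ℕ) (w : Vec n) :
    ftrlObjective κ τ₀ g x (k + 1) w =
      ftrlObjective κ τ₀ g x k w + (⟪w, g k⟫ + κ / 2 * ‖w - x k‖ ^ 2) := by
  simp only [ftrlObjective, quadratic, curvature, ftrlPole, norm_sub_sq_real, Nat.cast_add,
    Nat.cast_one, Finset.sum_range_succ, inner_add_right, inner_sub_right, inner_smul_right,
    real_inner_comm w]
  ring

lemma ftrlObjective_eq (κ τ₀ : ℝ) (g x : ℕ → Vec n) (k : ℕ) (w : Vec n) :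
    ftrlObjective κ τ₀ g x k w = (∑ i ∈ Finset.range k, (⟪w, g i⟫ + κ / 2 * ‖w - x i‖ ^ 2))
      + τ₀ / 2 * ‖w - x 0‖ ^ 2 := by
  induction k with
  | zero => simp [ftrlObjective_zero]
  | succ k ih => rw [ftrlObjective_succ, ih, Finset.sum_range_succ]; ring

lemma sum_Icc_one {E : Type*} [AddCommMonoid E] (F : ℕ → E) (k : ℕ) :
    ∑ i ∈ Finset.Icc 1 k, F i = ∑ i ∈ Finset.range k, F (i + 1) := by
  induction k with
  | zero => simp
  | succ k ih => rw [Finset.sum_Icc_succ_top (Nat.le_add_left 1 k), ih, Finset.sum_range_succ]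

lemma blockObjective_eq_ftrlObjective (K : ℕ) (α δ T₀ : ℝ) (f : ℕ → Vec n → ℝ) (x : ℕ → Vec n)
    (u : ℕ → USphere n) (hx : x 1 = x 0) (k : ℕ) :
    blockObjective K α δ T₀ f x u (k + 1) =
      ftrlObjective (K * α) (T₀ * α) (fun i => blockEstimate K δ f x u (i + 1)) x k := by
  ext w
  rw [ftrlObjective_eq, blockObjective, hx, Nat.add_sub_cancel, sum_Icc_one]
  simp only [Nat.add_sub_cancel, mul_div_assoc]

lemma curvature_succ (κ τ₀ : ℝ) (k : ℕ) : curvature κ τ₀ (k + 1) = curvature κ τ₀ k + κ := by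
  simp only [curvature]; push_cast; ring

lemma gradient_succ (κ τ₀ : ℝ) (g x : ℕ → Vec n) (k : ℕ) (w : Vec n) :
    curvature κ τ₀ (k + 1) • w - ftrlPole κ τ₀ g x (k + 1) =
      (curvature κ τ₀ k • w - ftrlPole κ τ₀ g x k) + (g k + κ • (w - x k)) := by
  rw [curvature_succ]
  simp only [ftrlPole, Finset.sum_range_succ]
  module

/-- Follow-the-regularized-leader with isotropic quadratics, where the iterate `x (k + 1)` is an
approximate minimizer of the objective after `k` blocks (and not yet after `k + 1` blocks): no
first-order improvement inside `S` exceeds `16 R² β ^ (1 / 3)`, with `β` the curvature one block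
later. -/
structure IsDelayedFTRL (S : Set (Vec n)) (R κ τ₀ : ℝ) (N : ℕ) (g x : ℕ → Vec n) : Prop where
  conv : Convex ℝ S
  closed : IsClosed S
  norm_le : ∀ a ∈ S, ‖a‖ ≤ R
  R_pos : 0 < R
  κ_pos : 0 < κ
  κ_le : 4 * κ ≤ τ₀
  le_τ₀ : 8 ≤ τ₀
  first : x 1 = x 0
  mem : ∀ k ≤ N, x k ∈ S
  gap : ∀ k, 1 ≤ k → k + 1 ≤ N → ∀ a ∈ S,
    ⟪curvature κ τ₀ k • x (k + 1) - ftrlPole κ τ₀ g x k, x (k + 1) - a⟫ ≤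
      16 * R ^ 2 * curvature κ τ₀ (k + 1) ^ (1 / 3 : ℝ)

/-- The cube root of the curvature. -/
def cbrtCurvature (κ τ₀ : ℝ) (k : ℕ) : ℝ := curvature κ τ₀ k ^ (1 / 3 : ℝ)

lemma cube_rpow_third {a : ℝ} (ha : 0 ≤ a) : (a ^ (1 / 3 : ℝ)) ^ 3 = a := by
  rw [← Real.rpow_natCast, ← Real.rpow_mul ha]; norm_num

namespace IsDelayedFTRL

variable {S : Set (Vec n)} {R κ τ₀ : ℝ} {N : ℕ} {g x : ℕ → Vec n}

lemma norm_sub_le (h : IsDelayedFTRL S R κ τ₀ N g x) {a a' : Vec n} (ha : a ∈ S) (ha' : a' ∈ S) :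
    ‖a - a'‖ ≤ 2 * R := by
  have := _root_.norm_sub_le a a'
  have := h.norm_le a ha
  have := h.norm_le a' ha'
  linarith

lemma nonempty (h : IsDelayedFTRL S R κ τ₀ N g x) : S.Nonempty := ⟨x 0, h.mem 0 N.zero_le⟩

lemma le_curvature (h : IsDelayedFTRL S R κ τ₀ N g x) (k : ℕ) : 8 ≤ curvature κ τ₀ k := by
  have := mul_nonneg h.κ_pos.le k.cast_nonneg (α := ℝ)
  have := h.le_τ₀
  rw [curvature]; linarith

lemma curvature_pos (h : IsDelayedFTRL S R κ τ₀ N g x) (k : ℕ) : 0 < curvature κ τ₀ k := by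
  linarith [h.le_curvature k]

lemma curvature_succ_le (h : IsDelayedFTRL S R κ τ₀ N g x) (k : ℕ) :
    curvature κ τ₀ (k + 1) ≤ 5 / 4 * curvature κ τ₀ k := by
  have := mul_nonneg h.κ_pos.le k.cast_nonneg (α := ℝ)
  have := h.κ_le
  rw [curvature_succ, curvature]; linarith

lemma cbrt_cube (h : IsDelayedFTRL S R κ τ₀ N g x) (k : ℕ) :
    cbrtCurvature κ τ₀ k ^ 3 = curvature κ τ₀ k := cube_rpow_third (h.curvature_pos k).le

lemma two_le_cbrt (h : IsDelayedFTRL S R κ τ₀ N g x) (k : ℕ) : 2 ≤ cbrtCurvature κ τ₀ k := by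
  have h1 := h.cbrt_cube k
  have h2 := h.le_curvature k
  by_contra! hlt
  have h0 : 0 ≤ cbrtCurvature κ τ₀ k := Real.rpow_nonneg (h.curvature_pos k).le _
  have : cbrtCurvature κ τ₀ k ^ 3 < 2 ^ 3 := by gcongr
  linarith

lemma leader_mem (h : IsDelayedFTRL S R κ τ₀ N g x) (k : ℕ) : leader S κ τ₀ g x k ∈ S :=
  (nearestPoint_spec h.nonempty h.closed h.conv _).1

lemma leader_first_order (h : IsDelayedFTRL S R κ τ₀ N g x) (k : ℕ) {a : Vec n} (ha : a ∈ S) :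
    0 ≤ ⟪curvature κ τ₀ k • leader S κ τ₀ g x k - ftrlPole κ τ₀ g x k, a - leader S κ τ₀ g x k⟫ :=
  first_order_quadratic_nearestPoint h.nonempty h.closed h.conv (h.curvature_pos k) _ ha

lemma leader_min (h : IsDelayedFTRL S R κ τ₀ N g x) (k : ℕ) {a : Vec n} (ha : a ∈ S) :
    ftrlObjective κ τ₀ g x k (leader S κ τ₀ g x k) ≤ ftrlObjective κ τ₀ g x k a := by
  have h1 := quadratic_min_le (k := τ₀ / 2 * ‖x 0‖ ^ 2 + ∑ i ∈ Finset.range k, κ / 2 * ‖x i‖ ^ 2)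
    (h.leader_first_order k ha)
  have h2 : 0 ≤ curvature κ τ₀ k / 2 * ‖a - leader S κ τ₀ g x k‖ ^ 2 :=
    mul_nonneg (by linarith [h.curvature_pos k]) (sq_nonneg _)
  simp only [ftrlObjective]
  linarith

lemma leader_zero (h : IsDelayedFTRL S R κ τ₀ N g x) : leader S κ τ₀ g x 0 = x 0 := by
  have h1 := h.leader_min 0 (h.mem 0 N.zero_le)
  rw [ftrlObjective_zero, ftrlObjective_zero, sub_self, norm_zero] at h1
  have hτ := h.le_τ₀
  have h2 : ‖leader S κ τ₀ g x 0 - x 0‖ ^ 2 ≤ 0 := by nlinarith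
  have h3 := pow_eq_zero_iff (two_ne_zero) |>.1 (le_antisymm h2 (sq_nonneg _))
  exact sub_eq_zero.1 (norm_eq_zero.1 h3)

/-- Stability of the leader: adding one loss changes the gradient of the objective by at most
`‖g k‖ + 2 R κ`, and the objective is strongly convex. -/
lemma norm_leader_sub_succ_le (h : IsDelayedFTRL S R κ τ₀ N g x) {k : ℕ} (hk : k ≤ N) :
    ‖leader S κ τ₀ g x k - leader S κ τ₀ g x (k + 1)‖ ≤
      (‖g k‖ + 2 * R * κ) / curvature κ τ₀ (k + 1) := by
  have hB := h.curvature_pos (k + 1)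
  have h1 := h.leader_first_order k (h.leader_mem (k + 1))
  have h2 := h.leader_first_order (k + 1) (h.leader_mem k)
  have h3 := gradient_succ κ τ₀ g x k (leader S κ τ₀ g x k)
  have h4 := h.norm_sub_le (h.leader_mem k) (h.mem k hk)
  set ℓ := leader S κ τ₀ g x k
  set ℓ' := leader S κ τ₀ g x (k + 1)
  set B := curvature κ τ₀ (k + 1)
  have h5 : B • ℓ' - ftrlPole κ τ₀ g x (k + 1) =
      (curvature κ τ₀ k • ℓ - ftrlPole κ τ₀ g x k) + (g k + κ • (ℓ - x k)) - B • (ℓ - ℓ') := by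
    rw [← h3]; module
  rw [h5, inner_sub_left, inner_add_left, inner_smul_left, real_inner_self_eq_norm_sq,
    conj_trivial] at h2
  rw [← neg_sub ℓ ℓ', inner_neg_right] at h1
  have h6 : ⟪g k + κ • (ℓ - x k), ℓ - ℓ'⟫ ≤ (‖g k‖ + 2 * R * κ) * ‖ℓ - ℓ'‖ := by
    refine (real_inner_le_norm _ _).trans (mul_le_mul_of_nonneg_right ?_ (norm_nonneg _))
    refine (norm_add_le _ _).trans (add_le_add_right ?_ _)
    rw [norm_smul, Real.norm_of_nonneg h.κ_pos.le]
    nlinarith [h.κ_pos]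
  rw [le_div_iff₀ hB]
  rcases (norm_nonneg (ℓ - ℓ')).eq_or_lt with h0 | h0
  · rw [← h0, zero_mul]
    have := h.R_pos; have := h.κ_pos; positivity
  · have h7 : (‖ℓ - ℓ'‖ * B) * ‖ℓ - ℓ'‖ ≤ (‖g k‖ + 2 * R * κ) * ‖ℓ - ℓ'‖ := by nlinarith
    exact le_of_mul_le_mul_right h7 h0

lemma norm_leader_pred_sub_le (h : IsDelayedFTRL S R κ τ₀ N g x) {k : ℕ} (hk : k ≤ N) :
    ‖leader S κ τ₀ g x (k - 1) - leader S κ τ₀ g x k‖ ≤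
      (‖g (k - 1)‖ + 2 * R * κ) / curvature κ τ₀ k := by
  cases k with
  | zero =>
    have := h.R_pos; have := h.κ_pos; have := h.curvature_pos 0
    simp only [Nat.zero_sub, sub_self, norm_zero]
    positivity
  | succ k => exact h.norm_leader_sub_succ_le (Nat.le_of_succ_le hk)

/-- An approximate minimizer is close to the leader. The number `16` in the tolerance and the growth
`curvature_succ_le` of the curvature within a block combine to `5 ^ 2 ≥ 16 * (5 / 4)`. -/
lemma norm_sub_leader_le (h : IsDelayedFTRL S R κ τ₀ N g x) {k : ℕ} (hk : k ≤ N) :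
    ‖x k - leader S κ τ₀ g x (k - 1)‖ ≤ 5 * R / cbrtCurvature κ τ₀ k := by
  have hy := h.two_le_cbrt k
  have hR := h.R_pos
  match k, hk with
  | 0, _ => rw [Nat.zero_sub, h.leader_zero, sub_self, norm_zero]; positivity
  | 1, _ => rw [Nat.sub_self, h.leader_zero, h.first, sub_self, norm_zero]; positivity
  | k + 2, hk =>
    have h1 := h.gap (k + 1) (Nat.le_add_left 1 k) hk _ (h.leader_mem (k + 1))
    have h2 := h.leader_first_order (k + 1) (h.mem (k + 2) hk)
    have hB := h.curvature_succ_le (k + 1)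
    have hB0 := h.curvature_pos (k + 1)
    have hcube := h.cbrt_cube (k + 2)
    change _ ≤ 16 * R ^ 2 * cbrtCurvature κ τ₀ (k + 1 + 1) at h1
    simp only [add_assoc, Nat.reduceAdd, show k + 2 - 1 = k + 1 by omega]
      at h1 h2 hB ⊢
    set ℓ := leader S κ τ₀ g x (k + 1)
    set y := cbrtCurvature κ τ₀ (k + 2)
    set b := curvature κ τ₀ (k + 1)
    have h3 : b • x (k + 2) - ftrlPole κ τ₀ g x (k + 1) =
      (b • ℓ - ftrlPole κ τ₀ g x (k + 1)) + b • (x (k + 2) - ℓ) := by module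
    rw [h3, inner_add_left, inner_smul_left, real_inner_self_eq_norm_sq, conj_trivial] at h1
    have h4 : b * ‖x (k + 2) - ℓ‖ ^ 2 ≤ 16 * R ^ 2 * y := by linarith
    have h5 : y ^ 3 ≤ 5 / 4 * b := hcube ▸ hB
    have h6 : y * (y * ‖x (k + 2) - ℓ‖) ^ 2 ≤ y * (5 * R) ^ 2 := by
      nlinarith [mul_le_mul_of_nonneg_right h5 (sq_nonneg ‖x (k + 2) - ℓ‖),
        mul_pos (by positivity : 0 < R ^ 2) (by linarith : 0 < y)]
    have h7 := abs_le_of_sq_le_sq' (le_of_mul_le_mul_left h6 (by linarith)) (by positivity)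
    rw [le_div_iff₀ (by linarith)]
    linarith [h7.2]

/-- Being the leader has no regret, up to the regularization: here the iterate of block `k` is
compared with the leader that already knows the loss of block `k`. -/
lemma sum_le_of_leader (h : IsDelayedFTRL S R κ τ₀ N g x) {w : Vec n} (hw : w ∈ S) (j : ℕ) :
    ∑ k ∈ Finset.range j, (⟪leader S κ τ₀ g x (k + 1), g k⟫
        + κ / 2 * ‖leader S κ τ₀ g x (k + 1) - x k‖ ^ 2)
      ≤ ∑ k ∈ Finset.range j, (⟪w, g k⟫ + κ / 2 * ‖w - x k‖ ^ 2) + τ₀ / 2 * ‖w - x 0‖ ^ 2 := by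
  have key : ∀ j, ∑ k ∈ Finset.range j, (⟪leader S κ τ₀ g x (k + 1), g k⟫
        + κ / 2 * ‖leader S κ τ₀ g x (k + 1) - x k‖ ^ 2)
      ≤ ftrlObjective κ τ₀ g x j (leader S κ τ₀ g x j) := by
    intro j
    induction j with
    | zero =>
      rw [ftrlObjective_zero, Finset.range_zero, Finset.sum_empty]
      have := h.le_τ₀
      positivity
    | succ j ih =>
      rw [Finset.sum_range_succ, ftrlObjective_succ]
      have := h.leader_min j (h.leader_mem (j + 1))
      linarith
  rw [← ftrlObjective_eq]
  exact (key j).trans (h.leader_min j hw)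

/-- The regret of the delayed iterates on the surrogate losses. The inner products on the right
involve only data that is available before block `k`, so that conditional expectations apply to
them. -/
theorem regret_le (h : IsDelayedFTRL S R κ τ₀ N g x) {w : Vec n} (hw : w ∈ S) :
    ∑ k ∈ Finset.range N, (⟪g k, x k - w⟫ - κ / 2 * ‖x k - w‖ ^ 2) ≤ 2 * R ^ 2 * τ₀ +
      ∑ k ∈ Finset.range N, (⟪g k, x k - leader S κ τ₀ g x (k - 1)⟫ +
        (‖g k‖ * ((‖g (k - 1)‖ + 2 * R * κ) / curvature κ τ₀ k) +
         ‖g k‖ * ((‖g k‖ + 2 * R * κ) / curvature κ τ₀ (k + 1)))) := by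
  have h1 := h.sum_le_of_leader hw N
  have h2 : τ₀ / 2 * ‖w - x 0‖ ^ 2 ≤ 2 * R ^ 2 * τ₀ := by
    have := pow_le_pow_left₀ (norm_nonneg _) (h.norm_sub_le hw (h.mem 0 N.zero_le)) 2
    nlinarith [h.le_τ₀]
  have h3 : ∀ k ∈ Finset.range N, ⟪g k, x k - w⟫ - κ / 2 * ‖x k - w‖ ^ 2 ≤
      (⟪g k, x k - leader S κ τ₀ g x (k - 1)⟫ +
        (‖g k‖ * ((‖g (k - 1)‖ + 2 * R * κ) / curvature κ τ₀ k) +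
         ‖g k‖ * ((‖g k‖ + 2 * R * κ) / curvature κ τ₀ (k + 1)))) +
      ((⟪leader S κ τ₀ g x (k + 1), g k⟫ + κ / 2 * ‖leader S κ τ₀ g x (k + 1) - x k‖ ^ 2) -
        (⟪w, g k⟫ + κ / 2 * ‖w - x k‖ ^ 2)) := by
    intro k hk
    have hkN : k ≤ N := (Finset.mem_range.1 hk).le
    have e1 : ⟪g k, x k - w⟫ = ⟪g k, x k - leader S κ τ₀ g x (k - 1)⟫
        + ⟪g k, leader S κ τ₀ g x (k - 1) - leader S κ τ₀ g x k⟫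
        + ⟪g k, leader S κ τ₀ g x k - leader S κ τ₀ g x (k + 1)⟫
        + ⟪leader S κ τ₀ g x (k + 1), g k⟫ - ⟪w, g k⟫ := by
      rw [real_inner_comm (g k) (leader S κ τ₀ g x (k + 1)), real_inner_comm (g k) w]
      simp only [inner_sub_right]
      ring
    have e2 := (real_inner_le_norm (g k) (leader S κ τ₀ g x (k - 1) - leader S κ τ₀ g x k)).trans
      (mul_le_mul_of_nonneg_left (h.norm_leader_pred_sub_le hkN) (norm_nonneg _))
    have e3 := (real_inner_le_norm (g k) (leader S κ τ₀ g x k - leader S κ τ₀ g x (k + 1))).trans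
      (mul_le_mul_of_nonneg_left (h.norm_leader_sub_succ_le hkN) (norm_nonneg _))
    have e4 : 0 ≤ κ / 2 * ‖leader S κ τ₀ g x (k + 1) - x k‖ ^ 2 := by
      have := h.κ_pos; positivity
    rw [norm_sub_rev w]
    linarith
  have h4 := Finset.sum_le_sum h3
  simp only [Finset.sum_add_distrib, Finset.sum_sub_distrib] at h1 h4 ⊢
  linarith

/-- The optimality gap at the start of a block: what was left at the end of the previous block,
plus the effect of the new loss. -/
lemma start_gap_le (h : IsDelayedFTRL S R κ τ₀ N g x) {k : ℕ} (hk : k + 1 ≤ N) :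
    ftrlObjective κ τ₀ g x (k + 1) (x (k + 1)) -
        ftrlObjective κ τ₀ g x (k + 1) (leader S κ τ₀ g x (k + 1)) ≤
      ftrlObjective κ τ₀ g x k (x (k + 1)) - ftrlObjective κ τ₀ g x k (leader S κ τ₀ g x k) +
        (‖g k‖ + 2 * R * κ) * (5 * R / cbrtCurvature κ τ₀ (k + 1) +
          (‖g k‖ + 2 * R * κ) / curvature κ τ₀ (k + 1)) := by
  have h1 := h.leader_min k (h.leader_mem (k + 1))
  have h2 := h.norm_sub_leader_le hk
  have h3 := h.norm_leader_sub_succ_le (Nat.le_of_succ_le hk)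
  have hx := h.mem k (Nat.le_of_succ_le hk)
  have h4 := h.norm_sub_le (h.mem (k + 1) hk) hx
  have h5 := h.norm_sub_le (h.leader_mem (k + 1)) hx
  have hκ := h.κ_pos
  have hR := h.R_pos
  rw [Nat.add_sub_cancel] at h2
  rw [ftrlObjective_succ, ftrlObjective_succ]
  set ℓ := leader S κ τ₀ g x k
  set ℓ' := leader S κ τ₀ g x (k + 1)
  have h6 : ‖x (k + 1) - ℓ'‖ ≤ 5 * R / cbrtCurvature κ τ₀ (k + 1) +
      (‖g k‖ + 2 * R * κ) / curvature κ τ₀ (k + 1) := by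
    have : x (k + 1) - ℓ' = (x (k + 1) - ℓ) + (ℓ - ℓ') := by abel
    rw [this]
    exact (norm_add_le _ _).trans (add_le_add h2 h3)
  have h7 : ⟪x (k + 1), g k⟫ - ⟪ℓ', g k⟫ ≤ ‖g k‖ * ‖x (k + 1) - ℓ'‖ := by
    rw [← inner_sub_left, mul_comm]
    exact real_inner_le_norm _ _
  have h8 : ‖x (k + 1) - x k‖ ^ 2 - ‖ℓ' - x k‖ ^ 2 ≤ 4 * R * ‖x (k + 1) - ℓ'‖ := by
    have e1 : ‖x (k + 1) - x k‖ ≤ ‖x (k + 1) - ℓ'‖ + ‖ℓ' - x k‖ := by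
      have : x (k + 1) - x k = (x (k + 1) - ℓ') + (ℓ' - x k) := by abel
      rw [this]; exact norm_add_le _ _
    have e2 := norm_nonneg (x (k + 1) - ℓ')
    rcases le_total ‖x (k + 1) - x k‖ ‖ℓ' - x k‖ with h0 | h0
    · have := pow_le_pow_left₀ (norm_nonneg _) h0 2
      nlinarith
    · nlinarith [norm_nonneg (x (k + 1) - x k), norm_nonneg (ℓ' - x k)]
  have h9 : (‖g k‖ + 2 * R * κ) * ‖x (k + 1) - ℓ'‖ ≤ (‖g k‖ + 2 * R * κ) *
      (5 * R / cbrtCurvature κ τ₀ (k + 1) + (‖g k‖ + 2 * R * κ) / curvature κ τ₀ (k + 1)) :=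
    mul_le_mul_of_nonneg_left h6 (by positivity)
  have h10 := mul_le_mul_of_nonneg_left h8 (by positivity : 0 ≤ κ / 2)
  linarith

/-- The optimality gap at the end of a block is bounded by the tolerance. -/
lemma end_gap_le (h : IsDelayedFTRL S R κ τ₀ N g x) {k : ℕ} (hk : k + 1 ≤ N) :
    ftrlObjective κ τ₀ g x k (x (k + 1)) - ftrlObjective κ τ₀ g x k (leader S κ τ₀ g x k) ≤
      16 * R ^ 2 * cbrtCurvature κ τ₀ (k + 1) := by
  have hy := h.two_le_cbrt (k + 1)
  have hR := h.R_pos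
  cases k with
  | zero => rw [zero_add, h.first, h.leader_zero, sub_self]; rw [zero_add] at hy; positivity
  | succ k =>
    have h1 := h.gap (k + 1) (Nat.le_add_left 1 k) hk _ (h.leader_mem (k + 1))
    have h2 := quadratic_expand (curvature κ τ₀ (k + 1)) (ftrlPole κ τ₀ g x (k + 1))
      (τ₀ / 2 * ‖x 0‖ ^ 2 + ∑ i ∈ Finset.range (k + 1), κ / 2 * ‖x i‖ ^ 2)
      (leader S κ τ₀ g x (k + 1)) (x (k + 1 + 1))
    have h3 : 0 ≤ curvature κ τ₀ (k + 1) / 2 *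
        ‖leader S κ τ₀ g x (k + 1) - x (k + 1 + 1)‖ ^ 2 :=
      mul_nonneg (by linarith [h.curvature_pos (k + 1)]) (sq_nonneg _)
    rw [← neg_sub (x (k + 1 + 1)), inner_neg_right, neg_sub] at h2
    simp only [ftrlObjective]
    change _ ≤ 16 * R ^ 2 * cbrtCurvature κ τ₀ (k + 1 + 1) at h1
    linarith

lemma cbrt_succ_bounds (h : IsDelayedFTRL S R κ τ₀ N g x) (k : ℕ) :
    cbrtCurvature κ τ₀ k ≤ cbrtCurvature κ τ₀ (k + 1) ∧
      cbrtCurvature κ τ₀ (k + 1) ≤ 11 / 10 * cbrtCurvature κ τ₀ k ∧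
      (cbrtCurvature κ τ₀ (k + 1) - cbrtCurvature κ τ₀ k) * cbrtCurvature κ τ₀ k ≤ κ / 6 := by
  have h1 := h.cbrt_cube k
  have h2 := h.cbrt_cube (k + 1)
  have h3 := h.curvature_succ_le k
  have h4 := h.two_le_cbrt k
  have h4' := h.two_le_cbrt (k + 1)
  have h5 := curvature_succ κ τ₀ k
  have hκ := h.κ_pos
  set y := cbrtCurvature κ τ₀ k
  set y' := cbrtCurvature κ τ₀ (k + 1)
  have hle : y ≤ y' := by
    by_contra! hlt
    have : y' ^ 3 < y ^ 3 := by gcongr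
    linarith
  refine ⟨hle, ?_, ?_⟩
  · by_contra! hlt
    have : (11 / 10 * y) ^ 3 < y' ^ 3 := by gcongr
    have : 0 < y ^ 3 := by positivity
    nlinarith
  · have h6 : y' ^ 3 - y ^ 3 = κ := by linarith
    have h7 : 3 * y ^ 2 * (y' - y) ≤ y' ^ 3 - y ^ 3 := by
      nlinarith [mul_nonneg (sq_nonneg (y' - y)) (by linarith : 0 ≤ y' + 2 * y)]
    have h8 : 0 ≤ y * (y' - y) := mul_nonneg (by linarith) (by linarith)
    nlinarith

/-- The potential argument for the number of Frank-Wolfe iterations. Every iteration uses up a fixed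
part of the optimality gap, and the gap left at the end of a block is handed to the next one: only
the growth of the gap between blocks has to be paid for. -/
theorem sum_calls_le (h : IsDelayedFTRL S R κ τ₀ N g x) {L : ℕ → ℕ}
    (hL : ∀ k, 1 ≤ k → k + 1 ≤ N → ftrlObjective κ τ₀ g x k (x (k + 1)) +
      ((L k : ℝ) - 1) * (32 * R ^ 2 / cbrtCurvature κ τ₀ (k + 1)) ≤
        ftrlObjective κ τ₀ g x k (x k)) (j : ℕ) (hj : j + 1 ≤ N) :
    ∑ k ∈ Finset.range j, (L (k + 1) : ℝ) ≤ ∑ k ∈ Finset.range j, (1 + κ / 12 +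
      11 / 320 / R ^ 2 * (5 * R * (‖g k‖ + 2 * R * κ) +
        (‖g k‖ + 2 * R * κ) ^ 2 / cbrtCurvature κ τ₀ (k + 1) ^ 2)) := by
  have hR := h.R_pos
  have hκ := h.κ_pos
  -- the potential is the optimality gap divided by the guaranteed decrease `32 R ^ 2 / β ^ (1 / 3)`
  suffices key : ∀ j, j + 1 ≤ N → ∑ k ∈ Finset.range j, (L (k + 1) : ℝ) +
      cbrtCurvature κ τ₀ (j + 1) / (32 * R ^ 2) * (ftrlObjective κ τ₀ g x j (x (j + 1)) -
        ftrlObjective κ τ₀ g x j (leader S κ τ₀ g x j)) ≤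
      ∑ k ∈ Finset.range j, (1 + κ / 12 + 11 / 320 / R ^ 2 * (5 * R * (‖g k‖ + 2 * R * κ) +
        (‖g k‖ + 2 * R * κ) ^ 2 / cbrtCurvature κ τ₀ (k + 1) ^ 2)) by
    have h1 := key j hj
    have h2 : 0 ≤ cbrtCurvature κ τ₀ (j + 1) / (32 * R ^ 2) *
        (ftrlObjective κ τ₀ g x j (x (j + 1)) -
        ftrlObjective κ τ₀ g x j (leader S κ τ₀ g x j)) := by
      have := h.leader_min j (h.mem (j + 1) hj)
      have := h.two_le_cbrt (j + 1)
      exact mul_nonneg (by positivity) (by linarith)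
    linarith
  intro j
  induction j with
  | zero =>
    intro _
    rw [zero_add, h.first, h.leader_zero]
    simp
  | succ j ih =>
    intro hj
    have ih := ih (by omega)
    rw [Finset.sum_range_succ, Finset.sum_range_succ]
    have hs := h.start_gap_le (k := j) (by omega)
    have he := h.end_gap_le (k := j) (by omega)
    have hc := hL (j + 1) (Nat.le_add_left 1 j) hj
    have hy2 := h.two_le_cbrt (j + 1)
    have hy2' := h.two_le_cbrt (j + 1 + 1)
    obtain ⟨hy, hy', hyκ⟩ := h.cbrt_succ_bounds (j + 1)
    rw [← h.cbrt_cube (j + 1)] at hs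
    set y := cbrtCurvature κ τ₀ (j + 1)
    set y' := cbrtCurvature κ τ₀ (j + 1 + 1)
    set e := ftrlObjective κ τ₀ g x j (x (j + 1)) -
      ftrlObjective κ τ₀ g x j (leader S κ τ₀ g x j)
    set Γ := ‖g j‖ + 2 * R * κ with hΓ
    have hΓ0 : 0 ≤ Γ := by positivity
    have hLs : (L (j + 1) : ℝ) + y' / (32 * R ^ 2) *
        (ftrlObjective κ τ₀ g x (j + 1) (x (j + 1 + 1)) -
          ftrlObjective κ τ₀ g x (j + 1) (leader S κ τ₀ g x (j + 1)))
        ≤ 1 + y' / (32 * R ^ 2) * (ftrlObjective κ τ₀ g x (j + 1) (x (j + 1)) -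
          ftrlObjective κ τ₀ g x (j + 1) (leader S κ τ₀ g x (j + 1))) := by
      have h1 := mul_le_mul_of_nonneg_left hc (by positivity : 0 ≤ y' / (32 * R ^ 2))
      have h2 : y' / (32 * R ^ 2) * (((L (j + 1) : ℝ) - 1) * (32 * R ^ 2 / y')) =
          L (j + 1) - 1 := by field_simp
      rw [mul_add, h2] at h1
      linarith
    have h1 := mul_le_mul_of_nonneg_left hs (by positivity : 0 ≤ y' / (32 * R ^ 2))
    -- the weight of the potential grows with the curvature, at a cost of `κ / 12` per block
    have h2 : y' / (32 * R ^ 2) * e ≤ y / (32 * R ^ 2) * e + κ / 12 := by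
      have e1 : (y' - y) * e ≤ (y' - y) * (16 * R ^ 2 * y) :=
        mul_le_mul_of_nonneg_left he (by linarith)
      have e2 : (y' - y) * (16 * R ^ 2 * y) ≤ 16 * R ^ 2 * (κ / 6) := by
        nlinarith [mul_le_mul_of_nonneg_left hyκ (by positivity : 0 ≤ 16 * R ^ 2)]
      have e3 : y' / (32 * R ^ 2) * e = y / (32 * R ^ 2) * e + (y' - y) * e / (32 * R ^ 2) := by
        field_simp; ring
      rw [e3]
      have e4 : (y' - y) * e / (32 * R ^ 2) ≤ κ / 12 := by
        rw [div_le_iff₀ (by positivity)]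
        linarith
      linarith
    have h3 : y' / (32 * R ^ 2) * (Γ * (5 * R / y + Γ / y ^ 3)) ≤
        11 / 320 / R ^ 2 * (5 * R * Γ + Γ ^ 2 / y ^ 2) := by
      have e1 : y' / (32 * R ^ 2) * (Γ * (5 * R / y + Γ / y ^ 3)) ≤
          (11 / 10 * y) / (32 * R ^ 2) * (Γ * (5 * R / y + Γ / y ^ 3)) := by gcongr
      refine e1.trans (le_of_eq ?_)
      field_simp
      ring
    linarith

end IsDelayedFTRL

end FTRL

/-! ### The shrunk feasible set -/

section Shrunk

variable {n : ℕ} {𝒦 : Set (Vec n)} {r R δ : ℝ}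

lemma radius_le [Nontrivial (Vec n)] (hr : 0 < r) (hr𝒦 : Metric.closedBall 0 r ⊆ 𝒦)
    (h𝒦R : 𝒦 ⊆ Metric.closedBall 0 R) : r ≤ R := by
  obtain ⟨a, ha⟩ := exists_norm_eq (Vec n) hr.le
  have := h𝒦R (hr𝒦 (a := a) (by simp [ha]))
  simpa [ha] using this

lemma isClosed_shrunkSet (h𝒦comp : IsCompact 𝒦) : IsClosed (shrunkSet 𝒦 r δ) :=
  (h𝒦comp.smul _).isClosed

lemma convex_shrunkSet (h𝒦conv : Convex ℝ 𝒦) : Convex ℝ (shrunkSet 𝒦 r δ) := h𝒦conv.smul _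

lemma norm_le_of_mem_shrunkSet (h𝒦R : 𝒦 ⊆ Metric.closedBall 0 R) (hr : 0 < r) (hδ : 0 < δ)
    (hδr : δ ≤ r) {a : Vec n} (ha : a ∈ shrunkSet 𝒦 r δ) : ‖a‖ ≤ R := by
  obtain ⟨b, hb, rfl⟩ := ha
  have h1 : ‖b‖ ≤ R := by simpa using h𝒦R hb
  have h2 : 0 ≤ 1 - δ / r := sub_nonneg.2 ((div_le_one hr).2 hδr)
  have h3 : 1 - δ / r ≤ 1 := by have := div_pos hδ hr; linarith
  simp only [norm_smul, Real.norm_of_nonneg h2]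
  exact (mul_le_of_le_one_left (norm_nonneg _) h3).trans h1

lemma add_smul_mem_of_mem_shrunkSet (h𝒦conv : Convex ℝ 𝒦) (hr𝒦 : Metric.closedBall 0 r ⊆ 𝒦)
    (hr : 0 < r) (hδ : 0 < δ) (hδr : δ ≤ r) {a : Vec n} (ha : a ∈ shrunkSet 𝒦 r δ) {w : Vec n}
    (hw : ‖w‖ ≤ 1) : a + δ • w ∈ 𝒦 := by
  obtain ⟨b, hb, rfl⟩ := ha
  have h1 : r • w ∈ 𝒦 := hr𝒦 (by
    simp only [mem_closedBall_zero_iff, norm_smul, Real.norm_of_nonneg hr.le]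
    exact mul_le_of_le_one_right hr.le hw)
  have h2 := h𝒦conv hb h1 (sub_nonneg.2 ((div_le_one hr).2 hδr)) (div_pos hδ hr).le
    (sub_add_cancel _ _)
  rwa [smul_smul, div_mul_cancel₀ _ hr.ne'] at h2

end Shrunk

/-! ### The algorithm is a delayed follow-the-regularized-leader method -/

section Path

variable {n : ℕ} {𝒦 : Set (Vec n)} {r R δ α T₀ : ℝ} {T K : ℕ} {ε : ℕ → ℝ} {f : ℕ → Vec n → ℝ}
  {u : ℕ → USphere n} {x : ℕ → Vec n} {z v : ℕ → ℕ → Vec n}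

/-- In every realization the Frank-Wolfe procedures stop, and the iterates that they return form a
run of delayed follow-the-regularized-leader. -/
theorem IsBanditFWPath.isDelayedFTRL (hp : IsBanditFWPath 𝒦 r T K α δ T₀ ε f u x z v)
    (h𝒦conv : Convex ℝ 𝒦) (h𝒦comp : IsCompact 𝒦) (h𝒦R : 𝒦 ⊆ Metric.closedBall 0 R)
    (hr : 0 < r) (hR : 0 < R) (hδ : 0 < δ) (hδr : δ ≤ r) (hα : 0 < α) (hK : 1 ≤ K)
    (hT₀K : 4 * K ≤ T₀) (hT₀α : 8 / α ≤ T₀)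
    (hε : ∀ m, ε m = 16 * R ^ 2 * (α * (m * K + T₀)) ^ (1 / 3 : ℝ)) :
    IsDelayedFTRL (shrunkSet 𝒦 r δ) R (K * α) (T₀ * α) (T / K)
        (fun i => blockEstimate K δ f x u (i + 1)) x ∧
      ∃ L : ℕ → ℕ, ∀ k, 1 ≤ k → k + 1 ≤ T / K → 1 ≤ L k ∧
        fwCalls (blockObjective K α δ T₀ f x u (k + 1)) (ε (k + 1)) (z (k + 1)) (v (k + 1)) = L k ∧
        fwGap (blockObjective K α δ T₀ f x u (k + 1)) (z (k + 1)) (v (k + 1)) (L k) ≤ ε (k + 1) ∧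
        x (k + 1) = z (k + 1) (L k) ∧
        ftrlObjective (K * α) (T₀ * α) (fun i => blockEstimate K δ f x u (i + 1)) x k (x (k + 1)) +
          ((L k : ℝ) - 1) * (32 * R ^ 2 / cbrtCurvature (K * α) (T₀ * α) (k + 1)) ≤
        ftrlObjective (K * α) (T₀ * α) (fun i => blockEstimate K δ f x u (i + 1)) x k (x k) := by
  set S := shrunkSet 𝒦 r δ with hS
  set g : ℕ → Vec n := fun i => blockEstimate K δ f x u (i + 1) with hg
  set N := T / K
  have hK0 : (0 : ℝ) < K := by exact_mod_cast hK
  have h0 : IsDelayedFTRL S R (K * α) (T₀ * α) 0 g x :=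
    { conv := convex_shrunkSet h𝒦conv
      closed := isClosed_shrunkSet h𝒦comp
      norm_le := fun a ha => norm_le_of_mem_shrunkSet h𝒦R hr hδ hδr ha
      R_pos := hR
      κ_pos := by positivity
      κ_le := by nlinarith
      le_τ₀ := by rwa [div_le_iff₀ hα] at hT₀α
      first := hp.first
      mem := fun k hk => by rw [Nat.le_zero.1 hk]; exact hp.start
      gap := fun k _ hk2 => by omega }
  have hcurv : ∀ k : ℕ, α * (k * K + T₀) = curvature (K * α) (T₀ * α) k := by
    intro k; rw [curvature]; ring
  have step : ∀ k, 1 ≤ k → k + 1 ≤ N → x k ∈ S → ∃ L : ℕ, x (k + 1) ∈ S ∧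
      (∀ a ∈ S, ⟪curvature (K * α) (T₀ * α) k • x (k + 1) - ftrlPole (K * α) (T₀ * α) g x k,
        x (k + 1) - a⟫ ≤ 16 * R ^ 2 * curvature (K * α) (T₀ * α) (k + 1) ^ (1 / 3 : ℝ)) ∧
      1 ≤ L ∧ fwCalls (blockObjective K α δ T₀ f x u (k + 1)) (ε (k + 1)) (z (k + 1))
        (v (k + 1)) = L ∧
      fwGap (blockObjective K α δ T₀ f x u (k + 1)) (z (k + 1)) (v (k + 1)) L ≤ ε (k + 1) ∧
      x (k + 1) = z (k + 1) L ∧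
      ftrlObjective (K * α) (T₀ * α) g x k (x (k + 1)) +
          ((L : ℝ) - 1) * (32 * R ^ 2 / cbrtCurvature (K * α) (T₀ * α) (k + 1)) ≤
        ftrlObjective (K * α) (T₀ * α) g x k (x k) := by
    intro k hk1 hk hxk
    have hmem : k + 1 ∈ Finset.Icc 2 N := Finset.mem_Icc.2 ⟨by omega, hk⟩
    have hfw := hp.inner (k + 1) hmem
    have hobj := blockObjective_eq_ftrlObjective K α δ T₀ f x u hp.first k
    have hy := h0.two_le_cbrt (k + 1)
    have hb := h0.curvature_pos k
    have hε' : ε (k + 1) = 16 * R ^ 2 * cbrtCurvature (K * α) (T₀ * α) (k + 1) := by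
      rw [hε, hcurv, cbrtCurvature]
    have hby : curvature (K * α) (T₀ * α) k ≤ cbrtCurvature (K * α) (T₀ * α) (k + 1) ^ 3 := by
      rw [h0.cbrt_cube, curvature_succ]; linarith [h0.κ_pos]
    rw [hobj] at hfw ⊢
    rw [Nat.add_sub_cancel] at hfw
    have hη : (0 : ℝ) < 32 * R ^ 2 / cbrtCurvature (K * α) (T₀ * α) (k + 1) := by positivity
    obtain ⟨L, hL1, hL2, hL3, hL4⟩ := IsFrankWolfe.calls hfw hb (R := R) (ε := ε (k + 1))
      (fun a ha a' ha' => h0.norm_sub_le ha ha') h0.conv hxk (by rw [hε']; positivity) hη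
      (by
        rw [hε', div_le_iff₀ (by linarith)]
        nlinarith [mul_le_mul_of_nonneg_left (mul_le_mul hy hy (by norm_num) (by linarith))
          (sq_nonneg R)])
      (by
        rw [hε', div_mul_eq_mul_div, div_le_iff₀ (by linarith)]
        nlinarith [mul_le_mul_of_nonneg_left hby (sq_nonneg (R ^ 2))])
      (fun a ha => h0.leader_min k ha)
    have hxz : x (k + 1) = z (k + 1) L := hp.output (k + 1) hmem L (by rw [hobj]; exact hL2)
    refine ⟨L, ?_, ?_, hL1, hL2, hL3, hxz, ?_⟩
    · rw [hxz]; exact hfw.mem h0.conv hxk L hL1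
    · intro a ha
      rw [hxz]
      exact (hfw.inner_le_gap hL1 ha).trans (hL3.trans_eq hε')
    · rw [hxz]; exact hL4
  have hmem : ∀ k ≤ N, x k ∈ S := by
    intro k
    induction k with
    | zero => exact fun _ => hp.start
    | succ k ih =>
      intro hk
      rcases Nat.eq_zero_or_pos k with rfl | hk1
      · rw [zero_add, hp.first]; exact hp.start
      · exact (step k hk1 hk (ih (by omega))).choose_spec.1
  choose! L hL using fun k (hk : (1 ≤ k ∧ k + 1 ≤ N)) => step k hk.1 hk.2 (hmem k (by omega))
  refine ⟨{ h0 with mem := hmem, gap := fun k h1 h2 => (hL k ⟨h1, h2⟩).2.1 }, L,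
    fun k h1 h2 => (hL k ⟨h1, h2⟩).2.2⟩

lemma totalCalls_eq_sum {L : ℕ → ℕ} (hL : ∀ k, 1 ≤ k → k + 1 ≤ T / K →
      fwCalls (blockObjective K α δ T₀ f x u (k + 1)) (ε (k + 1)) (z (k + 1)) (v (k + 1)) = L k) :
    totalCalls T K α δ T₀ ε f x u z v =
      ((∑ k ∈ Finset.range (T / K - 1), L (k + 1) : ℕ) : ℕ∞) := by
  have h1 : Finset.Icc 2 (T / K) = (Finset.range (T / K - 1)).image (fun k => k + 1 + 1) := by
    ext m
    simp only [Finset.mem_Icc, Finset.mem_image, Finset.mem_range]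
    constructor
    · rintro ⟨h1, h2⟩; exact ⟨m - 2, by omega, by omega⟩
    · rintro ⟨k, hk, rfl⟩; omega
  rw [totalCalls, h1, Finset.sum_image (by intro a _ b _ h; simpa using h), Nat.cast_sum]
  refine Finset.sum_congr rfl fun k hk => ?_
  have := Finset.mem_range.1 hk
  exact hL (k + 1) (by omega) (by omega)

end Path

/-! ### Measurability of the iterates -/

section Measurability

variable {n : ℕ} {Ω : Type*} [MeasurableSpace Ω]

lemma measurable_ftrlPole (κ τ₀ : ℝ) {g x : ℕ → Ω → Vec n} {k : ℕ} (hx0 : Measurable (x 0))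
    (hx : ∀ i < k, Measurable (x i)) (hg : ∀ i < k, Measurable (g i)) :
    Measurable fun ω => ftrlPole κ τ₀ (fun i => g i ω) (fun i => x i ω) k := by
  unfold ftrlPole
  refine (hx0.const_smul τ₀).add (Finset.measurable_fun_sum _ fun i hi => ?_)
  have hi := Finset.mem_range.1 hi
  exact ((hx i hi).const_smul κ).sub (hg i hi)

lemma measurable_leader {S : Set (Vec n)} (hne : S.Nonempty) (hcl : IsClosed S)
    (hconv : Convex ℝ S) (κ τ₀ : ℝ) {g x : ℕ → Ω → Vec n} {k : ℕ} (hx0 : Measurable (x 0))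
    (hx : ∀ i < k, Measurable (x i)) (hg : ∀ i < k, Measurable (g i)) :
    Measurable fun ω => leader S κ τ₀ (fun i => g i ω) (fun i => x i ω) k :=
  (continuous_nearestPoint hne hcl hconv).measurable.comp
    ((measurable_ftrlPole κ τ₀ hx0 hx hg).const_smul (curvature κ τ₀ k)⁻¹)

variable {S : Set (Vec n)} {b : ℝ} {p : Ω → Vec n} {c : Ω → ℝ} {xin : Ω → Vec n}
  {z v : ℕ → Ω → Vec n}

/-- The Frank-Wolfe iterates inherit measurability from the oracle answers: line search does not
involve a choice. -/
lemma measurable_frankWolfe (hfw : ∀ ω, IsFrankWolfe S (quadratic b (p ω) (c ω)) (xin ω)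
      (fun τ => z τ ω) (fun τ => v τ ω)) (hconv : Convex ℝ S) (hxin : ∀ ω, xin ω ∈ S)
    (hb : 0 < b) (hp : Measurable p) (hx : Measurable xin) (hv : ∀ τ, 1 ≤ τ → Measurable (v τ))
    (τ : ℕ) (hτ : 1 ≤ τ) : Measurable (z τ) := by
  induction τ, hτ using Nat.le_induction with
  | base => rwa [show z 1 = xin from funext fun ω => (hfw ω).init]
  | succ τ hτ ih =>
    have h : z (τ + 1) = fun ω => z τ ω + min 1 (⟪b • z τ ω - p ω, z τ ω - v τ ω⟫ /
        (b * ‖v τ ω - z τ ω‖ ^ 2)) • (v τ ω - z τ ω) :=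
      funext fun ω => (hfw ω).step_eq hconv (hxin ω) hb hτ
    have hv := hv τ hτ
    rw [h]
    exact ih.add ((measurable_const.min ((((ih.const_smul b).sub hp).inner (ih.sub hv)).div
      (((hv.sub ih).norm.pow_const 2).const_mul b))).smul (hv.sub ih))

lemma measurable_fwCalls {ε : ℝ} {L : Ω → ℕ}
    (hz : ∀ τ, 1 ≤ τ → Measurable (z τ)) (hp : Measurable p)
    (hv : ∀ τ, 1 ≤ τ → Measurable (v τ)) (hL1 : ∀ ω, 1 ≤ L ω)
    (hL : ∀ ω, fwCalls (quadratic b (p ω) (c ω)) ε (fun τ => z τ ω) (fun τ => v τ ω) = L ω)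
    (hgap : ∀ ω, fwGap (quadratic b (p ω) (c ω)) (fun τ => z τ ω) (fun τ => v τ ω) (L ω) ≤ ε) :
    Measurable L := by
  classical
  have hex : ∀ ω, ∃ τ, 1 ≤ τ ∧
      fwGap (quadratic b (p ω) (c ω)) (fun τ => z τ ω) (fun τ => v τ ω) τ ≤ ε :=
    fun ω => ⟨L ω, hL1 ω, hgap ω⟩
  have hfind : L = fun ω => Nat.find (hex ω) := by
    funext ω
    refine le_antisymm ?_ (Nat.find_min' _ ⟨hL1 ω, hgap ω⟩)
    have : fwCalls (quadratic b (p ω) (c ω)) ε (fun τ => z τ ω) (fun τ => v τ ω) ≤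
        (Nat.find (hex ω) : ℕ∞) :=
      iInf₂_le (f := fun (τ : ℕ) _ => (τ : ℕ∞)) (Nat.find (hex ω)) (Nat.find_spec (hex ω))
    rw [hL ω] at this
    exact_mod_cast this
  rw [hfind]
  refine measurable_find hex fun τ => ?_
  by_cases hτ : 1 ≤ τ
  · have hz := hz τ hτ
    simp only [hτ, true_and, fwGap_quadratic]
    exact measurableSet_le (((hz.const_smul b).sub hp).inner (hz.sub (hv τ hτ))) measurable_const
  · simp [hτ]

lemma measurable_eval_nat {E : Type*} [MeasurableSpace E] {z : ℕ → Ω → E} {L : Ω → ℕ}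
    (hz : ∀ τ, 1 ≤ τ → Measurable (z τ)) (hL : Measurable L) (hL1 : ∀ ω, 1 ≤ L ω) :
    Measurable fun ω => z (L ω) ω := by
  have h : (fun ω => z (L ω) ω) = fun ω => z (L ω - 1 + 1) ω :=
    funext fun ω => by rw [Nat.sub_add_cancel (hL1 ω)]
  rw [h]
  have h2 : Measurable fun q : ℕ × Ω => z (q.1 + 1) q.2 :=
    measurable_from_prod_countable_right fun τ => hz (τ + 1) (Nat.le_add_left 1 τ)
  exact h2.comp ((measurable_of_countable (fun m : ℕ => m - 1)).comp hL |>.prodMk measurable_id)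

lemma measurable_pointEstimate {δ : ℝ} {φ : Vec n → ℝ} (hφ : Continuous φ) {y : Ω → Vec n}
    {u : Ω → USphere n} (hy : Measurable y) (hu : Measurable u) :
    Measurable fun ω => pointEstimate δ φ (y ω) (u ω) := by
  have : Continuous fun q : Vec n × USphere n => pointEstimate δ φ q.1 q.2 := by
    unfold pointEstimate; fun_prop
  exact this.measurable.comp (hy.prodMk hu)

lemma measurable_meanEstimate [Nontrivial (Vec n)] {δ : ℝ} {φ : Vec n → ℝ} (hφ : Continuous φ)
    {y : Ω → Vec n} (hy : Measurable y) : Measurable fun ω => meanEstimate δ φ (y ω) := by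
  have : Continuous fun q : Vec n × USphere n => pointEstimate δ φ q.1 q.2 := by
    unfold pointEstimate; fun_prop
  have h2 : StronglyMeasurable fun y => meanEstimate δ φ y :=
    StronglyMeasurable.integral_prod_right (ν := uniformSphere n)
      (f := fun y u => pointEstimate δ φ y u) this.stronglyMeasurable
  exact h2.measurable.comp hy

end Measurability

/-! ### Adaptedness of a run -/

/-- The assumptions on the feasible set, the losses and the parameters for a fixed radius `δ`. The
functions `F t` extend the losses from `𝒦` to the whole space with the same Lipschitz constant;
they make the smoothed losses and the measurability of the estimates independent of the values of
`f t` outside `𝒦`. The condition `dvd` says that the blocks exhaust the `T` rounds. -/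
structure BanditSetup {n : ℕ} (𝒦 : Set (Vec n)) (r R G M α δ T₀ : ℝ) (T K : ℕ)
    (ε : ℕ → ℝ) (f F : ℕ → Vec n → ℝ) : Prop where
  conv : Convex ℝ 𝒦
  comp : IsCompact 𝒦
  r_pos : 0 < r
  ball_subset : Metric.closedBall 0 r ⊆ 𝒦
  subset_ball : 𝒦 ⊆ Metric.closedBall 0 R
  α_pos : 0 < α
  G_pos : 0 < G
  M_pos : 0 < M
  δ_pos : 0 < δ
  δ_le : δ ≤ r
  K_pos : 1 ≤ K
  le_T₀ : 4 * K ≤ T₀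
  α_le_T₀ : 8 / α ≤ T₀
  dvd : T / K * K = T
  hε : ∀ m, ε m = 16 * R ^ 2 * (α * (m * K + T₀)) ^ (1 / 3 : ℝ)
  strong : ∀ t ∈ Finset.Icc 1 T, StrongConvexOn 𝒦 α (f t)
  bdd : ∀ t ∈ Finset.Icc 1 T, ∀ a ∈ 𝒦, |f t a| ≤ M
  eqOn : ∀ t ∈ Finset.Icc 1 T, Set.EqOn (f t) (F t) 𝒦
  lip : ∀ t ∈ Finset.Icc 1 T, ∀ a b, |F t a - F t b| ≤ G * ‖a - b‖

section Run

variable {n : ℕ} {𝒦 : Set (Vec n)} {r R G M α δ T₀ : ℝ} {T K : ℕ}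
  {ε : ℕ → ℝ} {f F : ℕ → Vec n → ℝ} {Ω : Type*} {mΩ : MeasurableSpace Ω} {P : Measure Ω}
  {ℱ : Filtration ℕ mΩ} {u : ℕ → Ω → USphere n} {x : ℕ → Ω → Vec n} {z v : ℕ → ℕ → Ω → Vec n}

lemma play_round {K k i : ℕ} (hi : i < K) (δ : ℝ) (x : ℕ → Vec n) (u : ℕ → USphere n) :
    play K δ x u (k * K + (i + 1)) = x k + δ • (u (k * K + (i + 1)) : Vec n) := by
  rw [play, ← add_assoc, Nat.add_sub_cancel, mul_comm, Nat.mul_add_div (by omega),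
    Nat.div_eq_of_lt hi, add_zero]

lemma BanditSetup.curvature_pos (hs : BanditSetup 𝒦 r R G M α δ T₀ T K ε f F) (k : ℕ) :
    0 < curvature (K * α) (T₀ * α) k := by
  have hT₀ : 0 < T₀ := (div_pos (by norm_num) hs.α_pos).trans_le hs.α_le_T₀
  have := hs.α_pos
  rw [curvature]
  positivity

lemma round_mem (hs : BanditSetup 𝒦 r R G M α δ T₀ T K ε f F) {k i : ℕ} (hk : k < T / K)
    (hi : i < K) : k * K + (i + 1) ∈ Finset.Icc 1 T := by
  have h1 : (k + 1) * K ≤ T / K * K := Nat.mul_le_mul_right _ hk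
  rw [hs.dvd] at h1
  rw [Finset.mem_Icc]
  constructor
  · omega
  · rw [add_mul, one_mul] at h1; omega

variable [Nontrivial (Vec n)]

lemma BanditSetup.R_pos (hs : BanditSetup 𝒦 r R G M α δ T₀ T K ε f F) : 0 < R :=
  hs.r_pos.trans_le (radius_le hs.r_pos hs.ball_subset hs.subset_ball)

namespace IsBanditFWRun

lemma isDelayedFTRL (hrun : IsBanditFWRun 𝒦 r T K α δ T₀ ε f P ℱ u x z v)
    (hs : BanditSetup 𝒦 r R G M α δ T₀ T K ε f F) (ω : Ω) :
    IsDelayedFTRL (shrunkSet 𝒦 r δ) R (K * α) (T₀ * α) (T / K)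
        (fun k => blockEstimate K δ f (fun m => x m ω) (fun t => u t ω) (k + 1))
        (fun m => x m ω) ∧
      ∃ L : ℕ → ℕ, ∀ k, 1 ≤ k → k + 1 ≤ T / K → 1 ≤ L k ∧
        fwCalls (blockObjective K α δ T₀ f (fun m => x m ω) (fun t => u t ω) (k + 1)) (ε (k + 1))
          (fun τ => z (k + 1) τ ω) (fun τ => v (k + 1) τ ω) = L k ∧
        fwGap (blockObjective K α δ T₀ f (fun m => x m ω) (fun t => u t ω) (k + 1))
          (fun τ => z (k + 1) τ ω) (fun τ => v (k + 1) τ ω) (L k) ≤ ε (k + 1) ∧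
        x (k + 1) ω = z (k + 1) (L k) ω ∧
        ftrlObjective (K * α) (T₀ * α)
            (fun k => blockEstimate K δ f (fun m => x m ω) (fun t => u t ω) (k + 1))
            (fun m => x m ω) k (x (k + 1) ω) +
          ((L k : ℝ) - 1) * (32 * R ^ 2 / cbrtCurvature (K * α) (T₀ * α) (k + 1)) ≤
        ftrlObjective (K * α) (T₀ * α)
            (fun k => blockEstimate K δ f (fun m => x m ω) (fun t => u t ω) (k + 1))
            (fun m => x m ω) k (x k ω) :=
  (hrun.path ω).isDelayedFTRL hs.conv hs.comp hs.subset_ball hs.r_pos hs.R_pos hs.δ_pos hs.δ_le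
    hs.α_pos hs.K_pos hs.le_T₀ hs.α_le_T₀ hs.hε

lemma mem (hrun : IsBanditFWRun 𝒦 r T K α δ T₀ ε f P ℱ u x z v)
    (hs : BanditSetup 𝒦 r R G M α δ T₀ T K ε f F) {k : ℕ} (hk : k ≤ T / K) (ω : Ω) :
    x k ω ∈ shrunkSet 𝒦 r δ := (hrun.isDelayedFTRL hs ω).1.mem k hk

lemma play_mem (hrun : IsBanditFWRun 𝒦 r T K α δ T₀ ε f P ℱ u x z v)
    (hs : BanditSetup 𝒦 r R G M α δ T₀ T K ε f F) {k : ℕ} (hk : k ≤ T / K) (ω : Ω)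
    (w : USphere n) : x k ω + δ • (w : Vec n) ∈ 𝒦 :=
  add_smul_mem_of_mem_shrunkSet hs.conv hs.ball_subset hs.r_pos hs.δ_pos hs.δ_le
    (hrun.mem hs hk ω) (norm_eq_of_mem_sphere w).le

lemma blockEstimate_eq (hrun : IsBanditFWRun 𝒦 r T K α δ T₀ ε f P ℱ u x z v)
    (hs : BanditSetup 𝒦 r R G M α δ T₀ T K ε f F) {k : ℕ} (hk : k < T / K) (ω : Ω) :
    blockEstimate K δ f (fun m => x m ω) (fun t => u t ω) (k + 1) =
      ∑ i ∈ Finset.range K,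
        pointEstimate δ (F (k * K + (i + 1))) (x k ω) (u (k * K + (i + 1)) ω) := by
  rw [blockEstimate, sum_Icc_one]
  refine Finset.sum_congr rfl fun i hi => ?_
  have hi := Finset.mem_range.1 hi
  rw [Nat.add_sub_cancel, roundEstimate, pointEstimate, play_round hi,
    hs.eqOn _ (round_mem hs hk hi) (hrun.play_mem hs hk.le ω _)]

omit [Nontrivial (Vec n)] in
lemma measurable_partial (hrun : IsBanditFWRun 𝒦 r T K α δ T₀ ε f P ℱ u x z v)
    (hs : BanditSetup 𝒦 r R G M α δ T₀ T K ε f F) {k : ℕ} (hk : k < T / K)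
    (hx : Measurable[ℱ (k * K)] (x k)) {i j : ℕ} (hij : i < j) (hj : j ≤ K) :
    Measurable[ℱ (k * K + j)] fun ω =>
      pointEstimate δ (F (k * K + (i + 1))) (x k ω) (u (k * K + (i + 1)) ω) := by
  have hmem := round_mem hs hk (hij.trans_le hj)
  refine @measurable_pointEstimate _ _ (ℱ (k * K + j)) _ _
    (continuous_of_abs_sub_le (hs.lip _ hmem)) _ _ ?_ ?_
  · exact hx.mono (ℱ.mono (by omega)) le_rfl
  · exact (hrun.u_measurable _ hmem).mono (ℱ.mono (by omega)) le_rfl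

/-- The iterate used in a block is known when the block starts, and its gradient estimates when it
ends. -/
theorem adapted (hrun : IsBanditFWRun 𝒦 r T K α δ T₀ ε f P ℱ u x z v)
    (hs : BanditSetup 𝒦 r R G M α δ T₀ T K ε f F) {L : Ω → ℕ → ℕ}
    (hL : ∀ ω k, 1 ≤ k → k + 1 ≤ T / K → 1 ≤ L ω k ∧
        fwCalls (blockObjective K α δ T₀ f (fun m => x m ω) (fun t => u t ω) (k + 1)) (ε (k + 1))
          (fun τ => z (k + 1) τ ω) (fun τ => v (k + 1) τ ω) = L ω k ∧
        fwGap (blockObjective K α δ T₀ f (fun m => x m ω) (fun t => u t ω) (k + 1))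
          (fun τ => z (k + 1) τ ω) (fun τ => v (k + 1) τ ω) (L ω k) ≤ ε (k + 1) ∧
        x (k + 1) ω = z (k + 1) (L ω k) ω) (k : ℕ) (hk : k ≤ T / K) :
    (∀ i ≤ k, Measurable[ℱ (i * K)] (x i)) ∧
    (∀ i < k, Measurable[ℱ ((i + 1) * K)]
      fun ω => blockEstimate K δ f (fun m => x m ω) (fun t => u t ω) (i + 1)) ∧
    (∀ i < k, 1 ≤ i → Measurable[ℱ ((i + 1) * K)] fun ω => L ω i) := by
  induction k with
  | zero =>
    refine ⟨fun i hi => ?_, fun i hi => by omega, fun i hi => by omega⟩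
    rw [Nat.le_zero.1 hi, zero_mul]
    exact hrun.start_measurable
  | succ k ih =>
    obtain ⟨ihx, ihg, ihL⟩ := ih (by omega)
    have hg : Measurable[ℱ ((k + 1) * K)]
        fun ω => blockEstimate K δ f (fun m => x m ω) (fun t => u t ω) (k + 1) := by
      simp only [hrun.blockEstimate_eq hs hk]
      rw [add_mul, one_mul]
      exact @Finset.measurable_fun_sum _ _ _ _ _ _ (ℱ (k * K + K)) _ _ fun i hi =>
        hrun.measurable_partial hs hk (ihx k le_rfl) (Finset.mem_range.1 hi) le_rfl
    have hxL : Measurable[ℱ ((k + 1) * K)] (x (k + 1)) ∧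
        (1 ≤ k → Measurable[ℱ ((k + 1) * K)] fun ω => L ω k) := by
      rcases Nat.eq_zero_or_pos k with rfl | hk1
      · have h10 : x (0 + 1) = x 0 := funext fun ω => (hrun.path ω).first
        rw [h10]
        exact ⟨hrun.start_measurable.mono (ℱ.mono (by omega)) le_rfl, fun h => by omega⟩
      · have hmem : k + 1 ∈ Finset.Icc 2 (T / K) := Finset.mem_Icc.2 ⟨by omega, hk⟩
        have hobj := fun ω => blockObjective_eq_ftrlObjective K α δ T₀ f (fun m => x m ω)
          (fun t => u t ω) (hrun.path ω).first k
        have hmonox : ∀ i ≤ k, Measurable[ℱ ((k + 1) * K)] (x i) := fun i hi =>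
          (ihx i hi).mono (ℱ.mono (Nat.mul_le_mul_right _ (by omega))) le_rfl
        have hmonog : ∀ i < k, Measurable[ℱ ((k + 1) * K)] fun ω =>
            blockEstimate K δ f (fun m => x m ω) (fun t => u t ω) (i + 1) := fun i hi =>
          (ihg i hi).mono (ℱ.mono (Nat.mul_le_mul_right _ (by omega))) le_rfl
        have hpole := @measurable_ftrlPole _ _ (ℱ ((k + 1) * K)) (K * α) (T₀ * α)
          (fun i ω => blockEstimate K δ f (fun m => x m ω) (fun t => u t ω) (i + 1)) x k
          (hmonox 0 k.zero_le) (fun i hi => hmonox i hi.le) hmonog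
        have hv := hrun.oracle_measurable (k + 1) hmem
        have hfw := fun ω => (hrun.path ω).inner (k + 1) hmem
        simp only [hobj, Nat.add_sub_cancel] at hfw
        have hz := @measurable_frankWolfe _ _ (ℱ ((k + 1) * K)) _ _ _ _ _ _ _ hfw
          (convex_shrunkSet hs.conv) (fun ω => hrun.mem hs (by omega) ω)
          (hs.curvature_pos k) hpole (hmonox k le_rfl) hv
        have hLk := fun ω => hL ω k hk1 hk
        simp only [hobj] at hLk
        have hLm := @measurable_fwCalls _ _ (ℱ ((k + 1) * K)) _ _ _ _ _ _ _ hz hpole hv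
          (fun ω => (hLk ω).1) (fun ω => (hLk ω).2.1) (fun ω => (hLk ω).2.2.1)
        refine ⟨?_, fun _ => hLm⟩
        rw [show x (k + 1) = fun ω => z (k + 1) (L ω k) ω from funext fun ω => (hLk ω).2.2.2]
        exact @measurable_eval_nat _ (ℱ ((k + 1) * K)) _ _ _ _ hz hLm (fun ω => (hLk ω).1)
    refine ⟨fun i hi => ?_, fun i hi => ?_, fun i hi h1 => ?_⟩
    · rcases Nat.lt_or_eq_of_le hi with h | rfl
      · exact ihx i (by omega)
      · exact hxL.1
    · rcases Nat.lt_or_eq_of_le (Nat.le_of_lt_succ hi) with h | rfl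
      · exact ihg i h
      · exact hg
    · rcases Nat.lt_or_eq_of_le (Nat.le_of_lt_succ hi) with h | rfl
      · exact ihL i h h1
      · exact hxL.2 h1

end IsBanditFWRun

end Run

/-! ### Conditional means and second moments of the gradient estimates -/

section Moments

variable {n : ℕ} [Nontrivial (Vec n)]

/-- Against directions known in advance, the gradient estimate acts like its mean. -/
lemma integral_inner_pointEstimate {Ω : Type*} {m mΩ : MeasurableSpace Ω} {P : Measure Ω}
    [IsProbabilityMeasure P] (hm : m ≤ mΩ) {Y Z : Ω → Vec n} {U : Ω → USphere n}
    (hY : Measurable[m] Y) (hZ : Measurable[m] Z) (hU : Measurable U)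
    (hind : Indep (MeasurableSpace.comap U inferInstance) m P)
    (hlaw : P.map U = uniformSphere n) {δ : ℝ} {φ : Vec n → ℝ} (hφ : Continuous φ)
    (hint : Integrable (fun ω => ⟪pointEstimate δ φ (Y ω) (U ω), Z ω⟫) P) :
    ∫ ω, ⟪pointEstimate δ φ (Y ω) (U ω), Z ω⟫ ∂P = ∫ ω, ⟪meanEstimate δ φ (Y ω), Z ω⟫ ∂P := by
  have hWm : Measurable[m] fun ω => (Y ω, Z ω) := hY.prodMk hZ
  have hW : Measurable fun ω => (Y ω, Z ω) := hWm.mono hm le_rfl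
  have hIF : IndepFun (fun ω => (Y ω, Z ω)) U P :=
    (indep_of_indep_of_le_right hind hWm.comap_le).symm
  have hprod := (indepFun_iff_map_prod_eq_prod_map_map hW.aemeasurable hU.aemeasurable).1 hIF
  have hΦ : Continuous fun q : (Vec n × Vec n) × USphere n =>
      ⟪pointEstimate δ φ q.1.1 q.2, q.1.2⟫ := by
    unfold pointEstimate; fun_prop
  have hWU : Measurable fun ω => ((Y ω, Z ω), U ω) := hW.prodMk hU
  have hint' : Integrable (fun q : (Vec n × Vec n) × USphere n =>
      ⟪pointEstimate δ φ q.1.1 q.2, q.1.2⟫)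
      ((P.map fun ω => (Y ω, Z ω)).prod (uniformSphere n)) := by
    rw [← hlaw, ← hprod]
    exact (integrable_map_measure hΦ.aestronglyMeasurable hWU.aemeasurable).2 hint
  have h1 := integral_map (μ := P) hWU.aemeasurable hΦ.aestronglyMeasurable
  rw [hprod, hlaw, integral_prod _ hint'] at h1
  rw [← h1]
  simp only [← inner_meanEstimate hφ]
  refine integral_map hW.aemeasurable (f := fun q : Vec n × Vec n => ⟪meanEstimate δ φ q.1, q.2⟫)
    (Measurable.aestronglyMeasurable ?_)
  exact (measurable_meanEstimate hφ measurable_fst).inner measurable_snd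

variable {𝒦 : Set (Vec n)} {r R G M α δ T₀ : ℝ} {T K : ℕ}
  {ε : ℕ → ℝ} {f F : ℕ → Vec n → ℝ} {Ω : Type*} {mΩ : MeasurableSpace Ω} {P : Measure Ω}
  {ℱ : Filtration ℕ mΩ} {u : ℕ → Ω → USphere n} {x : ℕ → Ω → Vec n} {z v : ℕ → ℕ → Ω → Vec n}

namespace IsBanditFWRun

lemma measurable_iterate (hrun : IsBanditFWRun 𝒦 r T K α δ T₀ ε f P ℱ u x z v)
    (hs : BanditSetup 𝒦 r R G M α δ T₀ T K ε f F) {k : ℕ} (hk : k ≤ T / K) :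
    Measurable[ℱ (k * K)] (x k) := by
  choose L hL using fun ω => (hrun.isDelayedFTRL hs ω).2
  exact (hrun.adapted hs (L := L) (fun ω k h1 h2 => ⟨(hL ω k h1 h2).1, (hL ω k h1 h2).2.1,
    (hL ω k h1 h2).2.2.1, (hL ω k h1 h2).2.2.2.1⟩) k hk).1 k le_rfl

lemma measurable_blockEstimate (hrun : IsBanditFWRun 𝒦 r T K α δ T₀ ε f P ℱ u x z v)
    (hs : BanditSetup 𝒦 r R G M α δ T₀ T K ε f F) {k : ℕ} (hk : k < T / K) :
    Measurable[ℱ ((k + 1) * K)]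
      fun ω => blockEstimate K δ f (fun m => x m ω) (fun t => u t ω) (k + 1) := by
  choose L hL using fun ω => (hrun.isDelayedFTRL hs ω).2
  exact (hrun.adapted hs (L := L) (fun ω k h1 h2 => ⟨(hL ω k h1 h2).1, (hL ω k h1 h2).2.1,
    (hL ω k h1 h2).2.2.1, (hL ω k h1 h2).2.2.2.1⟩) (k + 1) hk).2.1 k k.lt_succ_self

lemma norm_estimate_le (hrun : IsBanditFWRun 𝒦 r T K α δ T₀ ε f P ℱ u x z v)
    (hs : BanditSetup 𝒦 r R G M α δ T₀ T K ε f F) {k i : ℕ} (hk : k < T / K) (hi : i < K)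
    (ω : Ω) (w : USphere n) :
    ‖pointEstimate δ (F (k * K + (i + 1))) (x k ω) w‖ ≤ n * M / δ := by
  have hmem := round_mem hs hk hi
  have hp := hrun.play_mem hs hk.le ω w
  have hb := hs.bdd _ hmem _ hp
  have hδ := hs.δ_pos
  rw [hs.eqOn _ hmem hp] at hb
  rw [pointEstimate, norm_smul, norm_mul, norm_eq_of_mem_sphere, mul_one,
    Real.norm_of_nonneg (by positivity), Real.norm_eq_abs, mul_div_right_comm]
  gcongr

lemma norm_mean_le (hs : BanditSetup 𝒦 r R G M α δ T₀ T K ε f F) {k i : ℕ} (hk : k < T / K)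
    (hi : i < K) (y : Vec n) : ‖meanEstimate δ (F (k * K + (i + 1))) y‖ ≤ G :=
  norm_meanEstimate_le hs.G_pos.le (hs.lip _ (round_mem hs hk hi)) hs.δ_pos y

lemma norm_sum_estimate_le (hrun : IsBanditFWRun 𝒦 r T K α δ T₀ ε f P ℱ u x z v)
    (hs : BanditSetup 𝒦 r R G M α δ T₀ T K ε f F) {k : ℕ} (hk : k < T / K) {j : ℕ} (hj : j ≤ K)
    (ω : Ω) :
    ‖∑ i ∈ Finset.range j, pointEstimate δ (F (k * K + (i + 1))) (x k ω)
      (u (k * K + (i + 1)) ω)‖ ≤ j * (n * M / δ) := by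
  refine (norm_sum_le_of_le _ fun i hi =>
    hrun.norm_estimate_le hs hk ((Finset.mem_range.1 hi).trans_le hj) ω _).trans (le_of_eq ?_)
  simp

lemma norm_sum_mean_le (hs : BanditSetup 𝒦 r R G M α δ T₀ T K ε f F) {k : ℕ} (hk : k < T / K)
    {j : ℕ} (hj : j ≤ K) (y : Vec n) :
    ‖∑ i ∈ Finset.range j, meanEstimate δ (F (k * K + (i + 1))) y‖ ≤ j * G := by
  refine (norm_sum_le_of_le _ fun i hi =>
    norm_mean_le hs hk ((Finset.mem_range.1 hi).trans_le hj) y).trans (le_of_eq ?_)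
  simp

lemma measurable_mean (hrun : IsBanditFWRun 𝒦 r T K α δ T₀ ε f P ℱ u x z v)
    (hs : BanditSetup 𝒦 r R G M α δ T₀ T K ε f F) {k i : ℕ} (hk : k < T / K) (hi : i < K) :
    Measurable[ℱ (k * K)] fun ω => meanEstimate δ (F (k * K + (i + 1))) (x k ω) :=
  @measurable_meanEstimate _ _ (ℱ (k * K)) _ _ _
    (continuous_of_abs_sub_le (hs.lip _ (round_mem hs hk hi))) _ (hrun.measurable_iterate hs hk.le)

omit [Nontrivial (Vec n)] in
lemma integrable_inner_of_bound [IsProbabilityMeasure P] {Y Z : Ω → Vec n} (hY : Measurable Y)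
    (hZ : Measurable Z) {C D : ℝ} (hYC : ∀ ω, ‖Y ω‖ ≤ C) (hZD : ∀ ω, ‖Z ω‖ ≤ D) :
    Integrable (fun ω => ⟪Y ω, Z ω⟫) P :=
  Integrable.of_bound (hY.inner hZ).aestronglyMeasurable (C * D) (Filter.Eventually.of_forall
    fun ω => (norm_inner_le_norm _ _).trans
      (mul_le_mul (hYC ω) (hZD ω) (norm_nonneg _) ((norm_nonneg _).trans (hYC ω))))

omit [Nontrivial (Vec n)] in
lemma integral_inner_le [IsProbabilityMeasure P] {Y Z : Ω → Vec n} {C D : ℝ}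
    (hYC : ∀ ω, ‖Y ω‖ ≤ C) (hZD : ∀ ω, ‖Z ω‖ ≤ D) : ∫ ω, ⟪Y ω, Z ω⟫ ∂P ≤ C * D := by
  have h := norm_integral_le_of_norm_le_const (μ := P) (f := fun ω => ⟪Y ω, Z ω⟫) (C := C * D)
    (Filter.Eventually.of_forall fun ω => (norm_inner_le_norm _ _).trans
      (mul_le_mul (hYC ω) (hZD ω) (norm_nonneg _) ((norm_nonneg _).trans (hYC ω))))
  rw [probReal_univ, mul_one] at h
  exact (le_abs_self _).trans h

lemma integral_inner_estimate [IsProbabilityMeasure P]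
    (hrun : IsBanditFWRun 𝒦 r T K α δ T₀ ε f P ℱ u x z v)
    (hs : BanditSetup 𝒦 r R G M α δ T₀ T K ε f F) {k i : ℕ} (hk : k < T / K) (hi : i < K)
    {Z : Ω → Vec n} (hZ : Measurable[ℱ (k * K + i)] Z) {C : ℝ} (hC : ∀ ω, ‖Z ω‖ ≤ C) :
    ∫ ω, ⟪pointEstimate δ (F (k * K + (i + 1))) (x k ω) (u (k * K + (i + 1)) ω), Z ω⟫ ∂P =
      ∫ ω, ⟪meanEstimate δ (F (k * K + (i + 1))) (x k ω), Z ω⟫ ∂P := by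
  have hmem := round_mem hs hk hi
  have hx := hrun.measurable_iterate hs hk.le
  refine integral_inner_pointEstimate (ℱ.le (k * K + i)) (hx.mono (ℱ.mono (by omega)) le_rfl) hZ
    ((hrun.u_measurable _ hmem).mono (ℱ.le _) le_rfl) (hrun.u_indep _ hmem) (hrun.u_law _ hmem)
    (continuous_of_abs_sub_le (hs.lip _ hmem)) ?_
  exact integrable_inner_of_bound ((hrun.measurable_partial hs hk hx i.lt_succ_self hi).mono
    (ℱ.le _) le_rfl) (hZ.mono (ℱ.le _) le_rfl) (fun ω => hrun.norm_estimate_le hs hk hi ω _) hC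

lemma integral_inner_sum_estimate [IsProbabilityMeasure P]
    (hrun : IsBanditFWRun 𝒦 r T K α δ T₀ ε f P ℱ u x z v)
    (hs : BanditSetup 𝒦 r R G M α δ T₀ T K ε f F) {k j : ℕ} (hk : k < T / K) (hj : j ≤ K)
    {Z : Ω → Vec n} (hZ : Measurable[ℱ (k * K)] Z) {C : ℝ} (hC : ∀ ω, ‖Z ω‖ ≤ C) :
    ∫ ω, ⟪∑ i ∈ Finset.range j, pointEstimate δ (F (k * K + (i + 1))) (x k ω)
        (u (k * K + (i + 1)) ω), Z ω⟫ ∂P =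
      ∫ ω, ⟪∑ i ∈ Finset.range j, meanEstimate δ (F (k * K + (i + 1))) (x k ω), Z ω⟫ ∂P := by
  have hx := hrun.measurable_iterate hs hk.le
  have hZ' : Measurable Z := hZ.mono (ℱ.le _) le_rfl
  simp only [sum_inner]
  rw [integral_finsetSum, integral_finsetSum]
  · refine Finset.sum_congr rfl fun i hi => ?_
    have hi := (Finset.mem_range.1 hi).trans_le hj
    exact hrun.integral_inner_estimate hs hk hi (hZ.mono (ℱ.mono (by omega)) le_rfl) hC
  · intro i hi
    have hi := (Finset.mem_range.1 hi).trans_le hj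
    exact integrable_inner_of_bound ((hrun.measurable_mean hs hk hi).mono (ℱ.le _) le_rfl) hZ'
      (fun ω => norm_mean_le hs hk hi _) hC
  · intro i hi
    have hi := (Finset.mem_range.1 hi).trans_le hj
    exact integrable_inner_of_bound ((hrun.measurable_partial hs hk hx i.lt_succ_self hi).mono
      (ℱ.le _) le_rfl) hZ' (fun ω => hrun.norm_estimate_le hs hk hi ω _) hC

/-- Second moments within a block. The deviations from the means are orthogonal, so that only the
means contribute quadratically in the number of rounds. -/
lemma integral_norm_sq_sum_estimate_le [IsProbabilityMeasure P]
    (hrun : IsBanditFWRun 𝒦 r T K α δ T₀ ε f P ℱ u x z v)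
    (hs : BanditSetup 𝒦 r R G M α δ T₀ T K ε f F) {k : ℕ} (hk : k < T / K) (j : ℕ) (hj : j ≤ K) :
    ∫ ω, ‖∑ i ∈ Finset.range j, pointEstimate δ (F (k * K + (i + 1))) (x k ω)
        (u (k * K + (i + 1)) ω)‖ ^ 2 ∂P ≤ j * (n * M / δ) ^ 2 + (j * G) ^ 2 := by
  have hx := hrun.measurable_iterate hs hk.le
  induction j with
  | zero => simp
  | succ j ih =>
    have ih := ih (by omega)
    set e : ℕ → Ω → Vec n := fun i ω =>
      pointEstimate δ (F (k * K + (i + 1))) (x k ω) (u (k * K + (i + 1)) ω) with he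
    set s : Ω → Vec n := fun ω => ∑ i ∈ Finset.range j, e i ω with hsdef
    have hsm : Measurable[ℱ (k * K + j)] s :=
      @Finset.measurable_fun_sum _ _ _ _ _ _ (ℱ (k * K + j)) _ _ fun i hi =>
        hrun.measurable_partial hs hk hx (Finset.mem_range.1 hi) (by omega)
    have hsm' : Measurable s := hsm.mono (ℱ.le _) le_rfl
    have hem : Measurable (e j) :=
      (hrun.measurable_partial hs hk hx j.lt_succ_self hj).mono (ℱ.le _) le_rfl
    have hmm := hrun.measurable_mean hs hk hj
    have hsb : ∀ ω, ‖s ω‖ ≤ j * (n * M / δ) := fun ω =>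
      hrun.norm_sum_estimate_le hs hk (by omega) ω
    have heb : ∀ ω, ‖e j ω‖ ≤ n * M / δ := fun ω => hrun.norm_estimate_le hs hk hj ω _
    have hexp : ∀ ω, ‖∑ i ∈ Finset.range (j + 1), e i ω‖ ^ 2 =
        ‖s ω‖ ^ 2 + 2 * ⟪e j ω, s ω⟫ + ⟪e j ω, e j ω⟫ := by
      intro ω
      rw [Finset.sum_range_succ, norm_add_sq_real, real_inner_self_eq_norm_sq, real_inner_comm]
    have hi1 : Integrable (fun ω => ‖s ω‖ ^ 2) P := by
      simp only [← real_inner_self_eq_norm_sq]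
      exact integrable_inner_of_bound hsm' hsm' hsb hsb
    have hi2 : Integrable (fun ω => ⟪e j ω, s ω⟫) P := integrable_inner_of_bound hem hsm' heb hsb
    have hi3 : Integrable (fun ω => ⟪e j ω, e j ω⟫) P := integrable_inner_of_bound hem hem heb heb
    -- first the new estimate is replaced by its mean, which is known at the start of the block, and
    -- then against it the old ones are
    have hcross : ∫ ω, ⟪e j ω, s ω⟫ ∂P ≤ j * G ^ 2 := by
      rw [hrun.integral_inner_estimate hs hk hj hsm hsb]
      simp only [real_inner_comm (s _)]
      rw [hrun.integral_inner_sum_estimate hs hk (by omega) hmm (fun ω => norm_mean_le hs hk hj _)]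
      refine (integral_inner_le (fun ω => norm_sum_mean_le hs hk (by omega) _)
        (fun ω => norm_mean_le hs hk hj _)).trans (le_of_eq (by ring))
    have hsq : ∫ ω, ⟪e j ω, e j ω⟫ ∂P ≤ (n * M / δ) ^ 2 :=
      (integral_inner_le heb heb).trans (le_of_eq (by ring))
    change ∫ ω, ‖∑ i ∈ Finset.range (j + 1), e i ω‖ ^ 2 ∂P ≤ _
    change ∫ ω, ‖s ω‖ ^ 2 ∂P ≤ _ at ih
    simp only [hexp]
    have hi12 : Integrable (fun ω => ‖s ω‖ ^ 2 + 2 * ⟪e j ω, s ω⟫) P := hi1.add (hi2.const_mul 2)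
    rw [integral_add hi12 hi3, integral_add hi1 (hi2.const_mul 2),
      integral_const_mul]
    push_cast
    nlinarith [sq_nonneg G]

lemma norm_block_le (hrun : IsBanditFWRun 𝒦 r T K α δ T₀ ε f P ℱ u x z v)
    (hs : BanditSetup 𝒦 r R G M α δ T₀ T K ε f F) {k : ℕ} (hk : k < T / K) (ω : Ω) :
    ‖blockEstimate K δ f (fun m => x m ω) (fun t => u t ω) (k + 1)‖ ≤ K * (n * M / δ) := by
  rw [hrun.blockEstimate_eq hs hk]
  exact hrun.norm_sum_estimate_le hs hk le_rfl ω

lemma integral_norm_sq_block_le [IsProbabilityMeasure P]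
    (hrun : IsBanditFWRun 𝒦 r T K α δ T₀ ε f P ℱ u x z v)
    (hs : BanditSetup 𝒦 r R G M α δ T₀ T K ε f F) {k : ℕ} (hk : k < T / K) :
    ∫ ω, ‖blockEstimate K δ f (fun m => x m ω) (fun t => u t ω) (k + 1)‖ ^ 2 ∂P ≤
      K * (n * M / δ) ^ 2 + (K * G) ^ 2 := by
  simp only [hrun.blockEstimate_eq hs hk]
  exact hrun.integral_norm_sq_sum_estimate_le hs hk K le_rfl

lemma integral_inner_block [IsProbabilityMeasure P]
    (hrun : IsBanditFWRun 𝒦 r T K α δ T₀ ε f P ℱ u x z v)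
    (hs : BanditSetup 𝒦 r R G M α δ T₀ T K ε f F) {k : ℕ} (hk : k < T / K)
    {Z : Ω → Vec n} (hZ : Measurable[ℱ (k * K)] Z) {C : ℝ} (hC : ∀ ω, ‖Z ω‖ ≤ C) :
    ∫ ω, ⟪blockEstimate K δ f (fun m => x m ω) (fun t => u t ω) (k + 1), Z ω⟫ ∂P =
      ∫ ω, ⟪∑ i ∈ Finset.range K, meanEstimate δ (F (k * K + (i + 1))) (x k ω), Z ω⟫ ∂P := by
  simp only [hrun.blockEstimate_eq hs hk]
  exact hrun.integral_inner_sum_estimate hs hk le_rfl hZ hC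

lemma measurable_block (hrun : IsBanditFWRun 𝒦 r T K α δ T₀ ε f P ℱ u x z v)
    (hs : BanditSetup 𝒦 r R G M α δ T₀ T K ε f F) {k : ℕ} (hk : k < T / K) :
    Measurable fun ω => blockEstimate K δ f (fun m => x m ω) (fun t => u t ω) (k + 1) :=
  (hrun.measurable_blockEstimate hs hk).mono (ℱ.le _) le_rfl

lemma integrable_norm_mul_norm_block [IsProbabilityMeasure P]
    (hrun : IsBanditFWRun 𝒦 r T K α δ T₀ ε f P ℱ u x z v)
    (hs : BanditSetup 𝒦 r R G M α δ T₀ T K ε f F) {k l : ℕ} (hk : k < T / K) (hl : l < T / K) :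
    Integrable (fun ω => ‖blockEstimate K δ f (fun m => x m ω) (fun t => u t ω) (k + 1)‖ *
      ‖blockEstimate K δ f (fun m => x m ω) (fun t => u t ω) (l + 1)‖) P :=
  Integrable.of_bound ((hrun.measurable_block hs hk).norm.mul
      (hrun.measurable_block hs hl).norm).aestronglyMeasurable
    (K * (n * M / δ) * (K * (n * M / δ))) (Filter.Eventually.of_forall fun ω => by
      rw [Real.norm_of_nonneg (by positivity)]
      exact mul_le_mul (hrun.norm_block_le hs hk ω) (hrun.norm_block_le hs hl ω) (norm_nonneg _)
        ((norm_nonneg _).trans (hrun.norm_block_le hs hk ω)))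

lemma integrable_norm_block [IsProbabilityMeasure P]
    (hrun : IsBanditFWRun 𝒦 r T K α δ T₀ ε f P ℱ u x z v)
    (hs : BanditSetup 𝒦 r R G M α δ T₀ T K ε f F) {k : ℕ} (hk : k < T / K) :
    Integrable (fun ω => ‖blockEstimate K δ f (fun m => x m ω) (fun t => u t ω) (k + 1)‖) P :=
  Integrable.of_bound (hrun.measurable_block hs hk).norm.aestronglyMeasurable
    (K * (n * M / δ)) (Filter.Eventually.of_forall fun ω => by
      rw [norm_norm]; exact hrun.norm_block_le hs hk ω)

/-- Mixed second moments, by the arithmetic-geometric mean inequality. -/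
lemma integral_norm_mul_norm_block_le [IsProbabilityMeasure P]
    (hrun : IsBanditFWRun 𝒦 r T K α δ T₀ ε f P ℱ u x z v)
    (hs : BanditSetup 𝒦 r R G M α δ T₀ T K ε f F) {V : ℝ}
    (hV : K * (n * M / δ) ^ 2 + (K * G) ^ 2 ≤ V ^ 2) {k l : ℕ} (hk : k < T / K)
    (hl : l < T / K) :
    ∫ ω, ‖blockEstimate K δ f (fun m => x m ω) (fun t => u t ω) (k + 1)‖ *
      ‖blockEstimate K δ f (fun m => x m ω) (fun t => u t ω) (l + 1)‖ ∂P ≤ V ^ 2 := by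
  have h1 := (hrun.integral_norm_sq_block_le hs hk).trans hV
  have h2 := (hrun.integral_norm_sq_block_le hs hl).trans hV
  have i1 := hrun.integrable_norm_mul_norm_block hs hk hk
  have i2 := hrun.integrable_norm_mul_norm_block hs hl hl
  simp only [← sq] at i1 i2
  have h3 := integral_mono (hrun.integrable_norm_mul_norm_block hs hk hl)
    ((i1.add i2).const_mul (1 / 2)) (fun ω => by
      dsimp only [Pi.add_apply]
      nlinarith [sq_nonneg (‖blockEstimate K δ f (fun m => x m ω) (fun t => u t ω) (k + 1)‖ -
        ‖blockEstimate K δ f (fun m => x m ω) (fun t => u t ω) (l + 1)‖)])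
  simp only [Pi.add_apply] at h3
  rw [integral_const_mul, integral_add i1 i2] at h3
  linarith

lemma integral_norm_block_le [IsProbabilityMeasure P]
    (hrun : IsBanditFWRun 𝒦 r T K α δ T₀ ε f P ℱ u x z v)
    (hs : BanditSetup 𝒦 r R G M α δ T₀ T K ε f F) {V : ℝ} (hV0 : 0 < V)
    (hV : K * (n * M / δ) ^ 2 + (K * G) ^ 2 ≤ V ^ 2) {k : ℕ} (hk : k < T / K) :
    ∫ ω, ‖blockEstimate K δ f (fun m => x m ω) (fun t => u t ω) (k + 1)‖ ∂P ≤ V := by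
  have h1 := (hrun.integral_norm_sq_block_le hs hk).trans hV
  have i1 := hrun.integrable_norm_mul_norm_block hs hk hk
  simp only [← sq] at i1
  have h3 := integral_mono ((hrun.integrable_norm_block hs hk).const_mul (2 * V))
    (i1.add (integrable_const (V ^ 2))) (fun ω => by
      dsimp only [Pi.add_apply]
      nlinarith [sq_nonneg (‖blockEstimate K δ f (fun m => x m ω) (fun t => u t ω) (k + 1)‖ - V)])
  simp only [Pi.add_apply] at h3
  rw [integral_const_mul, integral_add i1 (integrable_const _), integral_const, probReal_univ,
    one_smul] at h3
  have : V * ∫ ω, ‖blockEstimate K δ f (fun m => x m ω) (fun t => u t ω) (k + 1)‖ ∂P ≤ V * V := by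
    linarith
  exact le_of_mul_le_mul_left this hV0

end IsBanditFWRun

end Moments

/-! ### Expected regret and expected number of oracle calls -/

lemma sum_rounds {E : Type*} [AddCommMonoid E] (φ : ℕ → E) (K N : ℕ) :
    ∑ t ∈ Finset.Icc 1 (N * K), φ t =
      ∑ k ∈ Finset.range N, ∑ i ∈ Finset.range K, φ (k * K + (i + 1)) := by
  rw [sum_Icc_one]
  induction N with
  | zero => simp
  | succ N ih =>
    rw [Finset.sum_range_succ, ← ih, add_mul, one_mul, Finset.sum_range_add]
    simp only [add_assoc]

lemma StrongConvexOn.congr_eqOn {n : ℕ} {S : Set (Vec n)} {α : ℝ} {φ ψ : Vec n → ℝ}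
    (h : StrongConvexOn S α φ) (he : Set.EqOn φ ψ S) : StrongConvexOn S α ψ := by
  refine ⟨h.1, fun a ha b hb s t hs ht hst => ?_⟩
  rw [← he ha, ← he hb, ← he (h.1 ha hb hs ht hst)]
  exact h.2 ha hb hs ht hst

section Expectation

variable {n : ℕ} [Nontrivial (Vec n)] {𝒦 : Set (Vec n)} {r R G M α δ T₀ : ℝ} {T K : ℕ}
  {ε : ℕ → ℝ} {f F : ℕ → Vec n → ℝ} {Ω : Type*} {mΩ : MeasurableSpace Ω} {P : Measure Ω}
  {ℱ : Filtration ℕ mΩ} {u : ℕ → Ω → USphere n} {x : ℕ → Ω → Vec n} {z v : ℕ → ℕ → Ω → Vec n}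

/-- The loss of a play against that of a comparator, through the smoothed loss. -/
lemma round_regret_le (hs : BanditSetup 𝒦 r R G M α δ T₀ T K ε f F) {t : ℕ}
    (ht : t ∈ Finset.Icc 1 T) {y w : Vec n} (hy : y ∈ shrunkSet 𝒦 r δ) (hw : w ∈ 𝒦)
    (q : USphere n) :
    f t (y + δ • (q : Vec n)) - f t w ≤ (3 * δ * G + G * δ * R / r) +
      (⟪meanEstimate δ (F t) y, y - (1 - δ / r) • w⟫ - α / 2 * ‖y - (1 - δ / r) • w‖ ^ 2) := by
  have hG := hs.G_pos
  have hδ := hs.δ_pos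
  have hr := hs.r_pos
  have hlip := hs.lip t ht
  have hball : ∀ a ∈ shrunkSet 𝒦 r δ, ∀ b ∈ Metric.closedBall (0 : Vec n) 1, a + δ • b ∈ 𝒦 :=
    fun a ha b hb => add_smul_mem_of_mem_shrunkSet hs.conv hs.ball_subset hr hδ hs.δ_le ha
      (by simpa using hb)
  have hwδ : (1 - δ / r) • w ∈ shrunkSet 𝒦 r δ := Set.smul_mem_smul_set hw
  have h1 := ballAverage_strongConvex (continuous_of_abs_sub_le hlip)
    ((hs.strong t ht).congr_eqOn (hs.eqOn t ht)) hδ (hball y hy) (hball _ hwδ)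
  have h2 := abs_le.1 (abs_ballAverage_sub_le hG.le hlip hδ.le y)
  have h3 := abs_le.1 (abs_ballAverage_sub_le hG.le hlip hδ.le ((1 - δ / r) • w))
  have h4 := (abs_le.1 (hlip (y + δ • (q : Vec n)) y)).2
  rw [add_sub_cancel_left, norm_smul, norm_eq_of_mem_sphere, mul_one,
    Real.norm_of_nonneg hδ.le] at h4
  have h5 := (abs_le.1 (hlip ((1 - δ / r) • w) w)).2
  have h6 : ‖(1 - δ / r) • w - w‖ ≤ δ / r * R := by
    rw [show (1 - δ / r) • w - w = -((δ / r) • w) by module, norm_neg, norm_smul,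
      Real.norm_of_nonneg (div_pos hδ hr).le]
    have : ‖w‖ ≤ R := by simpa using hs.subset_ball hw
    gcongr
  have h7 : G * ‖(1 - δ / r) • w - w‖ ≤ G * δ * R / r := by
    refine (mul_le_mul_of_nonneg_left h6 hG.le).trans (le_of_eq (by ring))
  rw [hs.eqOn t ht (hball y hy q (by simp)),
    hs.eqOn t ht hw]
  linarith

omit [Nontrivial (Vec n)] in
/-- The infimum in the regret is attained. -/
lemma exists_best (hs : BanditSetup 𝒦 r R G M α δ T₀ T K ε f F) :
    ∃ w ∈ 𝒦, (⨅ a : 𝒦, ∑ t ∈ Finset.Icc 1 T, f t (a : Vec n)) = ∑ t ∈ Finset.Icc 1 T, f t w := by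
  have hne : 𝒦.Nonempty := ⟨0, hs.ball_subset (by simp [hs.r_pos.le])⟩
  have heq : Set.EqOn (fun a => ∑ t ∈ Finset.Icc 1 T, F t a)
      (fun a => ∑ t ∈ Finset.Icc 1 T, f t a) 𝒦 :=
    fun a ha => Finset.sum_congr rfl fun t ht => (hs.eqOn t ht ha).symm
  have hcont : ContinuousOn (fun a => ∑ t ∈ Finset.Icc 1 T, f t a) 𝒦 := by
    refine ContinuousOn.congr ?_ heq.symm
    exact (continuous_finsetSum _ fun t ht => continuous_of_abs_sub_le (hs.lip t ht)).continuousOn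
  obtain ⟨w, hw, hmin⟩ := hs.comp.exists_isMinOn hne hcont
  have : Nonempty 𝒦 := hne.to_subtype
  refine ⟨w, hw, le_antisymm (ciInf_le ⟨∑ t ∈ Finset.Icc 1 T, f t w, ?_⟩ (⟨w, hw⟩ : 𝒦))
    (le_ciInf fun a => hmin a.2)⟩
  rintro _ ⟨a, rfl⟩
  exact hmin a.2

namespace IsBanditFWRun

/-- The regret of a realization against the surrogate losses with the means of the estimates. -/
lemma regret_pathwise_le (hrun : IsBanditFWRun 𝒦 r T K α δ T₀ ε f P ℱ u x z v)
    (hs : BanditSetup 𝒦 r R G M α δ T₀ T K ε f F) {w : Vec n} (hw : w ∈ 𝒦)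
    (hbest : (⨅ a : 𝒦, ∑ t ∈ Finset.Icc 1 T, f t (a : Vec n)) = ∑ t ∈ Finset.Icc 1 T, f t w)
    (ω : Ω) :
    regret 𝒦 T K δ f (fun m => x m ω) (fun t => u t ω) ≤ T * (3 * δ * G + G * δ * R / r) +
      ∑ k ∈ Finset.range (T / K),
        (⟪∑ i ∈ Finset.range K, meanEstimate δ (F (k * K + (i + 1))) (x k ω),
            x k ω - (1 - δ / r) • w⟫
          - K * α / 2 * ‖x k ω - (1 - δ / r) • w‖ ^ 2) := by
  have h1 : ∑ t ∈ Finset.Icc 1 T, (f t (play K δ (fun m => x m ω) (fun t => u t ω) t) - f t w) =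
      ∑ k ∈ Finset.range (T / K), ∑ i ∈ Finset.range K,
        (f (k * K + (i + 1)) (play K δ (fun m => x m ω) (fun t => u t ω) (k * K + (i + 1)))
          - f (k * K + (i + 1)) w) := by
    conv_lhs => rw [← hs.dvd]
    rw [sum_rounds]
  have h2 : (T : ℝ) * (3 * δ * G + G * δ * R / r) =
      ∑ k ∈ Finset.range (T / K), ∑ i ∈ Finset.range K, (3 * δ * G + G * δ * R / r) := by
    have hT : (T : ℝ) = (T / K : ℕ) * K := by exact_mod_cast hs.dvd.symm
    simp only [Finset.sum_const, Finset.card_range, nsmul_eq_mul, ← mul_assoc]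
    rw [hT]
  rw [regret, hbest, ← Finset.sum_sub_distrib, h1, h2, ← Finset.sum_add_distrib]
  refine Finset.sum_le_sum fun k hk => ?_
  have hk := Finset.mem_range.1 hk
  have h3 : K * α / 2 * ‖x k ω - (1 - δ / r) • w‖ ^ 2 =
      ∑ i ∈ Finset.range K, α / 2 * ‖x k ω - (1 - δ / r) • w‖ ^ 2 := by
    simp only [Finset.sum_const, Finset.card_range, nsmul_eq_mul]
    ring
  rw [sum_inner, h3, ← Finset.sum_sub_distrib, ← Finset.sum_add_distrib]
  refine Finset.sum_le_sum fun i hi => ?_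
  have hi := Finset.mem_range.1 hi
  rw [play_round hi]
  exact round_regret_le hs (round_mem hs hk hi) (hrun.mem hs hk.le ω) hw _

lemma integrable_regret [IsProbabilityMeasure P]
    (hrun : IsBanditFWRun 𝒦 r T K α δ T₀ ε f P ℱ u x z v)
    (hs : BanditSetup 𝒦 r R G M α δ T₀ T K ε f F) :
    Integrable (fun ω => regret 𝒦 T K δ f (fun m => x m ω) (fun t => u t ω)) P := by
  unfold regret
  refine Integrable.sub ?_ (integrable_const _)
  rw [show Finset.Icc 1 T = Finset.Icc 1 (T / K * K) by rw [hs.dvd]]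
  simp only [sum_rounds]
  refine integrable_finsetSum _ fun k hk => integrable_finsetSum _ fun i hi => ?_
  have hk := Finset.mem_range.1 hk
  have hi := Finset.mem_range.1 hi
  have hmem := round_mem hs hk hi
  have heq : ∀ ω, f (k * K + (i + 1)) (play K δ (fun m => x m ω) (fun t => u t ω)
      (k * K + (i + 1))) = F (k * K + (i + 1)) (x k ω + δ • (u (k * K + (i + 1)) ω : Vec n)) := by
    intro ω
    rw [play_round hi, hs.eqOn _ hmem (hrun.play_mem hs hk.le ω _)]
  have hx : Measurable (x k) := (hrun.measurable_iterate hs hk.le).mono (ℱ.le _) le_rfl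
  have hu : Measurable (u (k * K + (i + 1))) := (hrun.u_measurable _ hmem).mono (ℱ.le _) le_rfl
  simp only [heq]
  refine Integrable.of_bound (Measurable.aestronglyMeasurable ?_) M
    (Filter.Eventually.of_forall fun ω => ?_)
  · have hc := continuous_of_abs_sub_le (hs.lip _ hmem)
    have : Continuous fun p : Vec n × USphere n =>
      F (k * K + (i + 1)) (p.1 + δ • (p.2 : Vec n)) := by fun_prop
    exact this.measurable.comp (hx.prodMk hu)
  · have hp := hrun.play_mem hs hk.le ω (u (k * K + (i + 1)) ω)
    rw [← hs.eqOn _ hmem hp]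
    exact hs.bdd _ hmem _ hp

/-- The expected regret in terms of a bound `V` on the root mean square of the block estimates. -/
theorem integral_regret_le [IsProbabilityMeasure P]
    (hrun : IsBanditFWRun 𝒦 r T K α δ T₀ ε f P ℱ u x z v)
    (hs : BanditSetup 𝒦 r R G M α δ T₀ T K ε f F) {V : ℝ} (hV0 : 0 < V)
    (hV : K * (n * M / δ) ^ 2 + (K * G) ^ 2 ≤ V ^ 2) :
    ∫ ω, regret 𝒦 T K δ f (fun m => x m ω) (fun t => u t ω) ∂P ≤
      T * (3 * δ * G + G * δ * R / r) + (2 * R ^ 2 * (T₀ * α) +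
        ∑ k ∈ Finset.range (T / K), (K * G * (5 * R / cbrtCurvature (K * α) (T₀ * α) k) +
          ((V ^ 2 + 2 * R * (K * α) * V) / curvature (K * α) (T₀ * α) k +
           (V ^ 2 + 2 * R * (K * α) * V) / curvature (K * α) (T₀ * α) (k + 1)))) := by
  obtain ⟨w, hw, hbest⟩ := exists_best hs
  have hwδ : (1 - δ / r) • w ∈ shrunkSet 𝒦 r δ := Set.smul_mem_smul_set hw
  have hR := hs.R_pos
  have hα := hs.α_pos
  have hne : (shrunkSet 𝒦 r δ).Nonempty := ⟨_, hwδ⟩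
  set N := T / K with hN
  set g : ℕ → Ω → Vec n := fun k ω => blockEstimate K δ f (fun m => x m ω) (fun t => u t ω) (k + 1)
    with hg
  set ℓ : ℕ → Ω → Vec n := fun k ω =>
    leader (shrunkSet 𝒦 r δ) (K * α) (T₀ * α) (fun k => g k ω) (fun m => x m ω) k with hℓ
  set mean : ℕ → Ω → Vec n := fun k ω =>
    ∑ i ∈ Finset.range K, meanEstimate δ (F (k * K + (i + 1))) (x k ω) with hmean
  have hB := hs.curvature_pos
  have hftrl := fun ω => (hrun.isDelayedFTRL hs ω).1
  have hxS : ∀ k ≤ N, ∀ ω, x k ω ∈ shrunkSet 𝒦 r δ := fun k hk ω => hrun.mem hs hk ω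
  have hxm : ∀ k ≤ N, Measurable[ℱ (k * K)] (x k) := fun k hk => hrun.measurable_iterate hs hk
  have hgm : ∀ k < N, Measurable (g k) := fun k hk => hrun.measurable_block hs hk
  have hgb : ∀ k < N, ∀ ω, ‖g k ω‖ ≤ K * (n * M / δ) := fun k hk ω => hrun.norm_block_le hs hk ω
  have hmm : ∀ k < N, Measurable (mean k) := fun k hk =>
    Finset.measurable_fun_sum _ fun i hi =>
      (hrun.measurable_mean hs hk (Finset.mem_range.1 hi)).mono (ℱ.le _) le_rfl
  have hmb : ∀ k < N, ∀ ω, ‖mean k ω‖ ≤ K * G := fun k hk ω => norm_sum_mean_le hs hk le_rfl _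
  have hℓm : ∀ k < N, Measurable[ℱ (k * K)] (ℓ (k - 1)) := by
    intro k hk
    refine @measurable_leader _ _ (ℱ (k * K)) _ hne (isClosed_shrunkSet hs.comp)
      (convex_shrunkSet hs.conv) _ _ g x (k - 1) ?_ ?_ ?_
    · exact (hxm 0 N.zero_le).mono (ℱ.mono (by omega)) le_rfl
    · exact fun i hi => (hxm i (by omega)).mono
        (ℱ.mono (Nat.mul_le_mul_right _ (by omega))) le_rfl
    · exact fun i hi => (hrun.measurable_blockEstimate hs (k := i) (by omega)).mono
        (ℱ.mono (Nat.mul_le_mul_right _ (by omega))) le_rfl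
  -- the two predictable directions against which the block estimates are replaced by their means
  have hZ1 : ∀ k < N, Measurable[ℱ (k * K)] fun ω => x k ω - (1 - δ / r) • w := fun k hk =>
    (hxm k hk.le).sub_const _
  have hZ2 : ∀ k < N, Measurable[ℱ (k * K)] fun ω => x k ω - ℓ (k - 1) ω := fun k hk =>
    (hxm k hk.le).sub (hℓm k hk)
  have hb1 : ∀ k < N, ∀ ω, ‖x k ω - (1 - δ / r) • w‖ ≤ 2 * R := fun k hk ω =>
    (hftrl ω).norm_sub_le (hxS k hk.le ω) hwδ
  have hb2 : ∀ k < N, ∀ ω, ‖x k ω - ℓ (k - 1) ω‖ ≤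
      5 * R / cbrtCurvature (K * α) (T₀ * α) k := fun k hk ω =>
    (hftrl ω).norm_sub_leader_le hk.le
  have hiq : ∀ k < N, Integrable
      (fun ω => K * α / 2 * ‖x k ω - (1 - δ / r) • w‖ ^ 2) P := by
    intro k hk
    have hm := (hZ1 k hk).mono (ℱ.le _) le_rfl
    have := integrable_inner_of_bound (P := P) hm hm (hb1 k hk) (hb1 k hk)
    simp only [real_inner_self_eq_norm_sq] at this
    exact this.const_mul _
  have hi1 : ∀ k < N, Integrable (fun ω => ⟪mean k ω, x k ω - (1 - δ / r) • w⟫) P := fun k hk =>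
    integrable_inner_of_bound (hmm k hk) ((hZ1 k hk).mono (ℱ.le _) le_rfl) (hmb k hk) (hb1 k hk)
  have hi1' : ∀ k < N, Integrable (fun ω => ⟪g k ω, x k ω - (1 - δ / r) • w⟫) P := fun k hk =>
    integrable_inner_of_bound (hgm k hk) ((hZ1 k hk).mono (ℱ.le _) le_rfl) (hgb k hk) (hb1 k hk)
  have hi2 : ∀ k < N, Integrable (fun ω => ⟪g k ω, x k ω - ℓ (k - 1) ω⟫) P := fun k hk =>
    integrable_inner_of_bound (hgm k hk) ((hZ2 k hk).mono (ℱ.le _) le_rfl) (hgb k hk) (hb2 k hk)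
  have hstab : ∀ k < N, ∀ l < N, ∀ B : ℝ, 0 < B →
      Integrable (fun ω => ‖g k ω‖ * ((‖g l ω‖ + 2 * R * (K * α)) / B)) P ∧
      ∫ ω, ‖g k ω‖ * ((‖g l ω‖ + 2 * R * (K * α)) / B) ∂P ≤
        (V ^ 2 + 2 * R * (K * α) * V) / B := by
    intro k hk l hl B hBpos
    have e1 := hrun.integrable_norm_mul_norm_block hs hk hl
    have e2 := hrun.integrable_norm_block hs hk
    have e3 := hrun.integral_norm_mul_norm_block_le hs hV hk hl
    have e4 := hrun.integral_norm_block_le hs hV0 hV hk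
    have heq : (fun ω => ‖g k ω‖ * ((‖g l ω‖ + 2 * R * (K * α)) / B)) =
        fun ω => (‖g k ω‖ * ‖g l ω‖ + 2 * R * (K * α) * ‖g k ω‖) * B⁻¹ := by
      ext ω; field_simp
    have e5 : Integrable (fun ω => ‖g k ω‖ * ‖g l ω‖ + 2 * R * (K * α) * ‖g k ω‖) P :=
      e1.add (e2.const_mul _)
    rw [heq]
    refine ⟨e5.mul_const _, ?_⟩
    rw [integral_mul_const, integral_add e1 (e2.const_mul _), integral_const_mul, ← div_eq_mul_inv]
    have : 0 ≤ 2 * R * (K * α) := by positivity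
    gcongr
  have hswap : ∀ k < N, ∫ ω, (⟪mean k ω, x k ω - (1 - δ / r) • w⟫
      - K * α / 2 * ‖x k ω - (1 - δ / r) • w‖ ^ 2) ∂P =
      ∫ ω, (⟪g k ω, x k ω - (1 - δ / r) • w⟫
      - K * α / 2 * ‖x k ω - (1 - δ / r) • w‖ ^ 2) ∂P := by
    intro k hk
    rw [integral_sub (hi1 k hk) (hiq k hk), integral_sub (hi1' k hk) (hiq k hk),
      hrun.integral_inner_block hs hk (hZ1 k hk) (hb1 k hk)]
  have hd : ∀ k ∈ Finset.range N, Integrable (fun ω => ⟪mean k ω, x k ω - (1 - δ / r) • w⟫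
      - K * α / 2 * ‖x k ω - (1 - δ / r) • w‖ ^ 2) P := fun k hk =>
    (hi1 k (Finset.mem_range.1 hk)).sub (hiq k (Finset.mem_range.1 hk))
  have hd' : ∀ k ∈ Finset.range N, Integrable (fun ω => ⟪g k ω, x k ω - (1 - δ / r) • w⟫
      - K * α / 2 * ‖x k ω - (1 - δ / r) • w‖ ^ 2) P := fun k hk =>
    (hi1' k (Finset.mem_range.1 hk)).sub (hiq k (Finset.mem_range.1 hk))
  have hint1 := integrable_finsetSum _ hd
  have hint2 := integrable_finsetSum _ hd'
  have hterm : ∀ k < N, Integrable (fun ω => ⟪g k ω, x k ω - ℓ (k - 1) ω⟫ +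
      (‖g k ω‖ * ((‖g (k - 1) ω‖ + 2 * R * (K * α)) / curvature (K * α) (T₀ * α) k) +
       ‖g k ω‖ * ((‖g k ω‖ + 2 * R * (K * α)) / curvature (K * α) (T₀ * α) (k + 1)))) P ∧
      ∫ ω, (⟪g k ω, x k ω - ℓ (k - 1) ω⟫ +
        (‖g k ω‖ * ((‖g (k - 1) ω‖ + 2 * R * (K * α)) / curvature (K * α) (T₀ * α) k) +
         ‖g k ω‖ * ((‖g k ω‖ + 2 * R * (K * α)) / curvature (K * α) (T₀ * α) (k + 1)))) ∂P ≤
      K * G * (5 * R / cbrtCurvature (K * α) (T₀ * α) k) +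
          ((V ^ 2 + 2 * R * (K * α) * V) / curvature (K * α) (T₀ * α) k +
           (V ^ 2 + 2 * R * (K * α) * V) / curvature (K * α) (T₀ * α) (k + 1)) := by
    intro k hk
    obtain ⟨a1, a2⟩ := hstab k hk (k - 1) (by omega) _ (hB k)
    obtain ⟨b1, b2⟩ := hstab k hk k hk _ (hB (k + 1))
    have c1 : ∫ ω, ⟪g k ω, x k ω - ℓ (k - 1) ω⟫ ∂P ≤
        K * G * (5 * R / cbrtCurvature (K * α) (T₀ * α) k) := by
      rw [hrun.integral_inner_block hs hk (hZ2 k hk) (hb2 k hk)]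
      exact integral_inner_le (hmb k hk) (hb2 k hk)
    have ab : Integrable (fun ω =>
        ‖g k ω‖ * ((‖g (k - 1) ω‖ + 2 * R * (K * α)) / curvature (K * α) (T₀ * α) k) +
        ‖g k ω‖ * ((‖g k ω‖ + 2 * R * (K * α)) / curvature (K * α) (T₀ * α) (k + 1))) P := a1.add b1
    refine ⟨(hi2 k hk).add ab, ?_⟩
    rw [integral_add (hi2 k hk) ab, integral_add a1 b1]
    exact add_le_add c1 (add_le_add a2 b2)
  have hint3 := integrable_finsetSum (Finset.range N) fun k hk =>
    (hterm k (Finset.mem_range.1 hk)).1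
  have hint4 : Integrable (fun ω => 2 * R ^ 2 * (T₀ * α) + ∑ k ∈ Finset.range N,
      (⟪g k ω, x k ω - ℓ (k - 1) ω⟫ +
      (‖g k ω‖ * ((‖g (k - 1) ω‖ + 2 * R * (K * α)) / curvature (K * α) (T₀ * α) k) +
       ‖g k ω‖ * ((‖g k ω‖ + 2 * R * (K * α)) / curvature (K * α) (T₀ * α) (k + 1))))) P :=
    (integrable_const _).add hint3
  calc ∫ ω, regret 𝒦 T K δ f (fun m => x m ω) (fun t => u t ω) ∂P
      ≤ ∫ ω, (T * (3 * δ * G + G * δ * R / r) + ∑ k ∈ Finset.range N,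
          (⟪mean k ω, x k ω - (1 - δ / r) • w⟫
            - K * α / 2 * ‖x k ω - (1 - δ / r) • w‖ ^ 2)) ∂P :=
        integral_mono (hrun.integrable_regret hs) ((integrable_const _).add hint1)
          (hrun.regret_pathwise_le hs hw hbest)
    _ = T * (3 * δ * G + G * δ * R / r) + ∫ ω, ∑ k ∈ Finset.range N,
          (⟪g k ω, x k ω - (1 - δ / r) • w⟫
            - K * α / 2 * ‖x k ω - (1 - δ / r) • w‖ ^ 2) ∂P := by
        rw [integral_add (integrable_const _) hint1, integral_const, probReal_univ, one_smul,
          integral_finsetSum _ hd, integral_finsetSum _ hd']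
        congr 1
        exact Finset.sum_congr rfl fun k hk => hswap k (Finset.mem_range.1 hk)
    _ ≤ T * (3 * δ * G + G * δ * R / r) + ∫ ω, (2 * R ^ 2 * (T₀ * α) + ∑ k ∈ Finset.range N,
          (⟪g k ω, x k ω - ℓ (k - 1) ω⟫ +
          (‖g k ω‖ * ((‖g (k - 1) ω‖ + 2 * R * (K * α)) / curvature (K * α) (T₀ * α) k) +
           ‖g k ω‖ * ((‖g k ω‖ + 2 * R * (K * α)) / curvature (K * α) (T₀ * α) (k + 1))))) ∂P := by
        exact add_le_add le_rfl (integral_mono hint2 hint4 fun ω => (hftrl ω).regret_le hwδ)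
    _ ≤ _ := by
        refine add_le_add le_rfl ?_
        rw [integral_add (integrable_const _) hint3, integral_const, probReal_univ, one_smul,
          integral_finsetSum _ fun k hk => (hterm k (Finset.mem_range.1 hk)).1]
        gcongr with k hk
        exact (hterm k (Finset.mem_range.1 hk)).2

/-- The expected number of oracle calls in terms of a bound `V` on the root mean square of the block
estimates. -/
theorem expectedCallsLE [IsProbabilityMeasure P]
    (hrun : IsBanditFWRun 𝒦 r T K α δ T₀ ε f P ℱ u x z v)
    (hs : BanditSetup 𝒦 r R G M α δ T₀ T K ε f F) {V : ℝ} (hV0 : 0 < V)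
    (hV : K * (n * M / δ) ^ 2 + (K * G) ^ 2 ≤ V ^ 2) {B : ℝ}
    (hle : ∑ k ∈ Finset.range (T / K - 1), (1 + K * α / 12 +
      11 / 320 / R ^ 2 * (5 * R * (V + 2 * R * (K * α)) +
        (V + 2 * R * (K * α)) ^ 2 / cbrtCurvature (K * α) (T₀ * α) (k + 1) ^ 2)) ≤ B) :
    ExpectedCallsLE T K α δ T₀ ε f P u x z v B := by
  have hR := hs.R_pos
  have hα := hs.α_pos
  choose L hL using fun ω => (hrun.isDelayedFTRL hs ω).2
  have htot : ∀ ω, totalCalls T K α δ T₀ ε f (fun m => x m ω) (fun t => u t ω)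
      (fun m τ => z m τ ω) (fun m τ => v m τ ω) =
        ((∑ k ∈ Finset.range (T / K - 1), L ω (k + 1) : ℕ) : ℕ∞) := fun ω =>
    totalCalls_eq_sum (z := fun m τ => z m τ ω) (v := fun m τ => v m τ ω)
      fun k h1 h2 => (hL ω k h1 h2).2.1
  have hLm : ∀ k ∈ Finset.range (T / K - 1), Measurable fun ω => L ω (k + 1) := fun k hk => by
    have hk := Finset.mem_range.1 hk
    exact ((hrun.adapted hs (L := L) (fun ω k h1 h2 => ⟨(hL ω k h1 h2).1, (hL ω k h1 h2).2.1,
      (hL ω k h1 h2).2.2.1, (hL ω k h1 h2).2.2.2.1⟩) (T / K) le_rfl).2.2 (k + 1) (by omega)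
      (Nat.le_add_left 1 k)).mono (ℱ.le _) le_rfl
  have hsm : Measurable fun ω => ∑ k ∈ Finset.range (T / K - 1), L ω (k + 1) :=
    Finset.measurable_fun_sum _ hLm
  simp only [ExpectedCallsLE, htot, ENat.toENNReal_coe]
  refine ⟨(measurable_of_countable (fun m : ℕ => (m : ENNReal))).comp hsm, ?_⟩
  set g : ℕ → Ω → Vec n := fun k ω => blockEstimate K δ f (fun m => x m ω) (fun t => u t ω) (k + 1)
    with hg
  set bound : Ω → ℝ := fun ω => ∑ k ∈ Finset.range (T / K - 1), (1 + K * α / 12 +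
      11 / 320 / R ^ 2 * (5 * R * (‖g k ω‖ + 2 * R * (K * α)) +
        (‖g k ω‖ + 2 * R * (K * α)) ^ 2 / cbrtCurvature (K * α) (T₀ * α) (k + 1) ^ 2))
    with hbound
  have hpath : ∀ ω, ((∑ k ∈ Finset.range (T / K - 1), L ω (k + 1) : ℕ) : ℝ) ≤ bound ω := by
    intro ω
    have hf := (hrun.isDelayedFTRL hs ω).1
    push_cast
    rcases Nat.eq_zero_or_pos (T / K) with h0 | h0
    · simp [hbound, h0]
    · exact hf.sum_calls_le (fun k h1 h2 => (hL ω k h1 h2).2.2.2.2) _ (by omega)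
  have hterm : ∀ k ∈ Finset.range (T / K - 1), Integrable (fun ω => 1 + K * α / 12 +
      11 / 320 / R ^ 2 * (5 * R * (‖g k ω‖ + 2 * R * (K * α)) +
        (‖g k ω‖ + 2 * R * (K * α)) ^ 2 / cbrtCurvature (K * α) (T₀ * α) (k + 1) ^ 2)) P ∧
      ∫ ω, (1 + K * α / 12 + 11 / 320 / R ^ 2 * (5 * R * (‖g k ω‖ + 2 * R * (K * α)) +
        (‖g k ω‖ + 2 * R * (K * α)) ^ 2 / cbrtCurvature (K * α) (T₀ * α) (k + 1) ^ 2)) ∂P ≤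
      1 + K * α / 12 + 11 / 320 / R ^ 2 * (5 * R * (V + 2 * R * (K * α)) +
        (V + 2 * R * (K * α)) ^ 2 / cbrtCurvature (K * α) (T₀ * α) (k + 1) ^ 2) := by
    intro k hk
    have hk : k < T / K := by have := Finset.mem_range.1 hk; omega
    have i1 := hrun.integrable_norm_block hs hk
    have i2 := hrun.integrable_norm_mul_norm_block hs hk hk
    have e1 := hrun.integral_norm_block_le hs hV0 hV hk
    have e2 := hrun.integral_norm_mul_norm_block_le hs hV hk hk
    set y := cbrtCurvature (K * α) (T₀ * α) (k + 1)
    set ρ := 2 * R * (K * α) with hρ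
    have hρ0 : 0 ≤ ρ := by positivity
    have heq : (fun ω => 1 + K * α / 12 + 11 / 320 / R ^ 2 * (5 * R * (‖g k ω‖ + ρ) +
        (‖g k ω‖ + ρ) ^ 2 / y ^ 2)) = fun ω => (1 + K * α / 12 + 11 / 320 / R ^ 2 *
          (5 * R * ρ + ρ ^ 2 / y ^ 2)) + ((11 / 320 / R ^ 2 * (5 * R + 2 * ρ / y ^ 2)) * ‖g k ω‖
          + (11 / 320 / R ^ 2 / y ^ 2) * (‖g k ω‖ * ‖g k ω‖)) := by
      ext ω; ring
    have i3 : Integrable (fun ω => (11 / 320 / R ^ 2 * (5 * R + 2 * ρ / y ^ 2)) * ‖g k ω‖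
          + (11 / 320 / R ^ 2 / y ^ 2) * (‖g k ω‖ * ‖g k ω‖)) P :=
      (i1.const_mul _).add (i2.const_mul _)
    rw [heq]
    refine ⟨(integrable_const _).add i3, ?_⟩
    rw [integral_add (integrable_const _) i3, integral_add (i1.const_mul _) (i2.const_mul _),
      integral_const, probReal_univ, one_smul, integral_const_mul, integral_const_mul]
    have h1 := mul_le_mul_of_nonneg_left e1
      (by positivity : 0 ≤ 11 / 320 / R ^ 2 * (5 * R + 2 * ρ / y ^ 2))
    have h2 := mul_le_mul_of_nonneg_left e2 (by positivity : 0 ≤ 11 / 320 / R ^ 2 / y ^ 2)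
    calc _ ≤ (1 + K * α / 12 + 11 / 320 / R ^ 2 * (5 * R * ρ + ρ ^ 2 / y ^ 2)) +
          ((11 / 320 / R ^ 2 * (5 * R + 2 * ρ / y ^ 2)) * V + (11 / 320 / R ^ 2 / y ^ 2) * V ^ 2) :=
          add_le_add_right (add_le_add h1 h2) _
      _ = _ := by ring
  have hbi : Integrable bound P := integrable_finsetSum _ fun k hk => (hterm k hk).1
  have hb0 : ∀ ω, 0 ≤ bound ω := fun ω => (Nat.cast_nonneg _).trans (hpath ω)
  calc ∫⁻ ω, ((∑ k ∈ Finset.range (T / K - 1), L ω (k + 1) : ℕ) : ENNReal) ∂P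
      ≤ ∫⁻ ω, ENNReal.ofReal (bound ω) ∂P := by
        refine lintegral_mono fun ω => ?_
        rw [← ENNReal.ofReal_natCast]
        exact ENNReal.ofReal_le_ofReal (hpath ω)
    _ = ENNReal.ofReal (∫ ω, bound ω ∂P) :=
        (ofReal_integral_eq_lintegral_ofReal hbi (Filter.Eventually.of_forall hb0)).symm
    _ ≤ ENNReal.ofReal B := by
        refine ENNReal.ofReal_le_ofReal (le_trans ?_ hle)
        rw [hbound, integral_finsetSum _ fun k hk => (hterm k hk).1]
        exact Finset.sum_le_sum fun k hk => (hterm k hk).2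

end IsBanditFWRun

end Expectation

/-! ### Sums of inverse powers of the curvature -/

lemma sum_inv_cbrt_le (N : ℕ) :
    ∑ k ∈ Finset.range N, 1 / ((k : ℝ) + 1) ^ (1 / 3 : ℝ) ≤
      3 / 2 * ((N : ℝ) ^ (1 / 3 : ℝ)) ^ 2 := by
  induction N with
  | zero => simp
  | succ N ih =>
    rw [Finset.sum_range_succ]
    have h1 : ((N : ℝ) ^ (1 / 3 : ℝ)) ^ 3 = N := cube_rpow_third (by positivity)
    have h2 : (((N : ℝ) + 1) ^ (1 / 3 : ℝ)) ^ 3 = (N : ℝ) + 1 := cube_rpow_third (by positivity)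
    have h3 : 0 < ((N : ℝ) + 1) ^ (1 / 3 : ℝ) := by positivity
    have h4 : 0 ≤ (N : ℝ) ^ (1 / 3 : ℝ) := by positivity
    push_cast
    set q := ((N : ℝ) + 1) ^ (1 / 3 : ℝ)
    set p := (N : ℝ) ^ (1 / 3 : ℝ)
    have h5 : 1 / q ≤ 3 / 2 * (q ^ 2 - p ^ 2) := by
      rw [div_le_iff₀ h3]
      have : 0 ≤ (q - p) ^ 2 * (q + 2 * p) := by positivity
      linarith
    linarith

lemma sum_inv_cbrt_sq_le (N : ℕ) :
    ∑ k ∈ Finset.range N, 1 / (((k : ℝ) + 1) ^ (1 / 3 : ℝ)) ^ 2 ≤ 3 * (N : ℝ) ^ (1 / 3 : ℝ) := by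
  induction N with
  | zero => simp
  | succ N ih =>
    rw [Finset.sum_range_succ]
    have h1 : ((N : ℝ) ^ (1 / 3 : ℝ)) ^ 3 = N := cube_rpow_third (by positivity)
    have h2 : (((N : ℝ) + 1) ^ (1 / 3 : ℝ)) ^ 3 = (N : ℝ) + 1 := cube_rpow_third (by positivity)
    have h3 : 0 < ((N : ℝ) + 1) ^ (1 / 3 : ℝ) := by positivity
    have h4 : 0 ≤ (N : ℝ) ^ (1 / 3 : ℝ) := by positivity
    push_cast
    set q := ((N : ℝ) + 1) ^ (1 / 3 : ℝ)
    set p := (N : ℝ) ^ (1 / 3 : ℝ)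
    have h5 : 1 / q ^ 2 ≤ 3 * (q - p) := by
      rw [div_le_iff₀ (by positivity)]
      have : 0 ≤ (q - p) ^ 2 * (2 * q + p) := by positivity
      linarith
    linarith

lemma sum_inv_succ_le (N : ℕ) :
    ∑ k ∈ Finset.range N, 1 / ((k : ℝ) + 1) ≤ 1 + Real.log N := by
  have h := harmonic_le_one_add_log N
  rw [harmonic] at h
  push_cast at h
  simpa using h

section CurvatureSums

variable {κ τ₀ : ℝ}

lemma mul_succ_le_curvature (hτ : κ ≤ τ₀) (k : ℕ) :
    κ * (k + 1) ≤ curvature κ τ₀ k := by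
  rw [curvature]; linarith

lemma le_cbrtCurvature (hκ : 0 < κ) (hτ : κ ≤ τ₀) (k : ℕ) :
    κ ^ (1 / 3 : ℝ) * ((k : ℝ) + 1) ^ (1 / 3 : ℝ) ≤ cbrtCurvature κ τ₀ k := by
  rw [cbrtCurvature, ← Real.mul_rpow hκ.le (by positivity)]
  exact Real.rpow_le_rpow (by positivity) (mul_succ_le_curvature hτ k) (by norm_num)

lemma curvature_le_curvature_succ (hκ : 0 < κ) (k : ℕ) :
    curvature κ τ₀ k ≤ curvature κ τ₀ (k + 1) := by
  rw [curvature_succ]; linarith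

lemma sum_inv_curvature_le (hκ : 0 < κ) (hτ : κ ≤ τ₀) (N : ℕ) :
    ∑ k ∈ Finset.range N, 1 / curvature κ τ₀ k ≤ (1 + Real.log N) / κ := by
  calc ∑ k ∈ Finset.range N, 1 / curvature κ τ₀ k
      ≤ ∑ k ∈ Finset.range N, 1 / ((k : ℝ) + 1) / κ := by
        refine Finset.sum_le_sum fun k _ => ?_
        rw [div_div, mul_comm]
        exact one_div_le_one_div_of_le (by positivity) (mul_succ_le_curvature hτ k)
    _ ≤ _ := by
        rw [← Finset.sum_div]
        gcongr
        exact sum_inv_succ_le N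

lemma sum_inv_cbrtCurvature_le (hκ : 0 < κ) (hτ : κ ≤ τ₀) (N : ℕ) :
    ∑ k ∈ Finset.range N, 1 / cbrtCurvature κ τ₀ k ≤
      3 / 2 * ((N : ℝ) ^ (1 / 3 : ℝ)) ^ 2 / κ ^ (1 / 3 : ℝ) := by
  calc ∑ k ∈ Finset.range N, 1 / cbrtCurvature κ τ₀ k
      ≤ ∑ k ∈ Finset.range N, 1 / ((k : ℝ) + 1) ^ (1 / 3 : ℝ) / κ ^ (1 / 3 : ℝ) := by
        refine Finset.sum_le_sum fun k _ => ?_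
        rw [div_div, mul_comm]
        exact one_div_le_one_div_of_le (by positivity) (le_cbrtCurvature hκ hτ k)
    _ ≤ _ := by
        rw [← Finset.sum_div]
        gcongr
        exact sum_inv_cbrt_le N

lemma sum_inv_cbrtCurvature_sq_le (hκ : 0 < κ) (hτ : κ ≤ τ₀) (N : ℕ) :
    ∑ k ∈ Finset.range N, 1 / cbrtCurvature κ τ₀ (k + 1) ^ 2 ≤
      3 * (N : ℝ) ^ (1 / 3 : ℝ) / (κ ^ (1 / 3 : ℝ)) ^ 2 := by
  calc ∑ k ∈ Finset.range N, 1 / cbrtCurvature κ τ₀ (k + 1) ^ 2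
      ≤ ∑ k ∈ Finset.range N, 1 / (((k : ℝ) + 1) ^ (1 / 3 : ℝ)) ^ 2 / (κ ^ (1 / 3 : ℝ)) ^ 2 := by
        refine Finset.sum_le_sum fun k _ => ?_
        rw [div_div, mul_comm, ← mul_pow]
        refine one_div_le_one_div_of_le (by positivity) ?_
        gcongr
        refine (le_cbrtCurvature hκ hτ k).trans ?_
        have := mul_succ_le_curvature hτ k
        exact Real.rpow_le_rpow (le_trans (by positivity) this)
          (curvature_le_curvature_succ hκ k) (by norm_num)
    _ ≤ _ := by
        rw [← Finset.sum_div]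
        gcongr
        exact sum_inv_cbrt_sq_le N

end CurvatureSums

/-! ### The bounds for `T = N ^ 3` rounds in blocks of length `N ^ 2` -/

/-- If `T ^ (2 / 3)` is an integer, then `T` is a perfect cube. -/
lemma exists_eq_pow_of_rpow {T K : ℕ} (hT : 1 ≤ T) (hK : (K : ℝ) = (T : ℝ) ^ (2 / 3 : ℝ)) :
    ∃ N : ℕ, 1 ≤ N ∧ K = N ^ 2 ∧ T = N ^ 3 := by
  have hT0 : (0 : ℝ) < T := by exact_mod_cast hT
  have h3 : K ^ 3 = T ^ 2 := by
    have : (K : ℝ) ^ 3 = (T : ℝ) ^ 2 := by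
      rw [hK, ← Real.rpow_natCast, ← Real.rpow_mul hT0.le, ← Real.rpow_natCast]
      norm_num
    exact_mod_cast this
  have hK0 : 0 < K := Nat.pos_of_ne_zero fun h => by
    rw [h] at h3
    have : 0 < T ^ 2 := by positivity
    omega
  have hdvd : K ∣ T := (Nat.pow_dvd_pow_iff two_ne_zero).1 (h3 ▸ pow_dvd_pow K (by norm_num))
  obtain ⟨N, rfl⟩ := hdvd
  have hKN : K = N ^ 2 := by
    have : K ^ 2 * K = K ^ 2 * N ^ 2 := by rw [← mul_pow, ← h3]; ring
    exact Nat.eq_of_mul_eq_mul_left (by positivity) this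
  refine ⟨N, Nat.pos_of_ne_zero fun h => ?_, hKN, by rw [hKN]; ring⟩
  simp [h] at hT

section Final

variable {n : ℕ} [Nontrivial (Vec n)] {𝒦 : Set (Vec n)} {r R G M α T₀ c : ℝ} {N : ℕ}
  {ε : ℕ → ℝ} {f F : ℕ → Vec n → ℝ} {Ω : Type*} {mΩ : MeasurableSpace Ω} {P : Measure Ω}
  {ℱ : Filtration ℕ mΩ} {u : ℕ → Ω → USphere n} {x : ℕ → Ω → Vec n} {z v : ℕ → ℕ → Ω → Vec n}

/-- For block length `N ^ 2` and radius `c / N` the two contributions to the second moment of a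
block estimate have the same order. -/
lemma sq_second_moment_le {K N w c G : ℝ} (hK : K = N ^ 2) (hN : 1 ≤ N) (hw : 0 ≤ w) (hc : 0 < c)
    (hG : 0 ≤ G) : K * (w / (c / N)) ^ 2 + (K * G) ^ 2 ≤ (K * (w / c + G)) ^ 2 := by
  subst hK
  have h : N ^ 2 * (w / (c / N)) ^ 2 = (N ^ 2 * (w / c)) ^ 2 := by field_simp
  rw [h]
  have : 0 ≤ N ^ 2 * (w / c) * (N ^ 2 * G) := by positivity
  nlinarith

namespace IsBanditFWRun

/-- The summed regret bound before the constants are rounded. -/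
lemma integral_regret_le_cube [IsProbabilityMeasure P] {T K : ℕ} {δ : ℝ}
    (hrun : IsBanditFWRun 𝒦 r T K α δ T₀ ε f P ℱ u x z v)
    (hs : BanditSetup 𝒦 r R G M α δ T₀ T K ε f F) (hN : 1 ≤ N) (hK : K = N ^ 2) (hT : T = N ^ 3)
    (hc : 0 < c) (hδ : δ = c / N) (hrR : r ≤ R) :
    ∫ ω, regret 𝒦 T K δ f (fun m => x m ω) (fun t => u t ω) ∂P ≤
      4 * c * R * G / r * K + 2 * R ^ 2 * α * T₀ + 15 / 2 * R * G / α ^ (1 / 3 : ℝ) * K +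
        (2 * (n * M / c + G) ^ 2 / α + 4 * (n * M / c + G) * R) * K * (1 + Real.log T) := by
  have hR := hs.R_pos
  have hα := hs.α_pos
  have hG := hs.G_pos
  have hM := hs.M_pos
  have hr := hs.r_pos
  have hN1 : (1 : ℝ) ≤ N := by exact_mod_cast hN
  have hKr : (K : ℝ) = (N : ℝ) ^ 2 := by rw [hK]; push_cast; rfl
  have hTr : (T : ℝ) = (N : ℝ) ^ 3 := by rw [hT]; push_cast; rfl
  have hK0 : (0 : ℝ) < K := by rw [hKr]; positivity
  have hTK : T / K = N := by
    rw [hT, hK, pow_succ]; exact Nat.mul_div_cancel_left _ (by positivity)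
  set D := n * M / c + G with hD
  have hD0 : 0 < D := by positivity
  have hV : (K : ℝ) * (n * M / δ) ^ 2 + (K * G) ^ 2 ≤ (K * D) ^ 2 := by
    rw [hδ]
    exact sq_second_moment_le hKr hN1 (by positivity) hc hG.le
  have hκ : 0 < K * α := by positivity
  have hτ : K * α ≤ T₀ * α := by
    have := hs.le_T₀
    gcongr
    linarith
  have hmain := hrun.integral_regret_le hs (by positivity : 0 < K * D) hV
  rw [hTK] at hmain
  refine hmain.trans ?_
  set W := (K * D) ^ 2 + 2 * R * (K * α) * (K * D) with hW
  have hW0 : 0 ≤ W := by positivity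
  have hcurv : ∀ k, 0 < curvature (K * α) (T₀ * α) k := fun k =>
    lt_of_lt_of_le (by positivity) (mul_succ_le_curvature hτ k)
  -- `3 G ≤ 3 G R / r`, and `T δ = c K`
  have h1 : T * (3 * δ * G + G * δ * R / r) ≤ 4 * c * R * G / r * K := by
    have e : (T : ℝ) * δ = c * K := by rw [hTr, hKr, hδ]; field_simp
    have e2 : 1 ≤ R / r := (one_le_div hr).2 hrR
    calc T * (3 * δ * G + G * δ * R / r) = T * δ * G * (3 * 1 + R / r) := by ring
      _ ≤ T * δ * G * (3 * (R / r) + R / r) := by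
          rw [e]
          gcongr
      _ = 4 * c * R * G / r * K := by rw [e]; ring
  have h2 : ∑ k ∈ Finset.range N, (K * G * (5 * R / cbrtCurvature (K * α) (T₀ * α) k) +
      (W / curvature (K * α) (T₀ * α) k + W / curvature (K * α) (T₀ * α) (k + 1))) ≤
      K * G * (5 * R) * ∑ k ∈ Finset.range N, 1 / cbrtCurvature (K * α) (T₀ * α) k +
        2 * W * ∑ k ∈ Finset.range N, 1 / curvature (K * α) (T₀ * α) k := by
    rw [Finset.mul_sum, Finset.mul_sum, ← Finset.sum_add_distrib]
    refine Finset.sum_le_sum fun k _ => ?_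
    have : W / curvature (K * α) (T₀ * α) (k + 1) ≤ W / curvature (K * α) (T₀ * α) k :=
      div_le_div_of_nonneg_left hW0 (hcurv k) (curvature_le_curvature_succ hκ k)
    calc _ ≤ K * G * (5 * R / cbrtCurvature (K * α) (T₀ * α) k) +
          (W / curvature (K * α) (T₀ * α) k + W / curvature (K * α) (T₀ * α) k) := by gcongr
      _ = _ := by ring
  have hroot : ((K : ℝ) * α) ^ (1 / 3 : ℝ) = ((N : ℝ) ^ (1 / 3 : ℝ)) ^ 2 * α ^ (1 / 3 : ℝ) := by
    rw [Real.mul_rpow hK0.le hα.le, hKr, ← Real.rpow_natCast, ← Real.rpow_mul (by positivity),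
      ← Real.rpow_natCast, ← Real.rpow_mul (by positivity)]
    norm_num
  have h3 : K * G * (5 * R) * ∑ k ∈ Finset.range N, 1 / cbrtCurvature (K * α) (T₀ * α) k ≤
      15 / 2 * R * G / α ^ (1 / 3 : ℝ) * K := by
    calc _ ≤ K * G * (5 * R) * (3 / 2 * ((N : ℝ) ^ (1 / 3 : ℝ)) ^ 2 / (K * α) ^ (1 / 3 : ℝ)) := by
          gcongr
          exact sum_inv_cbrtCurvature_le hκ hτ N
      _ = _ := by
          rw [hroot]
          field_simp
          ring
  have h4 : 2 * W * ∑ k ∈ Finset.range N, 1 / curvature (K * α) (T₀ * α) k ≤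
      (2 * D ^ 2 / α + 4 * D * R) * K * (1 + Real.log T) := by
    have hlog : Real.log N ≤ Real.log T := by
      rw [hTr]
      exact Real.log_le_log (by positivity) (le_self_pow₀ hN1 (by norm_num))
    calc _ ≤ 2 * W * ((1 + Real.log T) / (K * α)) := by
          gcongr
          refine (sum_inv_curvature_le hκ hτ N).trans ?_
          gcongr
      _ = _ := by
          rw [hW]
          field_simp
          ring
  linarith

/-- The summed bound on the oracle calls before the constants are rounded. -/
lemma expectedCallsLE_cube [IsProbabilityMeasure P] {T K : ℕ} {δ : ℝ}
    (hrun : IsBanditFWRun 𝒦 r T K α δ T₀ ε f P ℱ u x z v)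
    (hs : BanditSetup 𝒦 r R G M α δ T₀ T K ε f F) (hN : 1 ≤ N) (hK : K = N ^ 2) (hT : T = N ^ 3)
    (hc : 0 < c) (hδ : δ = c / N) {A : ℝ} (hA : A = n * M / (c * 2 * R) + G / (2 * R) + α) {B : ℝ}
    (hB : N + α * T / 12 + 11 / 32 * A * T +
      33 / 80 * (1 / (α ^ (1 / 3 : ℝ)) ^ 2 * A ^ 2) * T ≤ B) :
    ExpectedCallsLE T K α δ T₀ ε f P u x z v B := by
  have hR := hs.R_pos
  have hα := hs.α_pos
  have hG := hs.G_pos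
  have hM := hs.M_pos
  have hN1 : (1 : ℝ) ≤ N := by exact_mod_cast hN
  have hKr : (K : ℝ) = (N : ℝ) ^ 2 := by rw [hK]; push_cast; rfl
  have hTr : (T : ℝ) = (N : ℝ) ^ 3 := by rw [hT]; push_cast; rfl
  have hK0 : (0 : ℝ) < K := by rw [hKr]; positivity
  have hTK : T / K = N := by
    rw [hT, hK, pow_succ]; exact Nat.mul_div_cancel_left _ (by positivity)
  have hD0 : 0 < n * M / c + G := by positivity
  have hV : (K : ℝ) * (n * M / δ) ^ 2 + (K * G) ^ 2 ≤ (K * (n * M / c + G)) ^ 2 := by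
    rw [hδ]
    exact sq_second_moment_le hKr hN1 (by positivity) hc hG.le
  have hκ : 0 < K * α := by positivity
  have hτ : K * α ≤ T₀ * α := by
    have := hs.le_T₀
    gcongr
    linarith
  have hA0 : 0 < A := by rw [hA]; positivity
  refine hrun.expectedCallsLE hs (by positivity : 0 < K * (n * M / c + G)) hV (le_trans ?_ hB)
  have hVA : K * (n * M / c + G) + 2 * R * (K * α) = 2 * R * K * A := by
    rw [hA]; field_simp
  rw [hVA, hTK]
  have hp : ((N : ℝ) ^ (1 / 3 : ℝ)) ^ 3 = N := cube_rpow_third (by positivity)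
  have hroot : ((K : ℝ) * α) ^ (1 / 3 : ℝ) = ((N : ℝ) ^ (1 / 3 : ℝ)) ^ 2 * α ^ (1 / 3 : ℝ) := by
    rw [Real.mul_rpow hK0.le hα.le, hKr, ← Real.rpow_natCast, ← Real.rpow_mul (by positivity),
      ← Real.rpow_natCast, ← Real.rpow_mul (by positivity)]
    norm_num
  calc _ ≤ ∑ k ∈ Finset.range N, (1 + K * α / 12 + 11 / 320 / R ^ 2 *
        (5 * R * (2 * R * K * A) +
          (2 * R * K * A) ^ 2 / cbrtCurvature (K * α) (T₀ * α) (k + 1) ^ 2)) := by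
        refine Finset.sum_le_sum_of_subset_of_nonneg
          (Finset.range_subset_range.2 (Nat.sub_le N 1)) fun k _ _ => ?_
        positivity
    _ = N * (1 + K * α / 12 + 11 / 32 * K * A) + 11 / 80 * K ^ 2 * A ^ 2 *
          ∑ k ∈ Finset.range N, 1 / cbrtCurvature (K * α) (T₀ * α) (k + 1) ^ 2 := by
        rw [Finset.mul_sum, show (N : ℝ) * (1 + K * α / 12 + 11 / 32 * K * A) =
          ∑ k ∈ Finset.range N, (1 + K * α / 12 + 11 / 32 * K * A) by
            rw [Finset.sum_const, Finset.card_range, nsmul_eq_mul],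
          ← Finset.sum_add_distrib]
        refine Finset.sum_congr rfl fun k _ => ?_
        field_simp
        ring
    _ ≤ N * (1 + K * α / 12 + 11 / 32 * K * A) + 11 / 80 * K ^ 2 * A ^ 2 *
          (3 * (N : ℝ) ^ (1 / 3 : ℝ) / ((K * α) ^ (1 / 3 : ℝ)) ^ 2) := by
        gcongr
        exact sum_inv_cbrtCurvature_sq_le hκ hτ N
    _ = _ := by
        have hp0 : 0 < (N : ℝ) ^ (1 / 3 : ℝ) := by positivity
        have ha0 : 0 < α ^ (1 / 3 : ℝ) := by positivity
        rw [hroot, hTr, hKr]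
        set p := (N : ℝ) ^ (1 / 3 : ℝ)
        rw [← hp]
        field_simp
        ring

end IsBanditFWRun

end Final

/-! ### Arbitrary and optimized smoothing parameters -/

/-- Real-valued Lipschitz functions extend from `𝒦` to the whole space with the same constant. -/
lemma exists_banditSetup {n T K : ℕ} {𝒦 : Set (Vec n)} {r R α G M δ T₀ : ℝ} {ε : ℕ → ℝ}
    {f : ℕ → Vec n → ℝ}
    (h𝒦conv : Convex ℝ 𝒦) (h𝒦comp : IsCompact 𝒦)
    (hr : 0 < r) (hr𝒦 : Metric.closedBall 0 r ⊆ 𝒦) (h𝒦R : 𝒦 ⊆ Metric.closedBall 0 R)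
    (hα : 0 < α) (hG : 0 < G) (hM : 0 < M)
    (hf_strong : ∀ t ∈ Finset.Icc 1 T, StrongConvexOn 𝒦 α (f t))
    (hf_lip : ∀ t ∈ Finset.Icc 1 T, ∀ a ∈ 𝒦, ∀ b ∈ 𝒦, |f t a - f t b| ≤ G * ‖a - b‖)
    (hf_bdd : ∀ t ∈ Finset.Icc 1 T, ∀ a ∈ 𝒦, |f t a| ≤ M)
    (hT₀ : T₀ = max (4 * (K : ℝ)) (8 / α))
    (hε : ∀ m, ε m = 16 * R ^ 2 * (α * (m * K + T₀)) ^ (1 / 3 : ℝ))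
    (hδ : 0 < δ) (hδr : δ ≤ r) (hK : 1 ≤ K) (hdvd : T / K * K = T) :
    ∃ F, BanditSetup 𝒦 r R G M α δ T₀ T K ε f F := by
  have hext : ∀ t, ∃ F : Vec n → ℝ, t ∈ Finset.Icc 1 T →
      Set.EqOn (f t) F 𝒦 ∧ ∀ a b, |F a - F b| ≤ G * ‖a - b‖ := by
    intro t
    by_cases ht : t ∈ Finset.Icc 1 T
    · have hl : LipschitzOnWith ⟨G, hG.le⟩ (f t) 𝒦 :=
        LipschitzOnWith.of_dist_le_mul fun a ha b hb => by
          rw [Real.dist_eq, dist_eq_norm]; exact hf_lip t ht a ha b hb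
      obtain ⟨F, hF, hEq⟩ := hl.extend_real
      refine ⟨F, fun _ => ⟨hEq, fun a b => ?_⟩⟩
      have := hF.dist_le_mul a b
      rwa [Real.dist_eq, dist_eq_norm] at this
    · exact ⟨f t, fun h => absurd h ht⟩
  choose F hF using hext
  exact ⟨F, h𝒦conv, h𝒦comp, hr, hr𝒦, h𝒦R, hα, hG, hM, hδ, hδr, hK, hT₀ ▸ le_max_left _ _,
    hT₀ ▸ le_max_right _ _, hdvd, hε, hf_strong, hf_bdd, fun t ht => (hF t ht).1,
    fun t ht => (hF t ht).2⟩

/-- Completing the square in the stability term. -/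
lemma regret_square_eq {w c G α R : ℝ} (hα : 0 < α) :
    (2 * w / (c * √α) + 2 * G / √α + 4 * R * √α) ^ 2 =
      4 * (w / c + G) ^ 2 / α + 16 * (w / c + G) * R + 16 * R ^ 2 * α := by
  have hs : 0 < √α := Real.sqrt_pos.2 hα
  have h2 : α = √α ^ 2 := (Real.sq_sqrt hα.le).symm
  have e : 2 * w / (c * √α) = 2 * (w / c) / √α := by rw [← div_div]; ring
  rw [e]
  set D := w / c
  set s := √α
  rw [h2]
  field_simp
  ring

/-- The identities behind the optimized smoothing parameter, proved by writing all quantities as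
cubes, and `α` as a sixth power. -/
lemma optimal_smoothing {w G R r α L c : ℝ} (hw : 0 < w) (hG : 0 < G) (hR : 0 < R) (hr : 0 < r)
    (hα : 0 < α) (hL : 0 < L) (hc : c = (r * w ^ 2 * L / (G * R * α)) ^ (1 / 3 : ℝ)) :
    4 * (w * G * R) ^ (2 / 3 : ℝ) * L ^ (1 / 3 : ℝ) / (α ^ (1 / 3 : ℝ) * r ^ (2 / 3 : ℝ)) =
      4 * c * R * G / r ∧
    2 * (w * G * R) ^ (1 / 3 : ℝ) / (α ^ (1 / 6 : ℝ) * r ^ (1 / 3 : ℝ) * L ^ (1 / 3 : ℝ)) =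
      2 * w / (c * √α) ∧
    (w * G * α) ^ (1 / 3 : ℝ) / (2 * r ^ (1 / 3 : ℝ) * R ^ (2 / 3 : ℝ) * L ^ (1 / 3 : ℝ)) =
      w / (c * 2 * R) := by
  have key : ∀ {a : ℝ}, 0 < a → ∃ b, 0 < b ∧ a = b ^ 3 := fun {a} ha =>
    ⟨a ^ (1 / 3 : ℝ), by positivity, (cube_rpow_third ha.le).symm⟩
  obtain ⟨w, hw', rfl⟩ := key hw
  obtain ⟨G, hG', rfl⟩ := key hG
  obtain ⟨R, hR', rfl⟩ := key hR
  obtain ⟨r, hr', rfl⟩ := key hr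
  obtain ⟨L, hL', rfl⟩ := key hL
  obtain ⟨a, ha, rfl⟩ := key hα
  obtain ⟨s, hs, rfl⟩ : ∃ s, 0 < s ∧ a = s ^ 2 :=
    ⟨√a, Real.sqrt_pos.2 ha, (Real.sq_sqrt ha.le).symm⟩
  have r1 : ∀ {b : ℝ}, 0 < b → (b ^ 3) ^ (1 / 3 : ℝ) = b := fun {b} hb => by
    rw [← Real.rpow_natCast, ← Real.rpow_mul hb.le]; norm_num
  have r2 : ∀ {b : ℝ}, 0 < b → (b ^ 3) ^ (2 / 3 : ℝ) = b ^ 2 := fun {b} hb => by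
    rw [← Real.rpow_natCast, ← Real.rpow_mul hb.le, ← Real.rpow_natCast]; norm_num
  have r3 : ((s ^ 2) ^ 3) ^ (1 / 6 : ℝ) = s := by
    rw [← pow_mul, ← Real.rpow_natCast, ← Real.rpow_mul hs.le]; norm_num
  have r4 : √((s ^ 2) ^ 3) = s ^ 3 := by
    rw [← pow_mul, mul_comm, pow_mul, Real.sqrt_sq (by positivity)]
  have e1 : r ^ 3 * (w ^ 3) ^ 2 * L ^ 3 / (G ^ 3 * R ^ 3 * (s ^ 2) ^ 3) =
      (r * w ^ 2 * L / (G * R * s ^ 2)) ^ 3 := by field_simp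
  rw [e1, r1 (by positivity)] at hc
  have e2 : w ^ 3 * G ^ 3 * R ^ 3 = (w * G * R) ^ 3 := by ring
  have e3 : w ^ 3 * G ^ 3 * (s ^ 2) ^ 3 = (w * G * s ^ 2) ^ 3 := by ring
  rw [e2, e3, r2 (by positivity), r1 hL', r1 (by positivity), r2 hr', r1 (by positivity), r3, r4,
    r1 hr', r1 (by positivity), r2 hR', hc]
  refine ⟨?_, ?_, ?_⟩ <;> field_simp

/-- The optimized smoothing parameter is admissible. -/
lemma optimal_smoothing_admissible {w G R r α L c T : ℝ} (hw : 0 < w) (hG : 0 < G) (hR : 0 < R)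
    (hr : 0 < r) (hα : 0 < α) (hL : 0 < L) (hT : 0 < T)
    (hc : c = (r * w ^ 2 * L / (G * R * α)) ^ (1 / 3 : ℝ))
    (h : w ^ 2 * L / (r ^ 2 * G * R * α) ≤ T) : c * T ^ (-(1 / 3) : ℝ) / r ≤ 1 := by
  have h1 : c ≤ r * T ^ (1 / 3 : ℝ) := by
    refine le_of_pow_le_pow_left₀ three_ne_zero (by positivity) ?_
    rw [hc, mul_pow, cube_rpow_third (by positivity), cube_rpow_third hT.le]
    calc r * w ^ 2 * L / (G * R * α) = r ^ 3 * (w ^ 2 * L / (r ^ 2 * G * R * α)) := by field_simp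
      _ ≤ _ := by gcongr
  rw [Real.rpow_neg hT.le, div_le_one hr, ← div_eq_mul_inv, div_le_iff₀ (by positivity)]
  exact h1

/-- The bounds for an arbitrary admissible smoothing parameter `c`. -/
theorem expected_bounds {n T K : ℕ} (hn : 1 ≤ n) (hT : 1 ≤ T)
    (hK : (K : ℝ) = (T : ℝ) ^ (2 / 3 : ℝ))
    {𝒦 : Set (Vec n)} (h𝒦conv : Convex ℝ 𝒦) (h𝒦comp : IsCompact 𝒦)
    {r R : ℝ} (hr : 0 < r) (hr𝒦 : Metric.closedBall 0 r ⊆ 𝒦) (h𝒦R : 𝒦 ⊆ Metric.closedBall 0 R)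
    {α G M : ℝ} (hα : 0 < α) (hG : 0 < G) (hM : 0 < M)
    {f : ℕ → Vec n → ℝ}
    (hf_strong : ∀ t ∈ Finset.Icc 1 T, StrongConvexOn 𝒦 α (f t))
    (hf_lip : ∀ t ∈ Finset.Icc 1 T, ∀ a ∈ 𝒦, ∀ b ∈ 𝒦, |f t a - f t b| ≤ G * ‖a - b‖)
    (hf_bdd : ∀ t ∈ Finset.Icc 1 T, ∀ a ∈ 𝒦, |f t a| ≤ M)
    {T₀ : ℝ} (hT₀ : T₀ = max (4 * (T : ℝ) ^ (2 / 3 : ℝ)) (8 / α))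
    {ε : ℕ → ℝ} (hε : ∀ m, ε m = 16 * R ^ 2 * (α * (m * K + T₀)) ^ (1 / 3 : ℝ))
    {Ω : Type*} [mΩ : MeasurableSpace Ω] (P : Measure Ω) [IsProbabilityMeasure P]
    (ℱ : Filtration ℕ mΩ) (u : ℕ → Ω → USphere n) (x : ℕ → Ω → Vec n)
    (z v : ℕ → ℕ → Ω → Vec n) :
    ∀ c δ : ℝ, 0 < c → c * (T : ℝ) ^ (-(1 / 3) : ℝ) / r ≤ 1 →
      δ = c * (T : ℝ) ^ (-(1 / 3) : ℝ) →
      IsBanditFWRun 𝒦 r T K α δ T₀ ε f P ℱ u x z v →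
      ExpectedRegretLE 𝒦 T K δ f P u x
        ((4 * c * R * G / r + 2 * R ^ 2 * α + 16 * R * G / α ^ (1 / 3 : ℝ))
            * (T : ℝ) ^ (2 / 3 : ℝ) + 16 * R ^ 2
          + (2 * n * M / (c * √α) + 2 * G / √α + 4 * R * √α) ^ 2
            * (T : ℝ) ^ (2 / 3 : ℝ) * (1 + Real.log T)) ∧
      (2 ≤ α * (T : ℝ) ^ (2 / 3 : ℝ) → 1 ≤ α ^ (1 / 3 : ℝ) * (1 + Real.log T) →
        ExpectedRegretLE 𝒦 T K δ f P u x
          ((4 * c * R * G / r + 2 * R ^ 2 * α + 4 * G / α ^ (1 / 3 : ℝ))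
              * (T : ℝ) ^ (2 / 3 : ℝ)
            + (2 * n * M / (c * √α) + 2 * G / √α + 4 * R * √α) ^ 2
              * (T : ℝ) ^ (2 / 3 : ℝ) * (1 + Real.log T))) ∧
      ExpectedCallsLE T K α δ T₀ ε f P u x z v
        ((n * M / (c * 2 * R) + G / (2 * R) + α) * T
          + 1 / α ^ (2 / 3 : ℝ) * (n * M / (c * 2 * R) + G / (2 * R) + α) ^ 2 * T
          + (T : ℝ) ^ (1 / 3 : ℝ)) ∧
      (2 ≤ α * (T : ℝ) ^ (2 / 3 : ℝ) →
        ExpectedCallsLE T K α δ T₀ ε f P u x z v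
          ((n * M / (c * 2 * R) + G / (2 * R) + α) * T
            + 1 / α ^ (2 / 3 : ℝ) * (n * M / (c * 2 * R) + G / (2 * R) + α) ^ 2 * T)) := by
  intro c δ hc hcr hδ hrun
  have : Nontrivial (Vec n) := Module.nontrivial_of_finrank_pos (R := ℝ) (by
    rw [finrank_euclideanSpace_fin]; omega)
  obtain ⟨N, hN, hKN, hTN⟩ := exists_eq_pow_of_rpow hT hK
  have hN1 : (1 : ℝ) ≤ N := by exact_mod_cast hN
  have hKr : (K : ℝ) = (N : ℝ) ^ 2 := by rw [hKN]; push_cast; rfl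
  have hTr : (T : ℝ) = (N : ℝ) ^ 3 := by rw [hTN]; push_cast; rfl
  have hT13 : (T : ℝ) ^ (1 / 3 : ℝ) = N := by
    rw [hTr, ← Real.rpow_natCast, ← Real.rpow_mul (by positivity)]; norm_num
  have hTinv : (T : ℝ) ^ (-(1 / 3) : ℝ) = 1 / N := by
    rw [Real.rpow_neg (by positivity), hT13, one_div]
  have ha23 : α ^ (2 / 3 : ℝ) = (α ^ (1 / 3 : ℝ)) ^ 2 := by
    rw [← Real.rpow_natCast, ← Real.rpow_mul hα.le]; norm_num
  rw [hTinv, mul_one_div] at hδ hcr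
  rw [← hK] at hT₀
  rw [← hK, hT13, ha23]
  have hK1 : 1 ≤ K := by rw [hKN]; exact Nat.one_le_pow _ _ hN
  have hK0 : (0 : ℝ) < K := by exact_mod_cast hK1
  have hdvd : T / K * K = T := Nat.div_mul_cancel (by
    rw [hKN, hTN]; exact pow_dvd_pow N (by norm_num))
  have hrR : r ≤ R := radius_le hr hr𝒦 h𝒦R
  have hR : 0 < R := hr.trans_le hrR
  have hδ0 : 0 < δ := by rw [hδ]; positivity
  obtain ⟨F, hs⟩ := exists_banditSetup h𝒦conv h𝒦comp hr hr𝒦 h𝒦R hα hG hM hf_strong hf_lip hf_bdd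
    hT₀ hε hδ0 (by rw [hδ]; exact (div_le_one hr).1 hcr) hK1 hdvd
  have hint := hrun.integrable_regret hs
  have hreg := hrun.integral_regret_le_cube hs hN hKN hTN hc hδ hrR
  have hlog : 0 ≤ Real.log T := Real.log_nonneg (by exact_mod_cast hT)
  have ha : 0 < α ^ (1 / 3 : ℝ) := by positivity
  have hsq : (2 * n * M / (c * √α) + 2 * G / √α + 4 * R * √α) ^ 2 =
      4 * (n * M / c + G) ^ 2 / α + 16 * (n * M / c + G) * R + 16 * R ^ 2 * α := by
    rw [← regret_square_eq hα]; ring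
  rw [hsq]
  set D := n * M / c + G with hD
  have hGD : G ≤ D := by
    have : 0 ≤ n * M / c := by positivity
    linarith
  have hD0 : 0 < D := hG.trans_le hGD
  set A := n * M / (c * 2 * R) + G / (2 * R) + α with hA
  have hαA : α ≤ A := by
    have : 0 ≤ n * M / (c * 2 * R) + G / (2 * R) := by positivity
    linarith
  set a := α ^ (1 / 3 : ℝ)
  have hαT : α * T ≤ A * T := by gcongr
  have hNT : (N : ℝ) * K = T := by rw [hKr, hTr]; ring
  have hquad : 0 ≤ 1 / a ^ 2 * A ^ 2 * T := by positivity
  have hαT0 : 0 ≤ α * T := by positivity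
  -- pieces of the squared term, which exceeds what the stability of the iterates uses up
  have hKL : (K : ℝ) ≤ K * (1 + Real.log T) := le_mul_of_one_le_right hK0.le (by linarith)
  have hsp1 : 0 ≤ D ^ 2 / α * (K * (1 + Real.log T)) := by positivity
  have hsp2 : R ^ 2 * α * K ≤ R ^ 2 * α * (K * (1 + Real.log T)) := by gcongr
  have hsp3 : 0 ≤ D * R * (K * (1 + Real.log T)) := by positivity
  have hsp4 : 0 ≤ R ^ 2 * α * K := by positivity
  refine ⟨⟨hint, hreg.trans ?_⟩, fun h2 h1 => ⟨hint, hreg.trans ?_⟩, ?_, fun h2 => ?_⟩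
  · have e1 : T₀ ≤ 4 * K + 8 / α := by
      rw [hT₀]
      exact max_le (le_add_of_nonneg_right (by positivity))
        (le_add_of_nonneg_left (by positivity))
    have e2 : 2 * R ^ 2 * α * T₀ ≤ 8 * (R ^ 2 * α * K) + 16 * R ^ 2 := by
      calc _ ≤ 2 * R ^ 2 * α * (4 * K + 8 / α) := by gcongr
        _ = _ := by field_simp; ring
    have e3 : 0 ≤ R * G / a * K := by positivity
    linear_combination e2 + (17 / 2) * e3 + 2 * hsp1 + 16 * hsp2 + 12 * hsp3 + 10 * hsp4
  · have e1 : T₀ = 4 * K := by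
      rw [hT₀]
      refine max_eq_left ?_
      rw [div_le_iff₀ hα]
      linarith
    have e2 : 1 / a ≤ 1 + Real.log T := by
      rw [div_le_iff₀ ha]
      linarith
    have e3 : 15 / 2 * R * G / a * K ≤ 12 * (D * R * (K * (1 + Real.log T))) := by
      calc 15 / 2 * R * G / a * K = 15 / 2 * (G * R * (K * (1 / a))) := by ring
        _ ≤ 12 * (D * R * (K * (1 + Real.log T))) := by gcongr; norm_num
    have e4 : 0 ≤ G / a * K := by positivity
    rw [e1]
    linear_combination e3 + 4 * e4 + 2 * hsp1 + 16 * hsp2 + 10 * hsp4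
  · refine hrun.expectedCallsLE_cube hs hN hKN hTN hc hδ hA ?_
    linarith
  · refine hrun.expectedCallsLE_cube hs hN hKN hTN hc hδ hA ?_
    have : (N : ℝ) * 2 ≤ α * T := by
      calc (N : ℝ) * 2 ≤ N * (α * K) := by gcongr
        _ = α * T := by rw [← hNT]; ring
    linarith

theorem theorem2 {n T K : ℕ} (hn : 1 ≤ n) (hT : 1 ≤ T)
    (hK : (K : ℝ) = (T : ℝ) ^ (2 / 3 : ℝ))
    {𝒦 : Set (Vec n)} (h𝒦conv : Convex ℝ 𝒦) (h𝒦comp : IsCompact 𝒦)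
    {r R : ℝ} (hr : 0 < r) (hr𝒦 : Metric.closedBall 0 r ⊆ 𝒦) (h𝒦R : 𝒦 ⊆ Metric.closedBall 0 R)
    {α G M : ℝ} (hα : 0 < α) (hG : 0 < G) (hM : 0 < M)
    {f : ℕ → Vec n → ℝ}
    (hf_strong : ∀ t ∈ Finset.Icc 1 T, StrongConvexOn 𝒦 α (f t))
    (hf_lip : ∀ t ∈ Finset.Icc 1 T, ∀ a ∈ 𝒦, ∀ b ∈ 𝒦, |f t a - f t b| ≤ G * ‖a - b‖)
    (hf_bdd : ∀ t ∈ Finset.Icc 1 T, ∀ a ∈ 𝒦, |f t a| ≤ M)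
    {T₀ : ℝ} (hT₀ : T₀ = max (4 * (T : ℝ) ^ (2 / 3 : ℝ)) (8 / α))
    {ε : ℕ → ℝ} (hε : ∀ m, ε m = 16 * R ^ 2 * (α * (m * K + T₀)) ^ (1 / 3 : ℝ))
    {Ω : Type*} [mΩ : MeasurableSpace Ω] (P : Measure Ω) [IsProbabilityMeasure P]
    (ℱ : Filtration ℕ mΩ) (u : ℕ → Ω → USphere n) (x : ℕ → Ω → Vec n)
    (z v : ℕ → ℕ → Ω → Vec n) :
    -- an arbitrary admissible smoothing parameter
    (∀ c δ : ℝ, 0 < c → c * (T : ℝ) ^ (-(1 / 3) : ℝ) / r ≤ 1 →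
      δ = c * (T : ℝ) ^ (-(1 / 3) : ℝ) →
      IsBanditFWRun 𝒦 r T K α δ T₀ ε f P ℱ u x z v →
      ExpectedRegretLE 𝒦 T K δ f P u x
        ((4 * c * R * G / r + 2 * R ^ 2 * α + 16 * R * G / α ^ (1 / 3 : ℝ))
            * (T : ℝ) ^ (2 / 3 : ℝ) + 16 * R ^ 2
          + (2 * n * M / (c * √α) + 2 * G / √α + 4 * R * √α) ^ 2
            * (T : ℝ) ^ (2 / 3 : ℝ) * (1 + Real.log T)) ∧
      (2 ≤ α * (T : ℝ) ^ (2 / 3 : ℝ) → 1 ≤ α ^ (1 / 3 : ℝ) * (1 + Real.log T) →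
        ExpectedRegretLE 𝒦 T K δ f P u x
          ((4 * c * R * G / r + 2 * R ^ 2 * α + 4 * G / α ^ (1 / 3 : ℝ))
              * (T : ℝ) ^ (2 / 3 : ℝ)
            + (2 * n * M / (c * √α) + 2 * G / √α + 4 * R * √α) ^ 2
              * (T : ℝ) ^ (2 / 3 : ℝ) * (1 + Real.log T))) ∧
      ExpectedCallsLE T K α δ T₀ ε f P u x z v
        ((n * M / (c * 2 * R) + G / (2 * R) + α) * T
          + 1 / α ^ (2 / 3 : ℝ) * (n * M / (c * 2 * R) + G / (2 * R) + α) ^ 2 * T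
          + (T : ℝ) ^ (1 / 3 : ℝ)) ∧
      (2 ≤ α * (T : ℝ) ^ (2 / 3 : ℝ) →
        ExpectedCallsLE T K α δ T₀ ε f P u x z v
          ((n * M / (c * 2 * R) + G / (2 * R) + α) * T
            + 1 / α ^ (2 / 3 : ℝ) * (n * M / (c * 2 * R) + G / (2 * R) + α) ^ 2 * T))) ∧
    -- the optimized smoothing parameter
    (∀ c δ : ℝ, 2 ≤ T → (n * M) ^ 2 * Real.log T / (r ^ 2 * G * R * α) ≤ T →
      c = (r * (n * M) ^ 2 * Real.log T / (G * R * α)) ^ (1 / 3 : ℝ) →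
      δ = c * (T : ℝ) ^ (-(1 / 3) : ℝ) →
      IsBanditFWRun 𝒦 r T K α δ T₀ ε f P ℱ u x z v →
      ExpectedRegretLE 𝒦 T K δ f P u x
        ((4 * (n * M * G * R) ^ (2 / 3 : ℝ) * Real.log T ^ (1 / 3 : ℝ)
              / (α ^ (1 / 3 : ℝ) * r ^ (2 / 3 : ℝ))
            + 2 * R ^ 2 * α + 16 * R * G / α ^ (1 / 3 : ℝ)) * (T : ℝ) ^ (2 / 3 : ℝ)
          + 16 * R ^ 2
          + (2 * (n * M * G * R) ^ (1 / 3 : ℝ)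
                / (α ^ (1 / 6 : ℝ) * r ^ (1 / 3 : ℝ) * Real.log T ^ (1 / 3 : ℝ))
              + 2 * G / √α + 4 * R * √α) ^ 2
            * (T : ℝ) ^ (2 / 3 : ℝ) * (1 + Real.log T)) ∧
      (2 ≤ α * (T : ℝ) ^ (2 / 3 : ℝ) → 1 ≤ α ^ (1 / 3 : ℝ) * (1 + Real.log T) →
        ExpectedRegretLE 𝒦 T K δ f P u x
          ((4 * (n * M * G * R) ^ (2 / 3 : ℝ) * Real.log T ^ (1 / 3 : ℝ)
                / (α ^ (1 / 3 : ℝ) * r ^ (2 / 3 : ℝ))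
              + 2 * R ^ 2 * α + 4 * G / α ^ (1 / 3 : ℝ)) * (T : ℝ) ^ (2 / 3 : ℝ)
            + (2 * (n * M * G * R) ^ (1 / 3 : ℝ)
                  / (α ^ (1 / 6 : ℝ) * r ^ (1 / 3 : ℝ) * Real.log T ^ (1 / 3 : ℝ))
                + 2 * G / √α + 4 * R * √α) ^ 2
              * (T : ℝ) ^ (2 / 3 : ℝ) * (1 + Real.log T))) ∧
      ExpectedCallsLE T K α δ T₀ ε f P u x z v
        (((n * M * G * α) ^ (1 / 3 : ℝ)
              / (2 * r ^ (1 / 3 : ℝ) * R ^ (2 / 3 : ℝ) * Real.log T ^ (1 / 3 : ℝ))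
            + G / (2 * R) + α) * T
          + 1 / α ^ (2 / 3 : ℝ)
            * ((n * M * G * α) ^ (1 / 3 : ℝ)
                / (2 * r ^ (1 / 3 : ℝ) * R ^ (2 / 3 : ℝ) * Real.log T ^ (1 / 3 : ℝ))
              + G / (2 * R) + α) ^ 2 * T
          + (T : ℝ) ^ (1 / 3 : ℝ)) ∧
      (2 ≤ α * (T : ℝ) ^ (2 / 3 : ℝ) →
        ExpectedCallsLE T K α δ T₀ ε f P u x z v
          (((n * M * G * α) ^ (1 / 3 : ℝ)
                / (2 * r ^ (1 / 3 : ℝ) * R ^ (2 / 3 : ℝ) * Real.log T ^ (1 / 3 : ℝ))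
              + G / (2 * R) + α) * T
            + 1 / α ^ (2 / 3 : ℝ)
              * ((n * M * G * α) ^ (1 / 3 : ℝ)
                  / (2 * r ^ (1 / 3 : ℝ) * R ^ (2 / 3 : ℝ) * Real.log T ^ (1 / 3 : ℝ))
                + G / (2 * R) + α) ^ 2 * T))) := by
  have hmain := expected_bounds hn hT hK h𝒦conv h𝒦comp hr hr𝒦 h𝒦R hα hG hM hf_strong hf_lip hf_bdd
    hT₀ hε P ℱ u x z v
  refine ⟨hmain, fun c δ hT2 hcond hc hδ hrun => ?_⟩
  have : Nontrivial (Vec n) := Module.nontrivial_of_finrank_pos (R := ℝ) (by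
    rw [finrank_euclideanSpace_fin]; omega)
  have hR : 0 < R := hr.trans_le (radius_le hr hr𝒦 h𝒦R)
  have hw : 0 < n * M := mul_pos (by exact_mod_cast hn) hM
  have hL : 0 < Real.log T := Real.log_pos (by exact_mod_cast hT2)
  have hadm := optimal_smoothing_admissible hw hG hR hr hα hL (by exact_mod_cast hT) hc hcond
  obtain ⟨e1, e2, e3⟩ := optimal_smoothing hw hG hR hr hα hL hc
  rw [e1, e2, e3, ← mul_assoc 2 (n : ℝ) M]
  exact hmain c δ (by rw [hc]; positivity) hadm hδ hrun

end
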